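/- An instance of \textsc{DAG Partitioning} consists of a directed acyclic graph $G=(V,A)$ with positive integer arc weights $\omega\colon A\to\mathbb N$ and a positive integer $k$. The question is whether there is a set $S\subseteq A$ with $\sum_{a\in S}\omega(a)\le k$ such that each weakly connected component of $(V,A\setminus S)$ has exactly one sink (vertex without outgoing arcs). A tree decomposition of $G$ consists of a rooted tree $T$ and a bag $V_x\subseteq V$ for each node $x$ of $T$ such that every vertex lies in some bag, the two endpoints of every arc lie together in some bag, and, for each vertex $v$, the nodes $x$ with $v\in V_x$ induce a subtree of $T$. Its width is one less than the size of its largest bag (read as $0$ if all bags, and hence $G$, are empty). Theorem. Given, together with the instance, a tree decomposition of width $t$ of the underlying undirected graph of $G$, \textsc{DAG Partitioning} can be solved in $2^{O(t^2)}\cdot n$ time, where $n=|V|$. Precisely: there is one program $P$ for a random access machine with uniform cost (registers and memory cells holding natural numbers, with memory initially zero apart from the input; unit-cost addition, truncated subtraction, indirect memory access and zero tests) that, given the arc list with weights, the number $k$, and a width-$t$ tree decomposition with $N$ nodes (parent pointers and a list of the elements of each bag, all in arbitrary order), halts with the correct yes/no answer, such that 1. there is a constant $C$ such that $P$ always halts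 within $2^{C(t^2+1)}\cdot(n+N)$ steps; 2. hence, for every constant $a$ there is a constant $C$ such that $P$ halts within $2^{C(t^2+1)}\cdot n$ steps whenever the given tree decomposition has $N\le a\,(t+1)\,n$ nodes, as is usually assumed of a tree decomposition given as input. -/

import Mathlib

namespace DAGPart

/-! ### The problem DAG Partitioning

A finite directed graph on the vertex set `V` is given by its finite set of arcs `A ⊆ V × V`. -/

section Graph

variable {V : Type*}

/-- The underlying undirected graph. -/
def underlying (A : Finset (V × V)) : SimpleGraph V :=
  SimpleGraph.fromRel fun u v => (u, v) ∈ A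

/-- No vertex lies on a directed cycle (in particular there are no loops). -/
def IsAcyclic (A : Finset (V × V)) : Prop :=
  ∀ v, ¬ Relation.TransGen (fun u w => (u, w) ∈ A) v v

/-- A sink is a vertex without outgoing arcs. -/
def IsSink (A : Finset (V × V)) (v : V) : Prop :=
  ∀ w, (v, w) ∉ A

/-- `S ⊆ A` is a partitioning set if every weakly connected component of `(V, A \ S)` has exactly
one sink. -/
def IsPartitioningSet [DecidableEq V] (A S : Finset (V × V)) : Prop :=
  S ⊆ A ∧ ∀ c : (underlying (A \ S)).ConnectedComponent, ∃! s, s ∈ c.supp ∧ IsSink (A \ S) s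

end Graph

/-- An instance of DAG Partitioning: a directed acyclic graph with positive integer arc weights
(only the values of `weight` on arcs matter) and a positive integer `k`. -/
structure Problem (V : Type*) where
  arcs : Finset (V × V)
  weight : V × V → ℕ
  k : ℕ
  acyclic : IsAcyclic arcs
  weight_pos : ∀ a ∈ arcs, 0 < weight a
  k_pos : 0 < k

/-- The question: is there a partitioning set of total weight at most `k`? -/
def Problem.IsYes {V : Type*} [DecidableEq V] (I : Problem V) : Prop :=
  ∃ S, IsPartitioningSet I.arcs S ∧ ∑ a ∈ S, I.weight a ≤ I.k

/-- A tree decomposition, with rooted tree on the node set `X`, of the graph with arc set `A`. -/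
structure TreeDecomposition {V : Type*} (A : Finset (V × V)) (X : Type*) where
  tree : SimpleGraph X
  isTree : tree.IsTree
  root : X
  bag : X → Finset V
  exists_mem_bag : ∀ v, ∃ x, v ∈ bag x
  exists_arc_bag : ∀ u w, (u, w) ∈ A → ∃ x, u ∈ bag x ∧ w ∈ bag x
  connected : ∀ v, (tree.induce {x | v ∈ bag x}).Connected

/-- One less than the size of the largest bag (and `0` if all bags, hence the graph, are empty). -/
def TreeDecomposition.width {V X : Type*} [Fintype X] {A : Finset (V × V)}
    (D : TreeDecomposition A X) : ℕ :=
  (Finset.univ.sup fun x => (D.bag x).card) - 1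

/-! ### The machine model

A uniform-cost random access machine, programmed in structured form. Its state consists of
natural-number registers and of memory arrays, both named by natural numbers; a program
mentions only finitely many names, but an array may be accessed at any computed address. The only
arithmetic operations are addition and truncated subtraction. Every constant, register access,
memory access and arithmetic operation costs one step, and so does every assignment and every
branching. -/

/-- Machine states. -/
structure State where
  reg : ℕ → ℕ
  mem : ℕ → ℕ → ℕ

/-- Expressions; `load a e` reads array `a` at address `e`. -/
inductive Expr where
  | lit (c : ℕ)
  | reg (x : ℕ)
  | load (a : ℕ) (e : Expr)
  | add (e f : Expr)
  | sub (e f : Expr)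

/-- The value of an expression. -/
def Expr.eval (s : State) : Expr → ℕ
  | .lit c => c
  | .reg x => s.reg x
  | .load a e => s.mem a (e.eval s)
  | .add e f => e.eval s + f.eval s
  | .sub e f => e.eval s - f.eval s

/-- The number of steps for evaluating an expression. -/
def Expr.cost : Expr → ℕ
  | .lit _ => 1
  | .reg _ => 1
  | .load _ e => e.cost + 1
  | .add e f => e.cost + f.cost + 1
  | .sub e f => e.cost + f.cost + 1

/-- Programs: `assign x e` puts the value of `e` into register `x`; `store a e f` writes the value
of `f` to array `a` at address `e`; a test succeeds if its expression is nonzero. -/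
inductive Cmd where
  | skip
  | assign (x : ℕ) (e : Expr)
  | store (a : ℕ) (e f : Expr)
  | seq (c d : Cmd)
  | cond (e : Expr) (c d : Cmd)
  | loop (e : Expr) (c : Cmd)

/-- The state after writing `v` into register `x`. -/
def State.setReg (s : State) (x v : ℕ) : State :=
  { s with reg := Function.update s.reg x v }

/-- The state after writing `v` to array `a` at address `i`. -/
def State.setMem (s : State) (a i v : ℕ) : State :=
  { s with mem := Function.update s.mem a (Function.update (s.mem a) i v) }

/-- `Exec c s T s'`: started in state `s`, the program `c` halts after exactly `T` steps in
state `s'`. -/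
inductive Exec : Cmd → State → ℕ → State → Prop
  | skip (s : State) : Exec .skip s 1 s
  | assign (x : ℕ) (e : Expr) (s : State) :
      Exec (.assign x e) s (e.cost + 1) (s.setReg x (e.eval s))
  | store (a : ℕ) (e f : Expr) (s : State) :
      Exec (.store a e f) s (e.cost + f.cost + 1) (s.setMem a (e.eval s) (f.eval s))
  | seq {c d : Cmd} {s s₁ s₂ : State} {T₁ T₂ : ℕ} :
      Exec c s T₁ s₁ → Exec d s₁ T₂ s₂ → Exec (.seq c d) s (T₁ + T₂) s₂
  | cond_true {e : Expr} {c d : Cmd} {s s' : State} {T : ℕ} :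
      e.eval s ≠ 0 → Exec c s T s' → Exec (.cond e c d) s (e.cost + 1 + T) s'
  | cond_false {e : Expr} {c d : Cmd} {s s' : State} {T : ℕ} :
      e.eval s = 0 → Exec d s T s' → Exec (.cond e c d) s (e.cost + 1 + T) s'
  | loop_true {e : Expr} {c : Cmd} {s s₁ s₂ : State} {T₁ T₂ : ℕ} :
      e.eval s ≠ 0 → Exec c s T₁ s₁ → Exec (.loop e c) s₁ T₂ s₂ →
      Exec (.loop e c) s (e.cost + 1 + T₁ + T₂) s₂
  | loop_false {e : Expr} {c : Cmd} {s : State} :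
      e.eval s = 0 → Exec (.loop e c) s (e.cost + 1) s

/-- The machine is deterministic: step count and final state are functions of the initial state. -/
theorem Exec.deterministic {c : Cmd} {s s₁ s₂ : State} {T₁ T₂ : ℕ}
    (h₁ : Exec c s T₁ s₁) (h₂ : Exec c s T₂ s₂) : T₁ = T₂ ∧ s₁ = s₂ := by
  induction h₁ generalizing T₂ s₂ with
  | skip s => cases h₂; exact ⟨rfl, rfl⟩
  | assign x e s => cases h₂; exact ⟨rfl, rfl⟩
  | store a e f s => cases h₂; exact ⟨rfl, rfl⟩
  | seq _ _ ih ih' =>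
    cases h₂ with
    | seq k k' =>
      obtain ⟨rfl, rfl⟩ := ih k
      obtain ⟨rfl, rfl⟩ := ih' k'
      exact ⟨rfl, rfl⟩
  | cond_true h _ ih =>
    cases h₂ with
    | cond_true _ k => obtain ⟨rfl, rfl⟩ := ih k; exact ⟨rfl, rfl⟩
    | cond_false h' _ => exact absurd h' h
  | cond_false h _ ih =>
    cases h₂ with
    | cond_true h' _ => exact absurd h h'
    | cond_false _ k => obtain ⟨rfl, rfl⟩ := ih k; exact ⟨rfl, rfl⟩
  | loop_true h _ _ ih ih' =>
    cases h₂ with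
    | loop_true _ k k' =>
      obtain ⟨rfl, rfl⟩ := ih k
      obtain ⟨rfl, rfl⟩ := ih' k'
      exact ⟨rfl, rfl⟩
    | loop_false h' => exact absurd h' h
  | loop_false h =>
    cases h₂ with
    | loop_true h' _ _ => exact absurd h h'
    | loop_false _ => exact ⟨rfl, rfl⟩

/-! ### The input -/

/-- A way of writing down an instance on the vertices `0, …, n - 1` together with a tree
decomposition on the nodes `0, …, N - 1`: the arcs and the elements of each bag are listed in an
arbitrary order without repetition, and the rooted tree is given by its parent pointers. -/
structure Presentation {n N : ℕ} (I : Problem (Fin n)) (D : TreeDecomposition I.arcs (Fin N)) where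
  arcList : List (Fin n × Fin n)
  arcList_nodup : arcList.Nodup
  mem_arcList : ∀ a, a ∈ arcList ↔ a ∈ I.arcs
  parent : Fin N → Fin N
  parent_root : parent D.root = D.root
  adj_parent : ∀ x, x ≠ D.root → D.tree.Adj x (parent x)
  dist_parent : ∀ x, x ≠ D.root → D.tree.dist D.root x = D.tree.dist D.root (parent x) + 1
  bagList : Fin N → List (Fin n)
  bagList_nodup : ∀ x, (bagList x).Nodup
  mem_bagList : ∀ x v, v ∈ bagList x ↔ v ∈ D.bag x

/-- An array that holds the entries of a list, followed by zeros. -/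
def ofList (l : List ℕ) : ℕ → ℕ := fun i => l.getD i 0

/-- The initial state. The first registers hold the number of vertices, the number of arcs, the
bound `k`, the number of nodes, and the root. The first arrays hold the tails of the arcs, their
heads, their weights, the parents of the nodes, the bag sizes, and the elements of the bags of
the nodes `0, …, N - 1` one bag after the other. All other memory is zero. -/
def Presentation.init {n N : ℕ} {I : Problem (Fin n)} {D : TreeDecomposition I.arcs (Fin N)}
    (E : Presentation I D) : State where
  reg := ofList [n, E.arcList.length, I.k, N, D.root]
  mem a :=
    match a with
    | 0 => ofList (E.arcList.map fun a => (a.1 : ℕ))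
    | 1 => ofList (E.arcList.map fun a => (a.2 : ℕ))
    | 2 => ofList (E.arcList.map I.weight)
    | 3 => ofList (List.ofFn fun x => (E.parent x : ℕ))
    | 4 => ofList (List.ofFn fun x => (E.bagList x).length)
    | 5 => ofList ((List.finRange N).flatMap fun x => (E.bagList x).map fun v => (v : ℕ))
    | _ => fun _ => 0

/-- On the given input, the program `P` halts after at most `T` steps, with the answer (`1` for
yes, `0` for no) in register `0`. -/
def DecidesWithin (P : Cmd) {n N : ℕ} {I : Problem (Fin n)} {D : TreeDecomposition I.arcs (Fin N)}
    (E : Presentation I D) (T : ℕ) : Prop :=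
  ∃ T' s, Exec P E.init T' s ∧ T' ≤ T ∧ (I.IsYes → s.reg 0 = 1) ∧ (¬ I.IsYes → s.reg 0 = 0)

end DAGPart

/-!
A partitioning set of weight at most `k` exists exactly when the vertices can be labelled such that
the arcs between different labels have weight at most `k` and every label has at most one vertex
without an out-neighbour of that label (`Problem.isYes_iff`). The arcs between different labels are
deleted; a vertex without an out-neighbour of its own label is a sink of what remains, and acyclicity
provides every component with a sink, so that the labels stand for the components.

This formulation is local and can be checked along a tree decomposition. For a piece `U` of the
graph that meets the rest in the bag `B` only, a labelling of `U` is summarized by a `BagState`: the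
partition of `B` into labels, the vertices of `B` that are required to have an out-neighbour with
their own label inside `U`, and the labels that have a vertex outside `B` without such an
out-neighbour.
`Feasible` gives the possible weights for a state. If two pieces are separated by their bags, then
labellings of the two pieces can be restricted from and glued to a labelling of the union, and the
relation `Mergeable` and the cost `mergeCost` express what happens to the states and the weights
(`Separated.feasible_restrict`, `Separated.feasible_glue`). There are at most
`2 ^ (b * (b + 2))` states for bags of size at most `b`, as a state is a Boolean matrix with `b` rows
and `b + 2` columns; the table of a node holds the least feasible weight for each of them.

The tables are merged along the tree from the leaves to the root. A queue holds the nodes all of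
whose children have been merged (`Peeling`), so that a single loop over the nodes suffices and no
recursion is needed; an additional root with an empty bag receives the final answer
(`Progress.succ`, `Progress.eval_answerT`).

For the machine, a small language of terms with bounded recursion and of loop programs is compiled
into `Cmd` (`Prog.exec_compile`). Its cost is read off from the nesting of the loops:
`Prog.bound_le_of_linear` gives a polynomial in the number of codes times a single factor `n + N`, and
`(2 ^ (t + 3) ^ 2) ^ e` is `2 ^ (O(t ^ 2))`. Registers below `64` belong to the loop program, those
from `64` on are scratch space of the compiled code. The loop program uses the registers as follows:
`0` to `4` are the input; `5` is the number of codes, `7` is `b`, and `6`, `8`, `9` are `b + 2`,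
`b + 1`, `N + 1`; `10` is the length of the queue; `11` and `12` are a node and its parent; `13`,
`14`, `15` are codes; `16` and `18` are loop variables; `17` is where the number of codes is computed;
and those from `20` on are bound in terms. The
arrays `0` to `5` are the input, `6` and `11` are multiplication tables, `7` is the weight matrix,
`8` the positions of the bags in array `5`, `9` the numbers of unmerged children, `10` the queue,
`12` the tables, and `13` a copy of one table row under construction.
-/

namespace DAGPart

/-! ### A loop language on top of the machine -/

@[simp] theorem State.setReg_reg (s : State) (x v y : ℕ) :
    (s.setReg x v).reg y = if y = x then v else s.reg y := by
  simp [State.setReg, Function.update_apply]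

@[simp] theorem State.setReg_mem (s : State) (x v : ℕ) : (s.setReg x v).mem = s.mem := rfl

@[simp] theorem State.setMem_reg (s : State) (a i v : ℕ) : (s.setMem a i v).reg = s.reg := rfl

theorem State.setMem_mem (s : State) (a i v a' i' : ℕ) :
    (s.setMem a i v).mem a' i' = if a' = a ∧ i' = i then v else s.mem a' i' := by
  by_cases h : a' = a
  · subst h; by_cases h' : i' = i <;> simp [State.setMem, h']
  · simp [State.setMem, h]

/-- Side-effect-free expressions with bounded recursion. The term `fold a i init step` iterates
`acc ↦ step`, started at `init`, for the index running below the value of register `5`; inside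
`step`, register `a` holds the accumulator and register `i` the index. As every iteration has the
same range, the cost of a term is a polynomial in the value of register `5`. -/
inductive Term where
  | lit (c : ℕ)
  | var (x : ℕ)
  | load (a : ℕ) (t : Term)
  | add (t u : Term)
  | sub (t u : Term)
  | ite (c t u : Term)
  | fold (a i : ℕ) (init step : Term)

namespace Term

/-- The value of a term. -/
def eval : Term → State → ℕ
  | lit c, _ => c
  | var x, s => s.reg x
  | load a t, s => s.mem a (t.eval s)
  | add t u, s => t.eval s + u.eval s
  | sub t u, s => t.eval s - u.eval s
  | ite c t u, s => if c.eval s ≠ 0 then t.eval s else u.eval s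
  | fold a i init step, s =>
      Nat.rec (init.eval s) (fun j acc => step.eval ((s.setReg a acc).setReg i j)) (s.reg 5)

/-- Terms that mention registers below `64` only and bind neither register `5` nor one register
twice. -/
def WF : Term → Bool
  | lit _ => true
  | var x => decide (x < 64)
  | load _ t => t.WF
  | add t u => t.WF && u.WF
  | sub t u => t.WF && u.WF
  | ite c t u => c.WF && t.WF && u.WF
  | fold a i init step => decide (a < 64) && decide (i < 64) && decide (a ≠ 5) && decide (i ≠ 5)
      && decide (a ≠ i) && init.WF && step.WF

/-- Whether the register `x` occurs free in a term. -/
def uses (x : ℕ) : Term → Bool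
  | lit _ => false
  | var y => decide (x = y)
  | load _ t => t.uses x
  | add t u => t.uses x || u.uses x
  | sub t u => t.uses x || u.uses x
  | ite c t u => c.uses x || t.uses x || u.uses x
  | fold a i init step => decide (x = 5) || init.uses x ||
      (decide (x ≠ a) && decide (x ≠ i) && step.uses x)

/-- The code that evaluates a term into register `k`, with the registers from `k` on as scratch
space. -/
def compile : Term → ℕ → Cmd
  | lit c, k => .assign k (.lit c)
  | var x, k => .assign k (.reg x)
  | load a t, k => .seq (t.compile k) (.assign k (.load a (.reg k)))
  | add t u, k => .seq (t.compile k) (.seq (u.compile (k + 1))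
      (.assign k (.add (.reg k) (.reg (k + 1)))))
  | sub t u, k => .seq (t.compile k) (.seq (u.compile (k + 1))
      (.assign k (.sub (.reg k) (.reg (k + 1)))))
  | ite c t u, k => .seq (c.compile k) (.cond (.reg k) (t.compile k) (u.compile k))
  | fold a i init step, k =>
      .seq (init.compile k) (.seq (.assign (k + 1) (.reg a)) (.seq (.assign (k + 2) (.reg i))
      (.seq (.assign a (.reg k)) (.seq (.assign i (.lit 0))
      (.seq (.loop (.sub (.reg 5) (.reg i)) (.seq (step.compile (k + 3))
        (.seq (.assign a (.reg (k + 3))) (.assign i (.add (.reg i) (.lit 1))))))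
      (.seq (.assign k (.reg a)) (.seq (.assign a (.reg (k + 1))) (.assign i (.reg (k + 2))))))))))

/-- A bound on the cost of evaluating a term, where `m` is the value of register `5`. -/
def bound : Term → ℕ → ℕ
  | lit _, _ => 2
  | var _, _ => 2
  | load _ t, m => t.bound m + 3
  | add t u, m => t.bound m + (u.bound m + 4)
  | sub t u, m => t.bound m + (u.bound m + 4)
  | ite c t u, m => c.bound m + (2 + (t.bound m + u.bound m))
  | fold _ _ init step, m => init.bound m + (8 + (m * (step.bound m + 10) + 10))

theorem eval_congr_uses (t : Term) {s s' : State} (hm : s.mem = s'.mem)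
    (hr : ∀ x, t.uses x = true → s.reg x = s'.reg x) : t.eval s = t.eval s' := by
  induction t generalizing s s' with
  | lit c => rfl
  | var x => exact hr x (by simp [uses])
  | load a t ih => simp only [eval, hm]; rw [ih hm fun x hx => hr x (by simp [uses, hx])]
  | add t u iht ihu =>
    simp only [eval]
    rw [iht hm fun x hx => hr x (by simp [uses, hx]), ihu hm fun x hx => hr x (by simp [uses, hx])]
  | sub t u iht ihu =>
    simp only [eval]
    rw [iht hm fun x hx => hr x (by simp [uses, hx]), ihu hm fun x hx => hr x (by simp [uses, hx])]
  | ite c t u ihc iht ihu =>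
    simp only [eval]
    rw [iht hm fun x hx => hr x (by simp [uses, hx]), ihu hm fun x hx => hr x (by simp [uses, hx]),
      ihc hm fun x hx => hr x (by simp [uses, hx])]
  | fold a i init step ih1 ih2 =>
    simp only [eval]
    rw [← hr 5 (by simp [uses]), ih1 hm fun x hx => hr x (by simp [uses, hx])]
    congr 1
    funext j acc
    refine ih2 (by simpa using hm) fun x hx => ?_
    by_cases h1 : x = i
    · simp [h1]
    · by_cases h2 : x = a
      · simp [h2]
      · simp [h1, h2, hr x (by simp [uses, hx, h1, h2])]

theorem lt_of_uses (t : Term) (h : t.WF = true) {x : ℕ} (hx : t.uses x = true) : x < 64 := by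
  induction t with
  | lit c => simp [uses] at hx
  | var y => simp_all [uses, WF]
  | load a t ih => exact ih h hx
  | add t u iht ihu => simp only [uses, WF, Bool.or_eq_true, Bool.and_eq_true] at *; tauto
  | sub t u iht ihu => simp only [uses, WF, Bool.or_eq_true, Bool.and_eq_true] at *; tauto
  | ite c t u ihc iht ihu => simp only [uses, WF, Bool.or_eq_true, Bool.and_eq_true] at *; tauto
  | fold a i init step ih1 ih2 =>
    simp only [uses, WF, Bool.or_eq_true, Bool.and_eq_true, decide_eq_true_eq] at *
    rcases hx with (rfl | hx) | hx
    · norm_num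
    · tauto
    · tauto

/-- A term without free occurrence of `x` does not depend on register `x`. -/
theorem eval_setReg (t : Term) {x : ℕ} (h : t.uses x = false) (s : State) (v : ℕ) :
    t.eval (s.setReg x v) = t.eval s :=
  t.eval_congr_uses rfl fun y hy => by
    have : y ≠ x := by rintro rfl; simp [h] at hy
    simp [this]

/-- Two states that agree on the memory and on the registers below `64`. -/
theorem eval_congr (t : Term) (h : t.WF = true) {s s' : State} (hm : s.mem = s'.mem)
    (hr : ∀ x < 64, s.reg x = s'.reg x) : t.eval s = t.eval s' :=
  t.eval_congr_uses hm fun x hx => hr x (t.lt_of_uses h hx)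

end Term

/-- Total correctness of a loop that runs `m` times. -/
theorem exec_loop {e : Expr} {c : Cmd} {m T : ℕ} (Inv : ℕ → State → Prop)
    (hstep : ∀ j < m, ∀ σ, Inv j σ → e.eval σ ≠ 0 ∧
      ∃ T' σ', Exec c σ T' σ' ∧ T' ≤ T ∧ Inv (j + 1) σ')
    (hend : ∀ σ, Inv m σ → e.eval σ = 0) (σ : State) (h0 : Inv 0 σ) :
    ∃ T' σ', Exec (.loop e c) σ T' σ' ∧ T' ≤ m * (T + (e.cost + 1)) + (e.cost + 1) ∧ Inv m σ' := by
  suffices H : ∀ r j σ, j + r = m → Inv j σ →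
      ∃ T' σ', Exec (.loop e c) σ T' σ' ∧ T' ≤ r * (T + (e.cost + 1)) + (e.cost + 1) ∧ Inv m σ' from
    H m 0 σ (by simp) h0
  intro r
  induction r with
  | zero =>
    intro j σ hj hI
    obtain rfl : j = m := by simpa using hj
    exact ⟨_, σ, .loop_false (hend σ hI), by simp, hI⟩
  | succ r ih =>
    intro j σ hj hI
    obtain ⟨h1, T1, σ1, hx1, hT1, hI1⟩ := hstep j (by omega) σ hI
    obtain ⟨T2, σ2, hx2, hT2, hI2⟩ := ih (j + 1) σ1 (by omega) hI1
    refine ⟨_, σ2, .loop_true h1 hx1 hx2, ?_, hI2⟩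
    rw [Nat.succ_mul]; omega

theorem exec_assign {σ σ' : State} {x T : ℕ} {e : Expr} (h : σ' = σ.setReg x (e.eval σ))
    (hT : T = e.cost + 1) : Exec (.assign x e) σ T σ' := by
  subst h hT; exact .assign x e σ

/-- The code for a term computes its value, within the cost bound, and restores all other
registers below the scratch space. -/
theorem Term.exec_compile (t : Term) (hwf : t.WF = true) (k : ℕ) (hk : 64 ≤ k) (σ : State) :
    ∃ T σ', Exec (t.compile k) σ T σ' ∧ T ≤ t.bound (σ.reg 5) ∧ σ'.mem = σ.mem ∧
      (∀ r < k, σ'.reg r = σ.reg r) ∧ σ'.reg k = t.eval σ := by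
  induction t generalizing k σ with
  | lit c => exact ⟨_, _, .assign _ _ _, le_rfl, rfl, fun r hr => by simp [hr.ne], by
      simp [Term.eval, Expr.eval]⟩
  | var x => exact ⟨_, _, .assign _ _ _, le_rfl, rfl, fun r hr => by simp [hr.ne], by
      simp [Term.eval, Expr.eval]⟩
  | load a t ih =>
    obtain ⟨T, σ', hx, hT, hm, hr, hv⟩ := ih hwf k hk σ
    refine ⟨_, _, .seq hx (.assign _ _ _), ?_, by simp [hm], fun r h => ?_, ?_⟩
    · simp only [Expr.cost, Term.bound]; omega
    · simp [h.ne, hr r h]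
    · simp [Term.eval, Expr.eval, hm, hv]
  | add t u iht ihu =>
    simp only [Term.WF, Bool.and_eq_true] at hwf
    obtain ⟨T, σ', hx, hT, hm, hr, hv⟩ := iht hwf.1 k hk σ
    obtain ⟨T2, σ2, hx2, hT2, hm2, hr2, hv2⟩ := ihu hwf.2 (k + 1) (by omega) σ'
    rw [u.eval_congr hwf.2 hm (fun x hx => hr x (by omega))] at hv2
    rw [hr 5 (by omega)] at hT2
    refine ⟨_, _, .seq hx (.seq hx2 (.assign _ _ _)), ?_, by simp [hm2, hm], fun r h => ?_, ?_⟩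
    · simp only [Expr.cost, Term.bound]; omega
    · simp [h.ne, hr2 r (by omega), hr r h]
    · simp [Term.eval, Expr.eval, hv2, hr2 k, hv]
  | sub t u iht ihu =>
    simp only [Term.WF, Bool.and_eq_true] at hwf
    obtain ⟨T, σ', hx, hT, hm, hr, hv⟩ := iht hwf.1 k hk σ
    obtain ⟨T2, σ2, hx2, hT2, hm2, hr2, hv2⟩ := ihu hwf.2 (k + 1) (by omega) σ'
    rw [u.eval_congr hwf.2 hm (fun x hx => hr x (by omega))] at hv2
    rw [hr 5 (by omega)] at hT2
    refine ⟨_, _, .seq hx (.seq hx2 (.assign _ _ _)), ?_, by simp [hm2, hm], fun r h => ?_, ?_⟩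
    · simp only [Expr.cost, Term.bound]; omega
    · simp [h.ne, hr2 r (by omega), hr r h]
    · simp [Term.eval, Expr.eval, hv2, hr2 k, hv]
  | ite c t u ihc iht ihu =>
    simp only [Term.WF, Bool.and_eq_true] at hwf
    obtain ⟨T, σ', hx, hT, hm, hr, hv⟩ := ihc hwf.1.1 k hk σ
    by_cases h0 : c.eval σ = 0
    · obtain ⟨T2, σ2, hx2, hT2, hm2, hr2, hv2⟩ := ihu hwf.2 k hk σ'
      rw [u.eval_congr hwf.2 hm (fun x hx => hr x (by omega))] at hv2
      rw [hr 5 (by omega)] at hT2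
      refine ⟨_, _, .seq hx (.cond_false (by simpa [Expr.eval, hv] using h0) hx2), ?_,
        by simp [hm2, hm], fun r h => by rw [hr2 r h, hr r h], by simp [Term.eval, h0, hv2]⟩
      simp only [Expr.cost, Term.bound]; omega
    · obtain ⟨T2, σ2, hx2, hT2, hm2, hr2, hv2⟩ := iht hwf.1.2 k hk σ'
      rw [t.eval_congr hwf.1.2 hm (fun x hx => hr x (by omega))] at hv2
      rw [hr 5 (by omega)] at hT2
      refine ⟨_, _, .seq hx (.cond_true (by simpa [Expr.eval, hv] using h0) hx2), ?_,
        by simp [hm2, hm], fun r h => by rw [hr2 r h, hr r h], by simp [Term.eval, h0, hv2]⟩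
      simp only [Expr.cost, Term.bound]; omega
  | fold a i init step ih1 ih2 =>
    simp only [Term.WF, Bool.and_eq_true, decide_eq_true_eq] at hwf
    obtain ⟨⟨⟨⟨⟨⟨ha, hi⟩, ha5⟩, hi5⟩, hai⟩, hwf1⟩, hwf2⟩ := hwf
    obtain ⟨T, σ0, hx, hT, hm, hr, hv⟩ := ih1 hwf1 k hk σ
    -- the value of the accumulator after `j` rounds
    let val : ℕ → ℕ := fun m =>
      Nat.rec (init.eval σ) (fun j acc => step.eval ((σ.setReg a acc).setReg i j)) m
    let Inv : ℕ → State → Prop := fun j τ =>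
      τ.mem = σ.mem ∧ (∀ r < k, r ≠ a → r ≠ i → τ.reg r = σ.reg r) ∧ τ.reg a = val j ∧
      τ.reg i = j ∧ τ.reg (k + 1) = σ.reg a ∧ τ.reg (k + 2) = σ.reg i
    have hstep : ∀ j < σ.reg 5, ∀ τ, Inv j τ → (Expr.sub (.reg 5) (.reg i)).eval τ ≠ 0 ∧
        ∃ T' τ', Exec (.seq (step.compile (k + 3)) (.seq (.assign a (.reg (k + 3)))
          (.assign i (.add (.reg i) (.lit 1))))) τ T' τ' ∧
          T' ≤ step.bound (σ.reg 5) + 6 ∧ Inv (j + 1) τ' := by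
      rintro j hj τ ⟨i1, i2, i3, i4, i5, i6⟩
      refine ⟨?_, ?_⟩
      · simp only [Expr.eval, i4, i2 5 (by omega) ha5.symm hi5.symm]; omega
      · obtain ⟨T2, σ2, hx2, hT2, hm2, hr2, hv2⟩ := ih2 hwf2 (k + 3) (by omega) τ
        rw [i2 5 (by omega) ha5.symm hi5.symm] at hT2
        have hv3 : step.eval τ = val (j + 1) := by
          refine step.eval_congr hwf2 (by simpa using i1) fun x hx => ?_
          by_cases h1 : x = i
          · simp [h1, i4]
          · by_cases h2 : x = a
            · subst h2; simp [h1, i3, val]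
            · simp [h1, h2, i2 x (by omega)]
        refine ⟨_, _, .seq hx2 (.seq (.assign _ _ _) (.assign _ _ _)), ?_, ?_⟩
        · simp only [Expr.cost]; omega
        · refine ⟨by simp [hm2, i1], fun r h1 h2 h3 => ?_, ?_, ?_, ?_, ?_⟩
          · simp [h2, h3, hr2 r (by omega), i2 r h1 h2 h3]
          · simp [hai, Expr.eval, hv2, hv3]
          · simp [hai.symm, Expr.eval, hr2 i (by omega), i4]
          · simp [show k + 1 ≠ a by omega, show k + 1 ≠ i by omega, hr2 (k + 1) (by omega), i5]
          · simp [show k + 2 ≠ a by omega, show k + 2 ≠ i by omega, hr2 (k + 2) (by omega), i6]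
    have hend : ∀ τ, Inv (σ.reg 5) τ → (Expr.sub (.reg 5) (.reg i)).eval τ = 0 := by
      rintro τ ⟨i1, i2, i3, i4, i5, i6⟩
      simp [Expr.eval, i4, i2 5 (by omega) ha5.symm hi5.symm]
    obtain ⟨T3, σ3, hx3, hT3, i1, i2, i3, i4, i5, i6⟩ := exec_loop Inv hstep hend
      ((((σ0.setReg (k + 1) (σ0.reg a)).setReg (k + 2) (σ0.reg i)).setReg a (σ0.reg k)).setReg i 0)
      (by
        refine ⟨by simp [hm], fun r h1 h2 h3 => ?_, ?_, ?_, ?_, ?_⟩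
        · simp [h2, h3, show r ≠ k + 1 by omega, show r ≠ k + 2 by omega, hr r h1]
        · simp [hai, hv, val]
        · simp
        · simp [show k + 1 ≠ a by omega, show k + 1 ≠ i by omega, hr a (by omega)]
        · simp [show k + 2 ≠ a by omega, show k + 2 ≠ i by omega, hr i (by omega)])
    refine ⟨_, _, .seq hx (.seq (exec_assign rfl rfl) (.seq (exec_assign rfl rfl)
      (.seq (exec_assign rfl rfl) (.seq (exec_assign rfl rfl) (.seq (T₁ := T3) (s₁ := σ3) ?_
      (.seq (.assign _ _ _) (.seq (.assign _ _ _) (.assign _ _ _)))))))), ?_, ?_, ?_, ?_⟩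
    · convert hx3 using 2 <;> simp [Expr.eval, show i ≠ k + 1 by omega]
    · simp only [Expr.cost, Term.bound] at hT3 ⊢
      have : T3 ≤ σ.reg 5 * (step.bound (σ.reg 5) + 10) + 4 := by
        convert hT3 using 2
      omega
    · simp [i1]
    · intro r h
      by_cases h1 : r = i
      · subst h1
        simp [Expr.eval, show k + 2 ≠ a by omega, i6]
      · by_cases h2 : r = a
        · subst h2
          simp [Expr.eval, h1, i5]
        · simp [h1, h2, h.ne, i2 r h h2 h1]
    · simp [Expr.eval, show k ≠ i by omega, show k ≠ a by omega, i3, val, Term.eval]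

/-- Loop programs. `loop x r c` runs `c` with `x` equal to `0, 1, …` below the initial value of
register `r`. -/
inductive Prog where
  | assign (x : ℕ) (t : Term)
  | store (a : ℕ) (t u : Term)
  | seq (c d : Prog)
  | loop (x r : ℕ) (c : Prog)

namespace Prog

/-- The state after running a loop program. -/
def run : Prog → State → State
  | assign x t, s => s.setReg x (t.eval s)
  | store a t u, s => s.setMem a (t.eval s) (u.eval s)
  | seq c d, s => d.run (c.run s)
  | loop x r c, s => Nat.rec s (fun j s' => c.run (s'.setReg x j)) (s.reg r)

/-- Loop programs that use registers below `64`, write to no register of the list `L`, and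
whose loop bounds are registers of `L`. -/
def WF (L : List ℕ) : Prog → Bool
  | assign x t => t.WF && decide (x < 64) && decide (x ∉ L)
  | store _ t u => t.WF && u.WF
  | seq c d => c.WF L && d.WF L
  | loop x r c => c.WF L && decide (x < 64) && decide (x ∉ L) && decide (r ∈ L) && decide (r < 64)

/-- The code for a loop program, with the registers from `k` on as scratch space. -/
def compile : Prog → ℕ → Cmd
  | assign x t, k => .seq (t.compile k) (.assign x (.reg k))
  | store a t u, k => .seq (t.compile k) (.seq (u.compile (k + 1))
      (.store a (.reg k) (.reg (k + 1))))
  | seq c d, k => .seq (c.compile k) (d.compile k)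
  | loop x r c, k => .seq (.assign k (.reg r)) (.seq (.assign (k + 1) (.lit 0))
      (.loop (.sub (.reg k) (.reg (k + 1))) (.seq (.assign x (.reg (k + 1)))
        (.seq (c.compile (k + 2)) (.assign (k + 1) (.add (.reg (k + 1)) (.lit 1)))))))

/-- A bound on the running time in terms of the values `ρ` of the registers that the program does
not change. -/
def bound : Prog → (ℕ → ℕ) → ℕ
  | assign _ t, ρ => t.bound (ρ 5) + 2
  | store _ t u, ρ => t.bound (ρ 5) + (u.bound (ρ 5) + 3)
  | seq c d, ρ => c.bound ρ + d.bound ρ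
  | loop _ r c, ρ => 4 + (ρ r * (c.bound ρ + 10) + 4)

/-- Registers of `L` are not changed. -/
theorem run_reg (c : Prog) {L : List ℕ} (h : c.WF L = true) {r : ℕ} (hr : r ∈ L) (s : State) :
    (c.run s).reg r = s.reg r := by
  induction c generalizing s with
  | assign x t =>
    simp only [WF, Bool.and_eq_true, decide_eq_true_eq] at h
    have : r ≠ x := by rintro rfl; exact h.2 hr
    simp [run, this]
  | store a t u => simp [run]
  | seq c d ihc ihd =>
    simp only [WF, Bool.and_eq_true] at h
    simp [run, ihc h.1, ihd h.2]
  | loop x b c ih =>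
    simp only [WF, Bool.and_eq_true, decide_eq_true_eq] at h
    have : r ≠ x := by rintro rfl; exact h.1.1.2 hr
    simp only [run]
    induction s.reg b with
    | zero => rfl
    | succ m ihm => simp [ih h.1.1.1.1, this, ihm]

/-- Whether a program writes to array `a`. -/
def stores (a : ℕ) : Prog → Bool
  | assign _ _ => false
  | store a' _ _ => decide (a = a')
  | seq c d => c.stores a || d.stores a
  | loop _ _ c => c.stores a

/-- Arrays that the program does not write to are not changed. -/
theorem run_mem (c : Prog) {a : ℕ} (h : c.stores a = false) (s : State) :
    (c.run s).mem a = s.mem a := by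
  induction c generalizing s with
  | assign x t => rfl
  | store a' t u =>
    simp only [stores, decide_eq_false_iff_not] at h
    funext i; simp [run, State.setMem_mem, h]
  | seq c d ihc ihd =>
    simp only [stores, Bool.or_eq_false_iff] at h
    simp [run, ihc h.1, ihd h.2]
  | loop x b c ih =>
    simp only [stores] at h
    simp only [run]
    induction s.reg b with
    | zero => rfl
    | succ m ihm => simp [ih h, ihm]

/-- The compiled code simulates the loop program within the time bound. -/
theorem exec_compile (c : Prog) {L : List ℕ} (hL : 5 ∈ L) (h : c.WF L = true) (ρ : ℕ → ℕ)
    (k : ℕ) (hk : 64 ≤ k) (s σ : State) (hm : σ.mem = s.mem) (hr : ∀ r < 64, σ.reg r = s.reg r)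
    (hρ : ∀ r ∈ L, s.reg r = ρ r) :
    ∃ T σ', Exec (c.compile k) σ T σ' ∧ T ≤ c.bound ρ ∧ σ'.mem = (c.run s).mem ∧
      (∀ r < 64, σ'.reg r = (c.run s).reg r) ∧ (∀ r, 64 ≤ r → r < k → σ'.reg r = σ.reg r) := by
  induction c generalizing k s σ with
  | assign x t =>
    simp only [WF, Bool.and_eq_true, decide_eq_true_eq] at h
    obtain ⟨T, σ1, hx, hT, hm1, hr1, hv⟩ := t.exec_compile h.1.1 k hk σ
    rw [hr 5 (by omega), hρ 5 hL] at hT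
    rw [t.eval_congr h.1.1 hm hr] at hv
    refine ⟨_, _, .seq hx (.assign _ _ _), ?_, ?_, fun r h' => ?_, fun r h1 h2 => ?_⟩
    · simp only [Expr.cost, bound]; omega
    · simp [hm1, hm, run]
    · by_cases hxr : r = x
      · simp [hxr, Expr.eval, hv, run]
      · simp [hxr, run, hr1 r (by omega), hr r h']
    · simp [show r ≠ x by omega, hr1 r h2]
  | store a t u =>
    simp only [WF, Bool.and_eq_true] at h
    obtain ⟨T, σ1, hx, hT, hm1, hr1, hv⟩ := t.exec_compile h.1 k hk σ
    obtain ⟨T2, σ2, hx2, hT2, hm2, hr2, hv2⟩ := u.exec_compile h.2 (k + 1) (by omega) σ1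
    rw [hr1 5 (by omega), hr 5 (by omega), hρ 5 hL] at hT2
    rw [hr 5 (by omega), hρ 5 hL] at hT
    rw [t.eval_congr h.1 hm hr] at hv
    rw [u.eval_congr h.2 (hm1.trans hm) (fun x hx => (hr1 x (by omega)).trans (hr x hx))] at hv2
    refine ⟨_, _, .seq hx (.seq hx2 (.store _ _ _ _)), ?_, ?_, fun r h' => ?_, fun r h1 h2 => ?_⟩
    · simp only [Expr.cost, bound]; omega
    · simp [State.setMem, Expr.eval, hr2 k, hv, hv2, hm2, hm1, hm, run]
    · simp [run, hr2 r (by omega), hr1 r (by omega), hr r h']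
    · simp [hr2 r (by omega), hr1 r h2]
  | seq c d ihc ihd =>
    simp only [WF, Bool.and_eq_true] at h
    obtain ⟨T, σ1, hx, hT, hm1, hr1, hs1⟩ := ihc h.1 k hk s σ hm hr hρ
    obtain ⟨T2, σ2, hx2, hT2, hm2, hr2, hs2⟩ := ihd h.2 k hk _ σ1 hm1 hr1
      (fun r hr => by rw [c.run_reg h.1 hr, hρ r hr])
    exact ⟨_, _, .seq hx hx2, by simp only [bound]; omega, hm2, hr2,
      fun r h1 h2 => by rw [hs2 r h1 h2, hs1 r h1 h2]⟩
  | loop x b c ih =>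
    have hwf := h
    simp only [WF, Bool.and_eq_true, decide_eq_true_eq] at h
    obtain ⟨⟨⟨⟨hc, hx64⟩, hxL⟩, hb⟩, hb64⟩ := h
    let st : ℕ → State := fun m => Nat.rec s (fun j s' => c.run (s'.setReg x j)) m
    have hst : ∀ j, ∀ r ∈ L, (st j).reg r = ρ r := by
      intro j
      induction j with
      | zero => exact hρ
      | succ j ihj =>
        intro r hrL
        have : r ≠ x := by rintro rfl; exact hxL hrL
        simp only [st, c.run_reg hc hrL]
        simpa [this] using ihj r hrL
    let Inv : ℕ → State → Prop := fun j τ =>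
      τ.mem = (st j).mem ∧ (∀ r < 64, τ.reg r = (st j).reg r) ∧
      (∀ r, 64 ≤ r → r < k → τ.reg r = σ.reg r) ∧ τ.reg k = ρ b ∧ τ.reg (k + 1) = j
    have hstep : ∀ j < ρ b, ∀ τ, Inv j τ → (Expr.sub (.reg k) (.reg (k + 1))).eval τ ≠ 0 ∧
        ∃ T' τ', Exec (.seq (.assign x (.reg (k + 1)))
          (.seq (c.compile (k + 2)) (.assign (k + 1) (.add (.reg (k + 1)) (.lit 1))))) τ T' τ' ∧
          T' ≤ c.bound ρ + 6 ∧ Inv (j + 1) τ' := by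
      rintro j hj τ ⟨i1, i2, i3, i4, i5⟩
      refine ⟨by simp only [Expr.eval, i4, i5]; omega, ?_⟩
      obtain ⟨T, σ1, hx, hT, hm1, hr1, hs1⟩ := ih hc (k + 2) (by omega) ((st j).setReg x j)
        (τ.setReg x j) (by simpa using i1)
        (fun r h => by by_cases hxr : r = x <;> simp [hxr, i2 r h])
        (fun r h => by
          have : r ≠ x := by rintro rfl; exact hxL h
          simpa [this] using hst j r h)
      refine ⟨_, _, .seq (exec_assign (by simp only [Expr.eval, i5]) rfl)
        (.seq hx (.assign _ _ _)), ?_, ?_, ?_, ?_, ?_, ?_⟩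
      · simp only [Expr.cost]; omega
      · simpa using hm1
      · intro r h
        simpa [show r ≠ k + 1 by omega] using hr1 r h
      · intro r h1 h2
        simp [show r ≠ k + 1 by omega, hs1 r h1 (by omega), show r ≠ x by omega, i3 r h1 h2]
      · simp [hs1 k hk (by omega), show k ≠ x by omega, i4]
      · simp [Expr.eval, hs1 (k + 1) (by omega) (by omega), show k + 1 ≠ x by omega, i5]
    obtain ⟨T3, σ3, hx3, hT3, i1, i2, i3, i4, i5⟩ := exec_loop Inv hstep
      (fun τ hτ => by simp [Expr.eval, hτ.2.2.2.1, hτ.2.2.2.2])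
      ((σ.setReg k (ρ b)).setReg (k + 1) 0)
      (by
        refine ⟨by simp [hm, st], fun r h => ?_, fun r h1 h2 => ?_, by simp, by simp⟩
        · simp [show r ≠ k by omega, show r ≠ k + 1 by omega, hr r h, st]
        · simp [show r ≠ k by omega, show r ≠ k + 1 by omega])
    refine ⟨_, σ3, .seq (exec_assign rfl rfl) (.seq (exec_assign rfl rfl) (T₂ := T3) ?_), ?_,
      ?_, ?_, ?_⟩
    · convert hx3 using 3 <;> simp [Expr.eval, hr b hb64, hρ b hb]
    · simp only [Expr.cost, bound] at hT3 ⊢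
      have : T3 ≤ ρ b * (c.bound ρ + 10) + 4 := by convert hT3 using 2
      omega
    · simp only [run, hρ b hb]; exact i1
    · simp only [run, hρ b hb]; exact i2
    · exact i3

/-- Programs all of whose loops are bounded by registers of the list `S`. -/
def Small (S : List ℕ) : Prog → Bool
  | assign _ _ => true
  | store _ _ _ => true
  | seq c d => c.Small S && d.Small S
  | loop _ r c => decide (r ∈ S) && c.Small S

/-- Programs in which loops bounded by registers outside of `S` are not nested. -/
def Linear (S : List ℕ) : Prog → Bool
  | assign _ _ => true
  | store _ _ _ => true
  | seq c d => c.Linear S && d.Linear S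
  | loop _ _ c => c.Small S

end Prog

theorem Term.bound_le (t : Term) : ∃ K e, ∀ m Z, m + 2 ≤ Z → t.bound m ≤ K * Z ^ e := by
  have mono : ∀ {Z e e' : ℕ}, 2 ≤ Z → e ≤ e' → Z ^ e ≤ Z ^ e' := fun h h' =>
    Nat.pow_le_pow_right (by omega) h'
  have comb : ∀ {f g : ℕ → ℕ} (n : ℕ), (∃ K e, ∀ m Z, m + 2 ≤ Z → f m ≤ K * Z ^ e) →
      (∃ K e, ∀ m Z, m + 2 ≤ Z → g m ≤ K * Z ^ e) →
      ∃ K e, ∀ m Z, m + 2 ≤ Z → f m + (g m + n) ≤ K * Z ^ e := by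
    rintro f g n ⟨K, e, h⟩ ⟨K', e', h'⟩
    refine ⟨K + K' + n, e + e', fun m Z hZ => ?_⟩
    have h1 := (h m Z hZ).trans (Nat.mul_le_mul_left K (mono (by omega) (Nat.le_add_right e e')))
    have h2 := (h' m Z hZ).trans (Nat.mul_le_mul_left K' (mono (by omega) (Nat.le_add_left e' e)))
    have h3 : n * 1 ≤ n * Z ^ (e + e') := Nat.mul_le_mul_left n (Nat.one_le_pow _ _ (by omega))
    nlinarith
  induction t with
  | lit c => exact ⟨2, 0, fun m Z h => by simp [bound]⟩
  | var x => exact ⟨2, 0, fun m Z h => by simp [bound]⟩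
  | load a t ih =>
    obtain ⟨K, e, h⟩ := comb 3 ih ⟨0, 0, fun m Z _ => (Nat.zero_le _ : (fun _ => 0) m ≤ _)⟩
    exact ⟨K, e, fun m Z hZ => le_trans (by simp only [bound]; omega) (h m Z hZ)⟩
  | add t u iht ihu => exact comb 4 iht ihu
  | sub t u iht ihu => exact comb 4 iht ihu
  | ite c t u ihc iht ihu =>
    obtain ⟨K, e, h⟩ := comb 2 ihc (comb 0 iht ihu)
    exact ⟨K, e, fun m Z hZ => le_trans (by simp only [bound]; omega) (h m Z hZ)⟩
  | fold a i init step ih1 ih2 =>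
    obtain ⟨K', e', h'⟩ := ih2
    obtain ⟨K, e, h⟩ := comb (g := fun m => m * (step.bound m + 10)) 18 ih1
      ⟨K' + 10, e' + 1, fun m Z hZ => by
        calc m * (step.bound m + 10) ≤ Z * (K' * Z ^ e' + 10 * Z ^ e') :=
              Nat.mul_le_mul (by omega) (Nat.add_le_add (h' m Z hZ)
                (Nat.le_mul_of_pos_right _ (Nat.pow_pos (by omega))))
          _ = _ := by ring⟩
    exact ⟨K, e, fun m Z hZ => le_trans (by simp only [bound]; omega) (h m Z hZ)⟩

/-- Programs with small loops run in polynomial time in the small quantities. -/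
theorem Prog.bound_le_of_small (S : List ℕ) (c : Prog) (hc : c.Small S = true) :
    ∃ K e, ∀ (ρ : ℕ → ℕ) Z, ρ 5 + 2 ≤ Z → (∀ r ∈ S, ρ r ≤ Z) → c.bound ρ ≤ K * Z ^ e := by
  induction c with
  | assign x t =>
    obtain ⟨K, e, h⟩ := (Term.add t t).bound_le
    refine ⟨K, e, fun ρ Z hZ _ => le_trans ?_ (h _ Z hZ)⟩
    simp only [bound, Term.bound]; omega
  | store a t u =>
    obtain ⟨K, e, h⟩ := (Term.add t u).bound_le
    refine ⟨K, e, fun ρ Z hZ _ => le_trans ?_ (h _ Z hZ)⟩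
    simp only [bound, Term.bound]; omega
  | seq c d ihc ihd =>
    simp only [Small, Bool.and_eq_true] at hc
    obtain ⟨K, e, h⟩ := ihc hc.1
    obtain ⟨K', e', h'⟩ := ihd hc.2
    refine ⟨K + K', e + e', fun ρ Z hZ hS => ?_⟩
    have h1 := (h ρ Z hZ hS).trans (Nat.mul_le_mul_left K
      (Nat.pow_le_pow_right (by omega) (Nat.le_add_right e e')))
    have h2 := (h' ρ Z hZ hS).trans (Nat.mul_le_mul_left K'
      (Nat.pow_le_pow_right (by omega) (Nat.le_add_left e' e)))
    simp only [bound]; nlinarith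
  | loop x r c ih =>
    simp only [Small, Bool.and_eq_true, decide_eq_true_eq] at hc
    obtain ⟨K, e, h⟩ := ih hc.2
    refine ⟨K + 18, e + 1, fun ρ Z hZ hS => ?_⟩
    have h1 : ρ r * (c.bound ρ + 10) ≤ Z * (K * Z ^ e + 10 * Z ^ e) :=
      Nat.mul_le_mul (hS r hc.1) (Nat.add_le_add (h ρ Z hZ hS)
        (Nat.le_mul_of_pos_right _ (Nat.pow_pos (by omega))))
    have h3 : 1 ≤ Z ^ (e + 1) := Nat.one_le_pow _ _ (by omega)
    have h4 : Z * (K * Z ^ e + 10 * Z ^ e) = (K + 10) * Z ^ (e + 1) := by ring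
    simp only [bound]; nlinarith

/-- Programs without nested large loops run in time linear in the large quantity `W`. -/
theorem Prog.bound_le_of_linear (L S : List ℕ) (c : Prog) (hL : c.WF L = true)
    (hc : c.Linear S = true) : ∃ K e, ∀ (ρ : ℕ → ℕ) Z W, ρ 5 + 2 ≤ Z → (∀ r ∈ S, ρ r ≤ Z) →
      1 ≤ W → (∀ r ∈ L, ρ r ≤ W * Z) → c.bound ρ ≤ K * Z ^ e * W := by
  induction c with
  | assign x t =>
    obtain ⟨K, e, h⟩ := (Prog.assign x t).bound_le_of_small S rfl
    exact ⟨K, e, fun ρ Z W hZ hS hW _ => (h ρ Z hZ hS).trans (Nat.le_mul_of_pos_right _ hW)⟩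
  | store a t u =>
    obtain ⟨K, e, h⟩ := (Prog.store a t u).bound_le_of_small S rfl
    exact ⟨K, e, fun ρ Z W hZ hS hW _ => (h ρ Z hZ hS).trans (Nat.le_mul_of_pos_right _ hW)⟩
  | seq c d ihc ihd =>
    simp only [Linear, WF, Bool.and_eq_true] at hc hL
    obtain ⟨K, e, h⟩ := ihc hL.1 hc.1
    obtain ⟨K', e', h'⟩ := ihd hL.2 hc.2
    refine ⟨K + K', e + e', fun ρ Z W hZ hS hW hb => ?_⟩
    have h1 := (h ρ Z W hZ hS hW hb).trans (Nat.mul_le_mul_right W (Nat.mul_le_mul_left K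
      (Nat.pow_le_pow_right (by omega) (Nat.le_add_right e e'))))
    have h2 := (h' ρ Z W hZ hS hW hb).trans (Nat.mul_le_mul_right W (Nat.mul_le_mul_left K'
      (Nat.pow_le_pow_right (by omega) (Nat.le_add_left e' e))))
    simp only [bound]; nlinarith
  | loop x r c ih =>
    simp only [Linear] at hc
    simp only [WF, Bool.and_eq_true, decide_eq_true_eq] at hL
    obtain ⟨K, e, h⟩ := c.bound_le_of_small S hc
    refine ⟨K + 18, e + 1, fun ρ Z W hZ hS hW hb => ?_⟩
    have h1 : ρ r * (c.bound ρ + 10) ≤ (W * Z) * (K * Z ^ e + 10 * Z ^ e) :=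
      Nat.mul_le_mul (hb r hL.1.2) (Nat.add_le_add (h ρ Z hZ hS)
        (Nat.le_mul_of_pos_right _ (Nat.pow_pos (by omega))))
    have h3 : 1 * 1 ≤ Z ^ (e + 1) * W := Nat.mul_le_mul (Nat.one_le_pow _ _ (by omega)) hW
    have h4 : (W * Z) * (K * Z ^ e + 10 * Z ^ e) = (K + 10) * (Z ^ (e + 1) * W) := by ring
    simp only [bound]; nlinarith

end DAGPart

namespace DAGPart

/-! ### Arithmetic and logic by bounded recursion -/

namespace Term

/-- The sum of a term over all values of register `i` below the value of register `5`. -/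
def sumT (i : ℕ) (t : Term) : Term := fold 63 i (lit 0) (add (var 63) t)

/-- The minimum of an initial value and of all values of a term for register `i` below the value
of register `5`. -/
def minT (i : ℕ) (init t : Term) : Term := fold 63 i init (ite (sub (var 63) t) t (var 63))

/-- The truth value of a term; every nonzero number counts as true. -/
def Holds (t : Term) (s : State) : Prop := t.eval s ≠ 0

/-! Boolean connectives, comparisons, and quantification over all values of register `i` below the
value of register `5`. -/

def notT (t : Term) : Term := ite t (lit 0) (lit 1)
def andT (t u : Term) : Term := ite t u (lit 0)
def orT (t u : Term) : Term := add t u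
def impT (t u : Term) : Term := ite t u (lit 1)
def iffT (t u : Term) : Term := ite t u (notT u)
def ltT (t u : Term) : Term := sub u t
def eqT (t u : Term) : Term := notT (add (sub t u) (sub u t))
def exT (i : ℕ) (t : Term) : Term := sumT i t
def allT (i : ℕ) (t : Term) : Term := notT (exT i (notT t))

/-- Half the value of register `x`. -/
def halfT (x : ℕ) : Term :=
  sumT 61 (notT (ltT (var x) (add (add (var 61) (var 61)) (lit 2))))

/-- The value of register `c` divided by `2 ^ t`. -/
def shiftT (c : ℕ) (t : Term) : Term :=
  fold 62 60 (var c) (ite (ltT (var 60) t) (halfT 62) (var 62))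

/-- The row-major position of the entry in row `i` and column `j` of a matrix that has rows of the
length stored in register `6`. -/
def idxT (i j : ℕ) : Term := add (sumT 61 (ite (ltT (var 61) (var i)) (var 6) (lit 0))) (var j)

/-- The entry in row `i` and column `j` of the Boolean matrix that has rows of the length stored
in register `6` and is encoded by the binary digits of register `c`. -/
def bitT (c i j : ℕ) : Term :=
  andT (notT (ltT (var 5) (var i))) (andT (notT (ltT (var 5) (var c)))
    (andT (ltT (idxT i j) (var 5))
      (sub (sub (shiftT c (idxT i j)) (shiftT c (add (idxT i j) (lit 1))))
        (shiftT c (add (idxT i j) (lit 1))))))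

@[simp] theorem uses_sumT (i : ℕ) (t : Term) : (sumT i t).uses 63 = false := by simp [sumT, uses]
@[simp] theorem uses_lit (x c : ℕ) : (lit c).uses x = false := rfl
@[simp] theorem uses_var (x y : ℕ) : (var y).uses x = decide (x = y) := rfl
@[simp] theorem uses_load (x a : ℕ) (t : Term) : (load a t).uses x = t.uses x := rfl
@[simp] theorem uses_add (x : ℕ) (t u : Term) : (add t u).uses x = (t.uses x || u.uses x) := rfl
@[simp] theorem uses_sub (x : ℕ) (t u : Term) : (sub t u).uses x = (t.uses x || u.uses x) := rfl
@[simp] theorem uses_ite (x : ℕ) (c t u : Term) :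
    (ite c t u).uses x = (c.uses x || t.uses x || u.uses x) := rfl
@[simp] theorem uses_notT (x : ℕ) (t : Term) : (notT t).uses x = t.uses x := by simp [notT]
@[simp] theorem uses_andT (x : ℕ) (t u : Term) : (andT t u).uses x = (t.uses x || u.uses x) := by
  simp [andT]
@[simp] theorem uses_orT (x : ℕ) (t u : Term) : (orT t u).uses x = (t.uses x || u.uses x) := by
  simp [orT]
@[simp] theorem uses_impT (x : ℕ) (t u : Term) : (impT t u).uses x = (t.uses x || u.uses x) := by
  simp [impT]
@[simp] theorem uses_iffT (x : ℕ) (t u : Term) : (iffT t u).uses x = (t.uses x || u.uses x) := by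
  simp [iffT]
@[simp] theorem uses_ltT (x : ℕ) (t u : Term) : (ltT t u).uses x = (u.uses x || t.uses x) := by
  simp [ltT]
@[simp] theorem uses_eqT (x : ℕ) (t u : Term) : (eqT t u).uses x = (t.uses x || u.uses x) := by
  simp only [eqT, uses_notT, uses_add, uses_sub]
  cases t.uses x <;> cases u.uses x <;> rfl
@[simp] theorem uses_exT (i : ℕ) (t : Term) : (exT i t).uses 63 = false := uses_sumT i t
@[simp] theorem uses_allT (i : ℕ) (t : Term) : (allT i t).uses 63 = false := by simp [allT]
@[simp] theorem uses_shiftT (c : ℕ) (t : Term) :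
    (shiftT c t).uses 63 = (decide (63 = c) || t.uses 63) := by
  simp [shiftT, uses, halfT]
@[simp] theorem uses_bitT {c i j : ℕ} (hc : c < 60) (hi : i < 60) (hj : j < 60) :
    (bitT c i j).uses 63 = false := by
  simp [bitT, idxT]; omega

@[simp] theorem eval_lit (c : ℕ) (s : State) : (lit c).eval s = c := rfl
@[simp] theorem eval_var (x : ℕ) (s : State) : (var x).eval s = s.reg x := rfl
@[simp] theorem eval_load (a : ℕ) (t : Term) (s : State) :
    (load a t).eval s = s.mem a (t.eval s) := rfl
@[simp] theorem eval_add (t u : Term) (s : State) :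
    (add t u).eval s = t.eval s + u.eval s := rfl
@[simp] theorem eval_sub (t u : Term) (s : State) :
    (sub t u).eval s = t.eval s - u.eval s := rfl
theorem eval_fold (a i : ℕ) (init step : Term) (s : State) : (fold a i init step).eval s =
    Nat.rec (init.eval s) (fun j acc => step.eval ((s.setReg a acc).setReg i j)) (s.reg 5) := rfl

@[simp] theorem eval_sumT {i : ℕ} {t : Term} (hi : 63 ≠ i) (ht : t.uses 63 = false) (s : State) :
    (sumT i t).eval s = ∑ j ∈ Finset.range (s.reg 5), t.eval (s.setReg i j) := by
  simp only [sumT, eval]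
  induction s.reg 5 with
  | zero => rfl
  | succ m ih =>
    rw [Finset.sum_range_succ, ← ih]
    simp only [State.setReg_reg, hi, if_false, if_true]
    congr 1
    refine t.eval_congr_uses rfl fun x hx => ?_
    have : x ≠ 63 := by rintro rfl; simp [ht] at hx
    simp [this]

theorem eval_minT_le {i : ℕ} {u t : Term} (hi : 63 ≠ i) (ht : t.uses 63 = false) (s : State)
    (w : ℕ) : (minT i u t).eval s ≤ w ↔
      u.eval s ≤ w ∨ ∃ j < s.reg 5, t.eval (s.setReg i j) ≤ w := by
  have hs : ∀ m v, (ite (sub (var 63) t) t (var 63)).eval ((s.setReg 63 v).setReg i m) =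
      if t.eval (s.setReg i m) < v then t.eval (s.setReg i m) else v := fun m v => by
    have : t.eval ((s.setReg 63 v).setReg i m) = t.eval (s.setReg i m) := by
      refine t.eval_congr_uses rfl fun x hx => ?_
      have : x ≠ 63 := by rintro rfl; simp [ht] at hx
      simp [this]
    simp [eval, this, hi, Nat.sub_eq_zero_iff_le]
  simp only [minT, eval_fold, hs]
  induction s.reg 5 with
  | zero => simp
  | succ m ih =>
    simp only [Nat.exists_lt_succ_right, ← or_assoc, ← ih]
    split_ifs <;> omega

@[simp] theorem holds_notT (t : Term) (s : State) : (notT t).Holds s ↔ ¬ t.Holds s := by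
  simp [Holds, notT, eval]
@[simp] theorem holds_andT (t u : Term) (s : State) :
    (andT t u).Holds s ↔ t.Holds s ∧ u.Holds s := by simp [Holds, andT, eval]
@[simp] theorem holds_orT (t u : Term) (s : State) :
    (orT t u).Holds s ↔ t.Holds s ∨ u.Holds s := by simp [Holds, orT]; tauto
@[simp] theorem holds_impT (t u : Term) (s : State) :
    (impT t u).Holds s ↔ (t.Holds s → u.Holds s) := by
  by_cases h : t.eval s = 0 <;> simp [Holds, impT, eval, h]
@[simp] theorem holds_iffT (t u : Term) (s : State) :
    (iffT t u).Holds s ↔ (t.Holds s ↔ u.Holds s) := by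
  simp only [Holds, iffT, eval, notT]
  by_cases h : t.eval s = 0 <;> simp [h]
@[simp] theorem holds_ltT (t u : Term) (s : State) :
    (ltT t u).Holds s ↔ t.eval s < u.eval s := by simp only [Holds, ltT, eval]; omega
@[simp] theorem holds_eqT (t u : Term) (s : State) :
    (eqT t u).Holds s ↔ t.eval s = u.eval s := by simp [Holds, eqT, eval, notT]; omega
@[simp] theorem holds_exT {i : ℕ} {t : Term} (hi : 63 ≠ i) (ht : t.uses 63 = false) (s : State) :
    (exT i t).Holds s ↔ ∃ j < s.reg 5, t.Holds (s.setReg i j) := by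
  simp [Holds, exT, hi, ht]
@[simp] theorem holds_allT {i : ℕ} {t : Term} (hi : 63 ≠ i) (ht : t.uses 63 = false) (s : State) :
    (allT i t).Holds s ↔ ∀ j < s.reg 5, t.Holds (s.setReg i j) := by
  simp [allT, hi, ht]

theorem eval_notT (t : Term) (s : State) [Decidable (t.Holds s)] :
    (notT t).eval s = if t.Holds s then 0 else 1 := by
  by_cases h : t.eval s = 0 <;> simp [Holds, notT, eval, h]

theorem eval_ite (c t u : Term) (s : State) [Decidable (c.Holds s)] :
    (ite c t u).eval s = if c.Holds s then t.eval s else u.eval s := by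
  by_cases h : c.eval s = 0 <;> simp [Holds, eval, h]

theorem eval_halfT {x : ℕ} (h1 : x ≠ 61) (h2 : 63 ≠ x) (s : State) (h : s.reg x ≤ s.reg 5) :
    (halfT x).eval s = s.reg x / 2 := by
  classical
  rw [halfT, eval_sumT (by decide) (by simp [h2])]
  simp only [eval_notT, holds_ltT, eval_var, eval_add, eval_lit, State.setReg_reg, h1, if_false,
    if_true]
  rw [Finset.sum_congr rfl (g := fun j => if j ∈ Finset.range (s.reg x / 2) then 1 else 0)
    (fun j _ => by simp only [Finset.mem_range]; split_ifs <;> omega), ← Finset.sum_filter,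
    Finset.filter_mem_eq_inter, Finset.inter_eq_right.2 (Finset.range_mono (by omega))]
  simp

theorem eval_shiftT {c : ℕ} {t : Term} (h1 : t.uses 62 = false) (h2 : t.uses 60 = false)
    (s : State) (hc : s.reg c ≤ s.reg 5) (ht : t.eval s ≤ s.reg 5) :
    (shiftT c t).eval s = s.reg c / 2 ^ (t.eval s) := by
  simp only [shiftT, eval]
  have key : ∀ m, (Nat.rec (s.reg c) (fun j acc => if (ltT (var 60) t).eval
      ((s.setReg 62 acc).setReg 60 j) ≠ 0 then (halfT 62).eval ((s.setReg 62 acc).setReg 60 j)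
      else ((s.setReg 62 acc).setReg 60 j).reg 62) m : ℕ) = s.reg c / 2 ^ (min m (t.eval s)) := by
    intro m
    induction m with
    | zero => simp
    | succ m ih =>
      simp only [ih]
      have hlt : ∀ v, (ltT (var 60) t).eval ((s.setReg 62 v).setReg 60 m) ≠ 0 ↔ m < t.eval s := by
        intro v
        rw [← Holds, holds_ltT, eval_setReg t h2, eval_setReg t h1]
        simp [eval]
      simp only [hlt]
      split_ifs with h
      · rw [eval_halfT (by decide) (by decide)]
        · rw [min_eq_left h.le, min_eq_left (by omega), pow_succ, ← Nat.div_div_eq_div_mul]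
          simp
        · simpa using (Nat.div_le_self _ _).trans hc
      · simp [min_eq_right (show t.eval s ≤ m by omega),
          min_eq_right (show t.eval s ≤ m + 1 by omega)]
  rw [key, min_eq_right ht]

end Term

/-- The entry in row `i` and column `j` of the Boolean matrix with rows of length `w` that is
encoded by the binary digits of `c`; entries are false where a quantity exceeds `m`. -/
def bitAt (m w c i j : ℕ) : Prop :=
  i ≤ m ∧ c ≤ m ∧ i * w + j < m ∧ c.testBit (i * w + j) = true

namespace Term

theorem eval_idxT {i j : ℕ} (hi : i < 60) (s : State) (hi5 : s.reg i ≤ s.reg 5) :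
    (idxT i j).eval s = s.reg i * s.reg 6 + s.reg j := by
  classical
  rw [idxT, eval_add, eval_sumT (by decide) (by simp; omega)]
  simp only [eval_ite, holds_ltT, eval_var, eval_lit, State.setReg_reg, if_true,
    show i ≠ 61 by omega, if_false, show (6 : ℕ) ≠ 61 by decide]
  rw [Finset.sum_congr rfl (g := fun l => if l ∈ Finset.range (s.reg i) then s.reg 6 else 0)
    (fun l _ => by simp), ← Finset.sum_filter, Finset.filter_mem_eq_inter,
    Finset.inter_eq_right.2 (Finset.range_mono hi5)]
  simp

@[simp] theorem holds_bitT {c i j : ℕ} (hi : i < 60) (hj : j < 60) (s : State) :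
    (bitT c i j).Holds s ↔ bitAt (s.reg 5) (s.reg 6) (s.reg c) (s.reg i) (s.reg j) := by
  simp only [bitT, holds_andT, holds_notT, holds_ltT, eval_var, not_lt, bitAt]
  refine and_congr_right fun hi5 => and_congr_right fun hc => ?_
  have hidx := eval_idxT (j := j) hi s hi5
  rw [hidx]
  refine and_congr_right fun hij => ?_
  have h62 : (idxT i j).uses 62 = false := by simp [idxT, sumT, uses]; omega
  have h60 : (idxT i j).uses 60 = false := by simp [idxT, sumT, uses]; omega
  have e1 := eval_shiftT (c := c) h62 h60 s hc (by omega)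
  have e2 := eval_shiftT (c := c) (t := add (idxT i j) (lit 1))
    (by simpa using h62) (by simpa using h60) s hc (by rw [eval_add, eval_lit]; omega)
  rw [eval_add, eval_lit] at e2
  rw [Holds, eval_sub, eval_sub, e1, e2, hidx, Nat.testBit_eq_decide_div_mod_eq, decide_eq_true_eq,
    pow_succ, ← Nat.div_div_eq_div_mul]
  omega

end Term

end DAGPart

namespace DAGPart

/-! ### Partitioning sets as labellings -/

section Labelling

variable {V : Type*}

/-- Within the vertex set `U`, no out-neighbour of `v` has the same label as `v`. -/
def Unsat (A : Finset (V × V)) (U : Finset V) (φ : V → ℕ) (v : V) : Prop :=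
  ∀ w ∈ U, (v, w) ∈ A → φ w ≠ φ v

theorem underlying_adj_of_mem {A : Finset (V × V)} (hA : IsAcyclic A) {u v : V}
    (h : (u, v) ∈ A) : (underlying A).Adj u v := by
  refine ⟨?_, Or.inl h⟩
  rintro rfl
  exact hA u (.single h)

theorem IsAcyclic.mono {A B : Finset (V × V)} (hA : IsAcyclic A) (h : B ⊆ A) : IsAcyclic B :=
  fun v hv => hA v (Relation.TransGen.mono (fun _ _ h' => h h') v v hv)

/-- In a finite acyclic graph, every vertex has a path to a sink. -/
theorem IsAcyclic.exists_sink [Finite V] {A : Finset (V × V)} (hA : IsAcyclic A) (v : V) :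
    ∃ s, (underlying A).Reachable v s ∧ IsSink A s := by
  have hwf : WellFounded (fun u v => Relation.TransGen (fun u w => (u, w) ∈ A) v u) := by
    have h1 : IsTrans V (fun u v => Relation.TransGen (fun u w => (u, w) ∈ A) v u) :=
      ⟨fun a b c h1 h2 => h2.trans h1⟩
    have h2 : Std.Irrefl (fun u v => Relation.TransGen (fun u w => (u, w) ∈ A) v u) := ⟨hA⟩
    exact Finite.wellFounded_of_trans_of_irrefl _
  induction v using hwf.induction with
  | h v ih =>
    by_cases hv : IsSink A v
    · exact ⟨v, .refl _, hv⟩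
    · simp only [IsSink, not_forall, not_not] at hv
      obtain ⟨w, hw⟩ := hv
      obtain ⟨s, h1, h2⟩ := ih w (.single hw)
      exact ⟨s, (underlying_adj_of_mem hA hw).reachable.trans h1, h2⟩

variable [DecidableEq V]

/-- A partitioning set of weight at most `k` exists if and only if the vertices can be labelled
in such a way that no two vertices of one label lack an out-neighbour of their own label, and the
arcs between different labels have weight at most `k`. -/
theorem Problem.isYes_iff [Fintype V] (I : Problem V) : I.IsYes ↔ ∃ φ : V → ℕ,
    (∀ u v, Unsat I.arcs Finset.univ φ u → Unsat I.arcs Finset.univ φ v → φ u = φ v → u = v) ∧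
      ∑ a ∈ I.arcs with φ a.1 ≠ φ a.2, I.weight a ≤ I.k := by
  constructor
  · rintro ⟨S, ⟨hS, hc⟩, hk⟩
    have hac := I.acyclic.mono (Finset.sdiff_subset (s := I.arcs) (t := S))
    let e := Fintype.equivFin V
    let φ : V → ℕ := fun v =>
      (e ((underlying (I.arcs \ S)).connectedComponentMk v).out : ℕ)
    have hφ : ∀ u v, φ u = φ v ↔ (underlying (I.arcs \ S)).connectedComponentMk u =
        (underlying (I.arcs \ S)).connectedComponentMk v := by
      intro u v
      refine ⟨fun h => ?_, fun h => by simp only [φ, h]⟩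
      have h' := e.injective (Fin.ext h)
      exact (Quot.out_eq _).symm.trans ((congrArg _ h').trans (Quot.out_eq _))
    have hadj : ∀ u w, (u, w) ∈ I.arcs \ S → φ w = φ u := fun u w h =>
      (hφ w u).2 (SimpleGraph.ConnectedComponent.sound
        (underlying_adj_of_mem hac h).symm.reachable)
    have hsink : ∀ u, Unsat I.arcs Finset.univ φ u → IsSink (I.arcs \ S) u := fun u hu w hw =>
      hu w (Finset.mem_univ _) (Finset.sdiff_subset hw) (hadj u w hw)
    refine ⟨φ, fun u v hu hv huv => ?_, le_trans (Finset.sum_le_sum_of_subset ?_) hk⟩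
    · obtain ⟨s, _, hs⟩ := hc ((underlying (I.arcs \ S)).connectedComponentMk u)
      rw [hs u ⟨rfl, hsink u hu⟩, hs v ⟨((hφ u v).1 huv).symm, hsink v hv⟩]
    · rintro ⟨u, w⟩ h
      simp only [Finset.mem_filter] at h
      by_contra hn
      exact h.2 (hadj u w (Finset.mem_sdiff.2 ⟨h.1, hn⟩)).symm
  · rintro ⟨φ, hv, hk⟩
    obtain ⟨S, hS⟩ : ∃ S, S = {a ∈ I.arcs | φ a.1 ≠ φ a.2} := ⟨_, rfl⟩
    rw [← hS] at hk
    refine ⟨S, ⟨hS ▸ Finset.filter_subset _ _, fun c => ?_⟩, hk⟩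
    have hac := I.acyclic.mono (Finset.sdiff_subset (s := I.arcs) (t := S))
    have harc : ∀ u w, (u, w) ∈ I.arcs \ S ↔ (u, w) ∈ I.arcs ∧ φ u = φ w := by
      intro u w; simp only [hS, Finset.mem_sdiff, Finset.mem_filter]; tauto
    have hreach : ∀ u w, (underlying (I.arcs \ S)).Reachable u w → φ u = φ w := by
      rintro u w ⟨p⟩
      induction p with
      | nil => rfl
      | cons h _ ih =>
        rw [← ih]
        rcases h.2 with h | h
        · exact ((harc _ _).1 h).2
        · exact ((harc _ _).1 h).2.symm
    have hun : ∀ u, IsSink (I.arcs \ S) u → Unsat I.arcs Finset.univ φ u := fun u hu w _ hw h =>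
      hu w ((harc _ _).2 ⟨hw, h.symm⟩)
    obtain ⟨v, rfl⟩ := c.exists_rep
    obtain ⟨s, h1, h2⟩ := hac.exists_sink v
    refine ⟨s, ⟨SimpleGraph.ConnectedComponent.sound h1.symm, h2⟩, ?_⟩
    rintro s' ⟨h3, h4⟩
    exact hv s' s (hun _ h4) (hun _ h2)
      ((hreach _ _ (SimpleGraph.ConnectedComponent.exact h3)).trans (hreach _ _ h1))

/-! ### Partial solutions -/

/-- What a partial solution tells about the current bag: which vertices have equal labels, which
vertices have found an out-neighbour of their own label, and which labels already belong to a
vertex that has left the bag without finding one. -/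
structure BagState (V : Type*) where
  eq : V → V → Prop
  sat : V → Prop
  done : V → Prop

/-- Among the vertices seen that have left the bag, no two of one label lack an out-neighbour of
their own label. -/
def Valid (A : Finset (V × V)) (U B : Finset V) (φ : V → ℕ) : Prop :=
  ∀ u ∈ U \ B, ∀ v ∈ U \ B, Unsat A U φ u → Unsat A U φ v → φ u = φ v → u = v

/-- The state `σ` describes the labelling `φ` of `U` on the bag `B`. Equality of labels is
described exactly, while `sat` may be too small and `done` too large: such a description is
pessimistic, hence as good as any for finding solutions. -/
def Describes (A : Finset (V × V)) (U B : Finset V) (φ : V → ℕ) (σ : BagState V) : Prop :=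
  (∀ u ∈ B, ∀ v ∈ B, σ.eq u v ↔ φ u = φ v) ∧ (∀ v ∈ B, σ.sat v → ¬ Unsat A U φ v) ∧
    ∀ v ∈ B, ∀ u ∈ U \ B, Unsat A U φ u → φ u = φ v → σ.done v

/-- The weight of the arcs within `U`, but not within `B`, that join different labels. -/
def pieceWeight (A : Finset (V × V)) (wt : V × V → ℕ) (U B : Finset V) (φ : V → ℕ) : ℕ :=
  ∑ a ∈ A with (a.1 ∈ U ∧ a.2 ∈ U) ∧ ¬ (a.1 ∈ B ∧ a.2 ∈ B) ∧ φ a.1 ≠ φ a.2, wt a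

/-- There is a partial solution on the seen vertices `U` that is described on the bag `B` by `σ`
and has weight at most `w`. -/
def Feasible (A : Finset (V × V)) (wt : V × V → ℕ) (U B : Finset V) (σ : BagState V) (w : ℕ) :
    Prop :=
  ∃ φ : V → ℕ, Valid A U B φ ∧ Describes A U B φ σ ∧ pieceWeight A wt U B φ ≤ w

/-- Two states agree on a bag. -/
def BagState.Agree (B : Finset V) (σ τ : BagState V) : Prop :=
  (∀ u ∈ B, ∀ v ∈ B, σ.eq u v ↔ τ.eq u v) ∧ (∀ v ∈ B, σ.sat v ↔ τ.sat v) ∧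
    ∀ v ∈ B, σ.done v ↔ τ.done v

theorem Feasible.congr {A : Finset (V × V)} {wt : V × V → ℕ} {U B : Finset V} {σ τ : BagState V}
    {w : ℕ} (h : Feasible A wt U B σ w) (hst : σ.Agree B τ) : Feasible A wt U B τ w :=
  let ⟨φ, h1, h2, h3⟩ := h
  ⟨φ, h1, ⟨fun u hu v hv => (hst.1 u hu v hv).symm.trans (h2.1 u hu v hv),
    fun v hv hs => h2.2.1 v hv ((hst.2.1 v hv).2 hs),
    fun v hv u hu hs he => (hst.2.2 v hv).1 (h2.2.2 v hv u hu hs he)⟩, h3⟩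

/-- Partial solutions on a single bag. -/
theorem feasible_self_iff (A : Finset (V × V)) (wt : V × V → ℕ) (B : Finset V) (σ : BagState V)
    (w : ℕ) : Feasible A wt B B σ w ↔
      (∀ u ∈ B, σ.eq u u) ∧ (∀ u ∈ B, ∀ v ∈ B, ∀ z ∈ B, σ.eq u v → σ.eq u z → σ.eq v z) ∧
        ∀ v ∈ B, σ.sat v → ∃ z ∈ B, σ.eq v z ∧ (v, z) ∈ A := by
  constructor
  · rintro ⟨φ, -, ⟨h1, h2, -⟩, -⟩
    refine ⟨fun u hu => (h1 u hu u hu).2 rfl, fun u hu v hv z hz huv huz => ?_, fun v hv hs => ?_⟩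
    · rw [h1 v hv z hz, ← (h1 u hu v hv).1 huv, ← (h1 u hu z hz).1 huz]
    · have := h2 v hv hs
      simp only [Unsat, not_forall, not_not] at this
      obtain ⟨z, hz, hA, he⟩ := this
      exact ⟨z, hz, (h1 v hv z hz).2 he.symm, hA⟩
  · rintro ⟨h1, h2, h3⟩
    classical
    have hsymm : ∀ u ∈ B, ∀ v ∈ B, σ.eq u v → σ.eq v u := fun u hu v hv h =>
      h2 u hu v hv u hu h (h1 u hu)
    -- label every vertex of the bag by the first vertex of its class in an enumeration
    let e := B.equivFin
    let S : V → Set ℕ := fun u => {i | ∃ v : B, (e v : ℕ) = i ∧ σ.eq u v}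
    have hne : ∀ u ∈ B, (S u).Nonempty := fun u hu => ⟨_, ⟨u, hu⟩, rfl, h1 u hu⟩
    have hφ : ∀ u ∈ B, ∀ v ∈ B, σ.eq u v ↔ sInf (S u) = sInf (S v) := by
      intro u hu v hv
      constructor
      · intro h
        congr 1
        ext i
        constructor
        · rintro ⟨z, hz, h'⟩; exact ⟨z, hz, h2 u hu v hv z z.2 h h'⟩
        · rintro ⟨z, hz, h'⟩; exact ⟨z, hz, h2 v hv u hu z z.2 (hsymm u hu v hv h) h'⟩
      · intro h
        obtain ⟨z, hz, h4⟩ := Nat.sInf_mem (hne u hu)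
        obtain ⟨z', hz', h4'⟩ := Nat.sInf_mem (hne v hv)
        obtain rfl : z = z' := e.injective (Fin.ext (by rw [hz, hz', h]))
        exact h2 z z.2 u hu v hv (hsymm _ hu _ z.2 h4) (hsymm _ hv _ z.2 h4')
    refine ⟨fun u => sInf (S u), ?_, ⟨hφ, fun v hv hs hun => ?_, ?_⟩, ?_⟩
    · intro u hu; simp at hu
    · obtain ⟨z, hz, he, hA⟩ := h3 v hv hs
      exact hun z hz hA ((hφ v hv z hz).1 he).symm
    · intro v _ u hu; simp at hu
    · rw [pieceWeight, Finset.filter_false_of_mem (fun a _ h => h.2.1 h.1)]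
      simp

/-- Partial solutions for all vertices and the empty bag. -/
theorem Problem.feasible_univ_iff [Fintype V] (I : Problem V) (σ : BagState V) :
    Feasible I.arcs I.weight Finset.univ ∅ σ I.k ↔ I.IsYes := by
  rw [I.isYes_iff]
  simp [Feasible, Valid, Describes, pieceWeight]

/-- Two pieces that overlap in common vertices of their bags only, such that no arc joins the two
sides. -/
structure Separated (A : Finset (V × V)) (U₁ B₁ U₂ B₂ : Finset V) : Prop where
  left : B₁ ⊆ U₁
  right : B₂ ⊆ U₂
  inter : ∀ v ∈ U₁, v ∈ U₂ → v ∈ B₁ ∧ v ∈ B₂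
  arcs : ∀ u ∈ U₁ ∪ U₂, ∀ w ∈ U₁ ∪ U₂, (u, w) ∈ A → u ∈ U₁ ∧ w ∈ U₁ ∨ u ∈ U₂ ∧ w ∈ U₂

/-- The label of `z` has lost its last chance for another vertex without out-neighbour of its own
label when the bag `B₂` with state `σ` is replaced by `B₁`. -/
def BagState.Closed (σ : BagState V) (B₁ B₂ : Finset V) (z : V) : Prop :=
  σ.done z ∨ ∃ u ∈ B₂, u ∉ B₁ ∧ σ.eq u z ∧ ¬ σ.sat u

/-- The states `σ₁` on `B₁` and `σ₂` on `B₂` may be merged into the state `τ` on `B₁`. -/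
structure Mergeable (B₁ B₂ : Finset V) (σ₁ σ₂ τ : BagState V) : Prop where
  compat : ∀ u ∈ B₂, u ∈ B₁ → ∀ v ∈ B₂, v ∈ B₁ → (σ₂.eq u v ↔ σ₁.eq u v)
  eq : ∀ u ∈ B₁, ∀ v ∈ B₁, τ.eq u v ↔ σ₁.eq u v
  sat : ∀ v ∈ B₁, τ.sat v → σ₁.sat v ∨ v ∈ B₂ ∧ σ₂.sat v
  done : ∀ v ∈ B₁, σ₁.done v → τ.done v
  closed : ∀ z ∈ B₂, z ∈ B₁ → σ₂.Closed B₁ B₂ z →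
    ¬ σ₁.done z ∧ ∀ v ∈ B₁, σ₁.eq z v → τ.done v
  gone : ∀ u ∈ B₂, u ∉ B₁ → ¬ σ₂.sat u →
    ¬ σ₂.done u ∧ ∀ v ∈ B₂, v ∉ B₁ → ¬ σ₂.sat v → σ₂.eq u v → u = v

open Classical in
/-- The weight of the arcs within `B₂`, but not within `B₁`, whose ends `σ` declares to have
different labels. -/
noncomputable def mergeCost (A : Finset (V × V)) (wt : V × V → ℕ) (B₁ B₂ : Finset V)
    (σ : BagState V) : ℕ :=
  ∑ u ∈ B₂, ∑ v ∈ B₂, if ¬ (u ∈ B₁ ∧ v ∈ B₁) ∧ ¬ σ.eq u v then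
    (if (u, v) ∈ A then wt (u, v) else 0) else 0

/-- Labellings of two sets with the same equalities on the intersection have a common extension,
up to renaming, that identifies only what it must. -/
theorem exists_glue (U₁ U₂ : Finset V) (φ₁ φ₂ : V → ℕ)
    (h : ∀ u ∈ U₁, u ∈ U₂ → ∀ v ∈ U₁, v ∈ U₂ → (φ₁ u = φ₁ v ↔ φ₂ u = φ₂ v)) :
    ∃ φ : V → ℕ, (∀ u ∈ U₁, ∀ v ∈ U₁, φ u = φ v ↔ φ₁ u = φ₁ v) ∧
      (∀ u ∈ U₂, ∀ v ∈ U₂, φ u = φ v ↔ φ₂ u = φ₂ v) ∧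
      ∀ u ∈ U₁, ∀ v ∈ U₂, φ u = φ v → ∃ z ∈ U₁, z ∈ U₂ ∧ φ₁ z = φ₁ u ∧ φ₂ z = φ₂ v := by
  classical
  let g : ℕ → ℕ := fun l =>
    if h : ∃ z ∈ U₁, z ∈ U₂ ∧ φ₂ z = l then 2 * φ₁ h.choose else 2 * l + 1
  let φ : V → ℕ := fun v => if v ∈ U₁ then 2 * φ₁ v else g (φ₂ v)
  have hg : ∀ z ∈ U₁, z ∈ U₂ → g (φ₂ z) = 2 * φ₁ z := by
    intro z h1 h2
    have hex : ∃ z' ∈ U₁, z' ∈ U₂ ∧ φ₂ z' = φ₂ z := ⟨z, h1, h2, rfl⟩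
    simp only [g, dif_pos hex]
    rw [(h _ hex.choose_spec.1 hex.choose_spec.2.1 z h1 h2).2 hex.choose_spec.2.2]
  have hgev : ∀ l c, g l = 2 * c → ∃ z ∈ U₁, z ∈ U₂ ∧ φ₁ z = c ∧ φ₂ z = l := by
    intro l c hl
    by_cases hex : ∃ z ∈ U₁, z ∈ U₂ ∧ φ₂ z = l
    · obtain ⟨z, h1, h2, rfl⟩ := hex
      rw [hg z h1 h2] at hl
      exact ⟨z, h1, h2, by omega, rfl⟩
    · simp only [g, dif_neg hex] at hl; omega
  have hginj : ∀ l l', g l = g l' → l = l' := by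
    intro l l' hl
    by_cases hex : ∃ z ∈ U₁, z ∈ U₂ ∧ φ₂ z = l
    · obtain ⟨z, h1, h2, rfl⟩ := hex
      rw [hg z h1 h2] at hl
      obtain ⟨z', h1', h2', h3, rfl⟩ := hgev _ _ hl.symm
      exact (h z h1 h2 z' h1' h2').1 h3.symm
    · by_cases hex' : ∃ z ∈ U₁, z ∈ U₂ ∧ φ₂ z = l'
      · obtain ⟨z, h1, h2, rfl⟩ := hex'
        rw [hg z h1 h2] at hl
        obtain ⟨z', h1', h2', h3, rfl⟩ := hgev _ _ hl
        exact (h z' h1' h2' z h1 h2).1 h3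
      · simp only [g, dif_neg hex, dif_neg hex'] at hl; omega
  have hφ1 : ∀ v ∈ U₁, φ v = 2 * φ₁ v := fun v hv => if_pos hv
  have hφ2 : ∀ v ∈ U₂, φ v = g (φ₂ v) := fun v hv => by
    by_cases h1 : v ∈ U₁
    · rw [hφ1 v h1, hg v h1 hv]
    · exact if_neg h1
  refine ⟨φ, fun u hu v hv => ?_, fun u hu v hv => ?_, fun u hu v hv huv => ?_⟩
  · rw [hφ1 u hu, hφ1 v hv]; omega
  · rw [hφ2 u hu, hφ2 v hv]; exact ⟨hginj _ _, fun h => by rw [h]⟩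
  · rw [hφ1 u hu, hφ2 v hv] at huv
    exact hgev _ _ huv.symm

namespace Separated

variable {A : Finset (V × V)} {wt : V × V → ℕ} {U₁ B₁ U₂ B₂ : Finset V} {φ φ₁ φ₂ : V → ℕ}

theorem unsat_iff (h : Separated A U₁ B₁ U₂ B₂)
    (h1 : ∀ u ∈ U₁, ∀ v ∈ U₁, φ u = φ v ↔ φ₁ u = φ₁ v)
    (h2 : ∀ u ∈ U₂, ∀ v ∈ U₂, φ u = φ v ↔ φ₂ u = φ₂ v) {v : V} (hv : v ∈ U₁ ∪ U₂) :
    Unsat A (U₁ ∪ U₂) φ v ↔ (v ∈ U₁ → Unsat A U₁ φ₁ v) ∧ (v ∈ U₂ → Unsat A U₂ φ₂ v) := by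
  constructor
  · intro hun
    exact ⟨fun hv w hw hA he => hun w (Finset.mem_union_left _ hw) hA ((h1 w hw v hv).2 he),
      fun hv w hw hA he => hun w (Finset.mem_union_right _ hw) hA ((h2 w hw v hv).2 he)⟩
  · rintro ⟨g1, g2⟩ w hw hA he
    rcases h.arcs v hv w hw hA with ⟨a, b⟩ | ⟨a, b⟩
    · exact g1 a w b hA ((h1 w b v a).1 he)
    · exact g2 a w b hA ((h2 w b v a).1 he)

theorem pieceWeight_eq (h : Separated A U₁ B₁ U₂ B₂)
    (h1 : ∀ u ∈ U₁, ∀ v ∈ U₁, φ u = φ v ↔ φ₁ u = φ₁ v)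
    (h2 : ∀ u ∈ U₂, ∀ v ∈ U₂, φ u = φ v ↔ φ₂ u = φ₂ v) {σ : BagState V}
    (hσ : ∀ u ∈ B₂, ∀ v ∈ B₂, σ.eq u v ↔ φ₂ u = φ₂ v) :
    pieceWeight A wt (U₁ ∪ U₂) B₁ φ = pieceWeight A wt U₁ B₁ φ₁ + pieceWeight A wt U₂ B₂ φ₂ +
      mergeCost A wt B₁ B₂ σ := by
  have hm : mergeCost A wt B₁ B₂ σ = ∑ a ∈ A,
      if (a.1 ∈ B₂ ∧ a.2 ∈ B₂) ∧ ¬ (a.1 ∈ B₁ ∧ a.2 ∈ B₁) ∧ φ₂ a.1 ≠ φ₂ a.2 then wt a else 0 := by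
    classical
    rw [mergeCost, ← Finset.sum_product' B₂ B₂ (fun u v => if ¬ (u ∈ B₁ ∧ v ∈ B₁) ∧ ¬ σ.eq u v then
      (if (u, v) ∈ A then wt (u, v) else 0) else 0), ← Finset.sum_filter]
    simp only [Prod.mk.eta]
    rw [← Finset.sum_filter, ← Finset.sum_filter]
    refine Finset.sum_congr ?_ fun _ _ => rfl
    ext ⟨u, v⟩
    simp only [Finset.mem_filter, Finset.mem_product]
    constructor
    · rintro ⟨⟨⟨a, b⟩, c, d⟩, e⟩; exact ⟨e, ⟨a, b⟩, c, fun h => d ((hσ u a v b).2 h)⟩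
    · rintro ⟨e, ⟨a, b⟩, c, d⟩; exact ⟨⟨⟨a, b⟩, c, fun h => d ((hσ u a v b).1 h)⟩, e⟩
  rw [hm]
  simp only [pieceWeight, Finset.sum_filter, ← Finset.sum_add_distrib]
  refine Finset.sum_congr rfl ?_
  rintro ⟨u, v⟩ hA
  have i1 := h.inter u
  have i2 := h.inter v
  have i3 := fun a b => h.arcs u a v b hA
  have l1 := @h.left u
  have l2 := @h.left v
  have l3 := @h.right u
  have l4 := @h.right v
  have k1 := fun a b => h1 u a v b
  have k2 := fun a b => h2 u a v b
  simp only [Finset.mem_union] at i3 ⊢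
  clear hm hσ h1 h2
  generalize wt (u, v) = w
  grind

/-- A partial solution on the union of two separated pieces restricts to both pieces. -/
theorem feasible_restrict (h : Separated A U₁ B₁ U₂ B₂) {τ : BagState V} {w : ℕ}
    (hf : Feasible A wt (U₁ ∪ U₂) B₁ τ w) :
    ∃ σ₁ σ₂ w₁ w₂, Feasible A wt U₁ B₁ σ₁ w₁ ∧ Feasible A wt U₂ B₂ σ₂ w₂ ∧
      Mergeable B₁ B₂ σ₁ σ₂ τ ∧ w₁ + w₂ + mergeCost A wt B₁ B₂ σ₂ ≤ w := by
  obtain ⟨φ, hV, ⟨hE, hS, hD⟩, hw⟩ := hf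
  have hun : ∀ {v : V}, v ∈ U₁ ∪ U₂ → _ := fun {v} hv =>
    h.unsat_iff (φ := φ) (φ₁ := φ) (φ₂ := φ) (by simp) (by simp) (v := v) hv
  have out1 : ∀ {u}, u ∈ U₁ \ B₁ → u ∈ (U₁ ∪ U₂) \ B₁ ∧ u ∉ U₂ := fun {u} hu => by
    simp only [Finset.mem_sdiff, Finset.mem_union] at *
    have := h.inter u; tauto
  have out2 : ∀ {u}, u ∈ U₂ → u ∉ B₁ → u ∈ (U₁ ∪ U₂) \ B₁ ∧ u ∉ U₁ := fun {u} hu hu' => by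
    simp only [Finset.mem_sdiff, Finset.mem_union] at *
    have := h.inter u; tauto
  have out3 : ∀ {u}, u ∈ U₂ \ B₂ → u ∈ U₂ ∧ u ∉ B₁ := fun {u} hu => by
    simp only [Finset.mem_sdiff] at *
    have := h.inter u; have := @h.left u; tauto
  have un1 : ∀ {u}, u ∈ U₁ \ B₁ → Unsat A U₁ φ u → Unsat A (U₁ ∪ U₂) φ u := fun {u} hu h' =>
    (hun (Finset.mem_sdiff.1 (out1 hu).1).1).2 ⟨fun _ => h', fun h'' => absurd h'' (out1 hu).2⟩
  have un2 : ∀ {u}, u ∈ U₂ → u ∉ B₁ → Unsat A U₂ φ u → Unsat A (U₁ ∪ U₂) φ u :=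
    fun {u} hu hu' h' => (hun (Finset.mem_union_right _ hu)).2
      ⟨fun h'' => absurd h'' (out2 hu hu').2, fun _ => h'⟩
  let σ : Finset V → Finset V → BagState V := fun U B =>
    ⟨fun u v => φ u = φ v, fun v => ¬ Unsat A U φ v,
      fun v => ∃ u ∈ U \ B, Unsat A U φ u ∧ φ u = φ v⟩
  have hdesc : ∀ U B, Describes A U B φ (σ U B) := fun U B =>
    ⟨fun _ _ _ _ => Iff.rfl, fun _ _ h => h, fun v _ u hu h1 h2 => ⟨u, hu, h1, h2⟩⟩
  have hcl : ∀ z ∈ B₂, (σ U₂ B₂).Closed B₁ B₂ z →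
      ∃ u ∈ U₂, u ∉ B₁ ∧ Unsat A U₂ φ u ∧ φ u = φ z := by
    rintro z hz (⟨u, hu, h1, h2⟩ | ⟨u, hu, h1, h2, h3⟩)
    · exact ⟨u, (out3 hu).1, (out3 hu).2, h1, h2⟩
    · exact ⟨u, h.right hu, h1, not_not.1 h3, h2⟩
  refine ⟨σ U₁ B₁, σ U₂ B₂, _, _, ⟨φ, ?_, hdesc _ _, le_rfl⟩, ⟨φ, ?_, hdesc _ _, le_rfl⟩,
    ⟨fun _ _ _ _ _ _ => Iff.rfl, hE, ?_, ?_, ?_, ?_⟩, ?_⟩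
  · exact fun u hu v hv h1 h2 => hV u (out1 hu).1 v (out1 hv).1 (un1 hu h1) (un1 hv h2)
  · intro u hu v hv h1 h2
    have hu' := out3 hu
    have hv' := out3 hv
    exact hV u (out2 hu'.1 hu'.2).1 v (out2 hv'.1 hv'.2).1 (un2 hu'.1 hu'.2 h1)
      (un2 hv'.1 hv'.2 h2)
  · intro v hv hs
    have hn := hS v hv hs
    rw [hun (Finset.mem_union_left _ (h.left hv))] at hn
    by_cases h1 : Unsat A U₁ φ v
    · right
      have h2 : ¬ (v ∈ U₂ → Unsat A U₂ φ v) := fun h2 => hn ⟨fun _ => h1, h2⟩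
      rw [Classical.not_imp] at h2
      exact ⟨(h.inter v (h.left hv) h2.1).2, h2.2⟩
    · exact Or.inl h1
  · rintro v hv ⟨u, hu, h1, h2⟩
    exact hD v hv u (out1 hu).1 (un1 hu h1) h2
  · intro z hz2 hz1 hc
    obtain ⟨u, hu, hu', h1, h2⟩ := hcl z hz2 hc
    refine ⟨?_, fun v hv he => hD v hv u (out2 hu hu').1 (un2 hu hu' h1) (h2.trans he)⟩
    rintro ⟨u', hu2, h3, h4⟩
    have := hV u (out2 hu hu').1 u' (out1 hu2).1 (un2 hu hu' h1) (un1 hu2 h3) (h2.trans h4.symm)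
    exact (out1 hu2).2 (this ▸ hu)
  · intro u hu hu' hs
    have hs := not_not.1 hs
    refine ⟨?_, fun v hv hv' hsv he => hV u (out2 (h.right hu) hu').1 v (out2 (h.right hv) hv').1
      (un2 (h.right hu) hu' hs) (un2 (h.right hv) hv' (not_not.1 hsv)) he⟩
    rintro ⟨v, hv, h1, h2⟩
    have hv' := out3 hv
    have := hV u (out2 (h.right hu) hu').1 v (out2 hv'.1 hv'.2).1 (un2 (h.right hu) hu' hs)
      (un2 hv'.1 hv'.2 h1) h2.symm
    exact (Finset.mem_sdiff.1 hv).2 (this ▸ hu)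
  · rw [← h.pieceWeight_eq (φ := φ) (by simp) (by simp) (by simp [σ])]
    exact hw

/-- Partial solutions on two separated pieces with mergeable states can be glued. -/
theorem feasible_glue (h : Separated A U₁ B₁ U₂ B₂) {σ₁ σ₂ τ : BagState V} {w₁ w₂ w : ℕ}
    (hf1 : Feasible A wt U₁ B₁ σ₁ w₁) (hf2 : Feasible A wt U₂ B₂ σ₂ w₂)
    (hM : Mergeable B₁ B₂ σ₁ σ₂ τ) (hw : w₁ + w₂ + mergeCost A wt B₁ B₂ σ₂ ≤ w) :
    Feasible A wt (U₁ ∪ U₂) B₁ τ w := by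
  obtain ⟨φ₁, hV1, ⟨hE1, hS1, hD1⟩, hw1⟩ := hf1
  obtain ⟨φ₂, hV2, ⟨hE2, hS2, hD2⟩, hw2⟩ := hf2
  obtain ⟨φ, h1, h2, h3⟩ := exists_glue U₁ U₂ φ₁ φ₂ (fun u hu hu' v hv hv' => by
    have hu := h.inter u hu hu'
    have hv := h.inter v hv hv'
    rw [← hE1 u hu.1 v hv.1, ← hE2 u hu.2 v hv.2, hM.compat u hu.2 hu.1 v hv.2 hv.1])
  have hun : ∀ {v : V}, v ∈ U₁ ∪ U₂ → _ := fun {v} hv => h.unsat_iff h1 h2 (v := v) hv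
  -- a vertex of the second piece outside of the first bag that lacks an out-neighbour of its label
  have hcl : ∀ u ∈ U₂, u ∉ B₁ → Unsat A (U₁ ∪ U₂) φ u → ∀ z ∈ B₂, φ₂ z = φ₂ u →
      σ₂.Closed B₁ B₂ z := by
    intro u hu hu1 hs z hz he
    have hs2 := ((hun (Finset.mem_union_right _ hu)).1 hs).2 hu
    by_cases hu2 : u ∈ B₂
    · exact Or.inr ⟨u, hu2, hu1, (hE2 u hu2 z hz).2 he.symm, fun h' => hS2 u hu2 h' hs2⟩
    · exact Or.inl (hD2 z hz u (Finset.mem_sdiff.2 ⟨hu, hu2⟩) hs2 he.symm)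
  have hcross : ∀ u ∈ U₁, u ∉ B₁ → ∀ v ∈ U₂, v ∉ B₁ → Unsat A (U₁ ∪ U₂) φ u →
      Unsat A (U₁ ∪ U₂) φ v → φ u ≠ φ v := by
    intro u hu hu1 v hv hv1 hsu hsv he
    obtain ⟨z, hz1, hz2, e1, e2⟩ := h3 u hu v hv he
    have hz := h.inter z hz1 hz2
    exact (hM.closed z hz.2 hz.1 (hcl v hv hv1 hsv z hz.2 e2)).1
      (hD1 z hz.1 u (Finset.mem_sdiff.2 ⟨hu, hu1⟩)
        (((hun (Finset.mem_union_left _ hu)).1 hsu).1 hu) e1.symm)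
  refine ⟨φ, ?_, ⟨?_, ?_, ?_⟩, ?_⟩
  · intro u hu v hv hsu hsv he
    rw [Finset.mem_sdiff, Finset.mem_union] at hu hv
    rcases hu with ⟨hu | hu, hu1⟩ <;> rcases hv with ⟨hv | hv, hv1⟩
    · exact hV1 u (Finset.mem_sdiff.2 ⟨hu, hu1⟩) v (Finset.mem_sdiff.2 ⟨hv, hv1⟩)
        (((hun (Finset.mem_union_left _ hu)).1 hsu).1 hu)
        (((hun (Finset.mem_union_left _ hv)).1 hsv).1 hv) ((h1 u hu v hv).1 he)
    · exact absurd he (hcross u hu hu1 v hv hv1 hsu hsv)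
    · exact absurd he.symm (hcross v hv hv1 u hu hu1 hsv hsu)
    · have su := ((hun (Finset.mem_union_right _ hu)).1 hsu).2 hu
      have sv := ((hun (Finset.mem_union_right _ hv)).1 hsv).2 hv
      have he2 := (h2 u hu v hv).1 he
      by_cases hu2 : u ∈ B₂ <;> by_cases hv2 : v ∈ B₂
      · exact (hM.gone u hu2 hu1 fun h' => hS2 u hu2 h' su).2 v hv2 hv1
          (fun h' => hS2 v hv2 h' sv) ((hE2 u hu2 v hv2).2 he2)
      · exact absurd (hD2 u hu2 v (Finset.mem_sdiff.2 ⟨hv, hv2⟩) sv he2.symm)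
          (hM.gone u hu2 hu1 fun h' => hS2 u hu2 h' su).1
      · exact absurd (hD2 v hv2 u (Finset.mem_sdiff.2 ⟨hu, hu2⟩) su he2)
          (hM.gone v hv2 hv1 fun h' => hS2 v hv2 h' sv).1
      · exact hV2 u (Finset.mem_sdiff.2 ⟨hu, hu2⟩) v (Finset.mem_sdiff.2 ⟨hv, hv2⟩) su sv he2
  · intro u hu v hv
    rw [hM.eq u hu v hv, hE1 u hu v hv, h1 u (h.left hu) v (h.left hv)]
  · intro v hv hs hu
    have := (hun (Finset.mem_union_left _ (h.left hv))).1 hu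
    rcases hM.sat v hv hs with h' | ⟨h', h''⟩
    · exact hS1 v hv h' (this.1 (h.left hv))
    · exact hS2 v h' h'' (this.2 (h.right h'))
  · intro v hv u hu hs he
    rw [Finset.mem_sdiff, Finset.mem_union] at hu
    rcases hu with ⟨hu | hu, hu1⟩
    · exact hM.done v hv (hD1 v hv u (Finset.mem_sdiff.2 ⟨hu, hu1⟩)
        (((hun (Finset.mem_union_left _ hu)).1 hs).1 hu) ((h1 u hu v (h.left hv)).1 he))
    · obtain ⟨z, hz1, hz2, e1, e2⟩ := h3 v (h.left hv) u hu he.symm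
      have hz := h.inter z hz1 hz2
      exact (hM.closed z hz.2 hz.1 (hcl u hu hu1 hs z hz.2 e2)).2 v hv
        ((hE1 z hz.1 v hv).2 e1)
  · rw [h.pieceWeight_eq h1 h2 hE2]
    omega

end Separated

end Labelling

end DAGPart

namespace DAGPart

/-! ### Rooted trees given by parent pointers -/

/-- The node `x` is a child of `p`. The nodes are `0, …, N - 1`, and the root is a child of the
additional node `N`. -/
def Child (N : ℕ) (par : ℕ → ℕ) (x p : ℕ) : Prop := x < N ∧ par x = p

/-- The node `z` lies in the subtree of `y`. -/
abbrev Below (N : ℕ) (par : ℕ → ℕ) : ℕ → ℕ → Prop := Relation.ReflTransGen (Child N par)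

/-- A tree decomposition with parent pointers, with an additional root `N` that has an empty
bag. -/
structure PointerDecomposition {V : Type*} (A : Finset (V × V)) (N : ℕ) (par : ℕ → ℕ)
    (bag : ℕ → Finset V) where
  depth : ℕ → ℕ
  par_le : ∀ x < N, par x ≤ N
  depth_par : ∀ x < N, depth (par x) < depth x
  bag_root : bag N = ∅
  exists_mem_bag : ∀ v, ∃ x < N, v ∈ bag x
  exists_arc_bag : ∀ u w, (u, w) ∈ A → ∃ x < N, u ∈ bag x ∧ w ∈ bag x
  mem_of_cross : ∀ v, ∀ z < N, ∀ z' < N, ∀ y < N, v ∈ bag z → v ∈ bag z' → Below N par z y →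
    ¬ Below N par z' y → v ∈ bag y ∧ v ∈ bag (par y)

namespace PointerDecomposition

variable {V : Type*} {A : Finset (V × V)} {N : ℕ} {par : ℕ → ℕ} {bag : ℕ → Finset V}

theorem depth_le (T : PointerDecomposition A N par bag) {x y : ℕ} (h : Below N par x y) :
    T.depth y ≤ T.depth x := by
  induction h with
  | refl => exact le_rfl
  | tail _ h ih => obtain ⟨h, rfl⟩ := h; exact (T.depth_par _ h).le.trans ih

theorem below_root (T : PointerDecomposition A N par bag) {x : ℕ} (h : x < N) :
    Below N par x N := by
  induction hd : T.depth x using Nat.strong_induction_on generalizing x with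
  | h d ih =>
    refine .head ⟨h, rfl⟩ ?_
    rcases (T.par_le x h).lt_or_eq with h' | h'
    · exact ih _ (hd ▸ T.depth_par x h) h' rfl
    · rw [h']

/-- The nodes whose bags have been merged into the table of node `x`, after the nodes in `Pr` have
been merged into their parents. -/
def Merged (N : ℕ) (par : ℕ → ℕ) (Pr : Set ℕ) (x z : ℕ) : Prop :=
  z = x ∨ ∃ y ∈ Pr, Child N par y x ∧ Below N par z y

theorem merged_iff_below {Pr : Set ℕ} {x z : ℕ} (h : ∀ y, Child N par y x → y ∈ Pr) :
    Merged N par Pr x z ↔ Below N par z x := by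
  constructor
  · rintro (rfl | ⟨y, _, h1, h2⟩)
    · exact .refl
    · exact h2.tail h1
  · intro hz
    rcases hz.cases_tail with rfl | ⟨c, h1, h2⟩
    · exact Or.inl rfl
    · exact Or.inr ⟨c, h c h2, h2, h1⟩

theorem not_below_of_merged (T : PointerDecomposition A N par bag) {Pr : Set ℕ} {y p z : ℕ}
    (hy : Child N par y p) (hyP : y ∉ Pr) (hz : Merged N par Pr p z) : ¬ Below N par z y := by
  intro hzy
  have hd := T.depth_par y hy.1
  rw [hy.2] at hd
  rcases hz with rfl | ⟨y', hP, hc, hb⟩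
  · have := T.depth_le hzy; omega
  · have hd' := T.depth_par y' hc.1
    rw [hc.2] at hd'
    have key : ∀ a b, Child N par a p → Child N par b p → Below N par a b → a = b := by
      intro a b ha hb hab
      rcases hab.cases_head with h | ⟨c, h1, h2⟩
      · exact h
      · have := T.depth_le h2
        have := T.depth_par b hb.1
        rw [hb.2] at this
        rw [← h1.2, ha.2] at h2
        have := T.depth_le h2
        omega
    rcases Relation.ReflTransGen.total_of_right_unique
      (fun _ _ _ h1 h2 => h1.2.symm.trans h2.2) hzy hb with h | h
    · exact hyP (key _ _ hy hc h ▸ hP)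
    · exact hyP ((key _ _ hc hy h).symm ▸ hP)

open Classical in
/-- The vertices in the bags that have been merged into the table of node `x`. -/
noncomputable def seen [Fintype V] (N : ℕ) (par : ℕ → ℕ) (bag : ℕ → Finset V) (Pr : Set ℕ)
    (x : ℕ) : Finset V :=
  {v | ∃ z, Merged N par Pr x z ∧ v ∈ bag z}

@[simp] theorem mem_seen [Fintype V] {Pr : Set ℕ} {x : ℕ} {v : V} :
    v ∈ seen N par bag Pr x ↔ ∃ z, Merged N par Pr x z ∧ v ∈ bag z := by simp [seen]

variable [Fintype V]

theorem seen_empty (x : ℕ) : seen N par bag ∅ x = bag x := by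
  ext v; simp [Merged]

theorem seen_insert_par [DecidableEq V] {Pr : Set ℕ} {y : ℕ} (hy : y < N)
    (h : ∀ z, Child N par z y → z ∈ Pr) :
    seen N par bag (insert y Pr) (par y) =
      seen N par bag Pr (par y) ∪ seen N par bag Pr y := by
  ext v
  simp only [Finset.mem_union, mem_seen, merged_iff_below h]
  constructor
  · rintro ⟨z, rfl | ⟨y', rfl | h1, h2, h3⟩, hv⟩
    · exact Or.inl ⟨_, Or.inl rfl, hv⟩
    · exact Or.inr ⟨z, h3, hv⟩
    · exact Or.inl ⟨z, Or.inr ⟨y', h1, h2, h3⟩, hv⟩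
  · rintro (⟨z, rfl | ⟨y', h1, h2, h3⟩, hv⟩ | ⟨z, h1, hv⟩)
    · exact ⟨_, Or.inl rfl, hv⟩
    · exact ⟨z, Or.inr ⟨y', Or.inr h1, h2, h3⟩, hv⟩
    · exact ⟨z, Or.inr ⟨y, Or.inl rfl, ⟨hy, rfl⟩, h1⟩, hv⟩

theorem seen_insert_of_ne {Pr : Set ℕ} {x y : ℕ} (hx : x ≠ par y) :
    seen N par bag (insert y Pr) x = seen N par bag Pr x := by
  ext v
  simp only [mem_seen]
  refine exists_congr fun z => and_congr_left fun _ => or_congr_right ?_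
  constructor
  · rintro ⟨y', rfl | h1, h2, h3⟩
    · exact absurd h2.2.symm hx
    · exact ⟨y', h1, h2, h3⟩
  · rintro ⟨y', h1, h2, h3⟩
    exact ⟨y', Or.inr h1, h2, h3⟩

theorem seen_root (T : PointerDecomposition A N par bag) {Pr : Set ℕ} (h : ∀ y < N, y ∈ Pr) :
    seen N par bag Pr N = Finset.univ := by
  ext v
  obtain ⟨z, hz, hv⟩ := T.exists_mem_bag v
  simp only [mem_seen, Finset.mem_univ, iff_true, merged_iff_below fun y hy => h y hy.1]
  exact ⟨z, T.below_root hz, hv⟩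

/-- When a node is merged into its parent, the two pieces are separated by the bags. -/
theorem separated [DecidableEq V] (T : PointerDecomposition A N par bag) {Pr : Set ℕ} {y : ℕ}
    (hy : y < N) (hyP : y ∉ Pr) (h : ∀ z, Child N par z y → z ∈ Pr) :
    Separated A (seen N par bag Pr (par y)) (bag (par y)) (seen N par bag Pr y) (bag y) := by
  have lt_of : ∀ {z v}, z ≤ N → v ∈ bag z → z < N := fun {z v} hz hv => by
    rcases hz.lt_or_eq with h | rfl
    · exact h
    · simp [T.bag_root] at hv
  have below_le : ∀ {z p}, p ≤ N → Below N par z p → z ≤ N := fun {z p} hp hz => by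
    rcases hz.cases_head with rfl | ⟨c, h1, -⟩
    · exact hp
    · exact h1.1.le
  have merged_le : ∀ {z}, Merged N par Pr (par y) z → z ≤ N := fun {z} hz => by
    rcases hz with rfl | ⟨y', _, h2, h3⟩
    · exact T.par_le y hy
    · exact below_le h2.1.le h3
  refine ⟨fun v hv => mem_seen.2 ⟨_, Or.inl rfl, hv⟩, fun v hv => mem_seen.2 ⟨_, Or.inl rfl, hv⟩,
    fun v h1 h2 => ?_, ?_⟩
  · obtain ⟨z', hz', hv'⟩ := mem_seen.1 h1
    obtain ⟨z, hz, hv⟩ := mem_seen.1 h2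
    rw [merged_iff_below h] at hz
    exact (T.mem_of_cross v z (lt_of (below_le hy.le hz) hv) z' (lt_of (merged_le hz') hv') y hy
      hv hv' hz (T.not_below_of_merged ⟨hy, rfl⟩ hyP hz')).symm
  · intro u hu w hw hA
    obtain ⟨x, hx, hux, hwx⟩ := T.exists_arc_bag u w hA
    by_cases hb : Below N par x y
    · right
      simp only [mem_seen, merged_iff_below h]
      exact ⟨⟨x, hb, hux⟩, ⟨x, hb, hwx⟩⟩
    · left
      have key : ∀ v ∈ bag x, v ∈ seen N par bag Pr (par y) ∪ seen N par bag Pr y →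
          v ∈ seen N par bag Pr (par y) := by
        intro v hv hvu
        rcases Finset.mem_union.1 hvu with h1 | h1
        · exact h1
        · simp only [mem_seen, merged_iff_below h] at h1
          obtain ⟨z, hz, hvz⟩ := h1
          exact mem_seen.2 ⟨par y, Or.inl rfl, (T.mem_of_cross v z (lt_of (below_le hy.le hz) hvz)
            x hx y hy hvz hv hz hb).2⟩
      exact ⟨key u hux hu, key w hwx hw⟩

end PointerDecomposition

/-! ### Processing the nodes of a tree from the leaves to the root -/

/-- The state of the queue after `i` nodes have been processed: the entries of `Q` below `q` are
the nodes all of whose children have been processed, and `cnt` counts the other children. -/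
structure Peeling (N : ℕ) (par : ℕ → ℕ) (i q : ℕ) (Q cnt : ℕ → ℕ) : Prop where
  cnt_eq : ∀ x ≤ N, cnt x = ({y ∈ Finset.range N | par y = x ∧ ∀ j < i, Q j ≠ y}).card
  mem_iff : ∀ x ≤ N, (∃ j < q, Q j = x) ↔ cnt x = 0
  inj : ∀ j < q, ∀ j' < q, Q j = Q j' → j = j'
  le : ∀ j < q, Q j ≤ N
  le_length : i ≤ q

namespace Peeling

variable {N : ℕ} {par depth : ℕ → ℕ} {i q : ℕ} {Q cnt : ℕ → ℕ}

theorem child_processed (h : Peeling N par i q Q cnt) {x : ℕ} (hx : x ≤ N)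
    (hQ : ∃ j < q, Q j = x) {y : ℕ} (hy : Child N par y x) : ∃ j < i, Q j = y := by
  have h0 := h.cnt_eq x hx
  rw [(h.mem_iff x hx).1 hQ, eq_comm, Finset.card_eq_zero] at h0
  by_contra hn
  push Not at hn
  have : y ∈ ({y ∈ Finset.range N | par y = x ∧ ∀ j < i, Q j ≠ y} : Finset ℕ) := by
    simpa using ⟨hy.1, hy.2, hn⟩
  simp [h0] at this

/-- As long as not all nodes have been processed, the queue contains another node. -/
theorem next (h : Peeling N par i q Q cnt) (hpar : ∀ x < N, par x ≤ N)
    (hd : ∀ x < N, depth (par x) < depth x) (hi : i < N) : i < q ∧ Q i < N := by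
  -- fewer than `N` nodes have been processed
  have hne : ¬ ∀ x < N, ∃ j < i, Q j = x := by
    intro hall
    have : Finset.range N ⊆ (Finset.range i).image Q := by
      intro x hx
      obtain ⟨j, hj, rfl⟩ := hall x (Finset.mem_range.1 hx)
      exact Finset.mem_image_of_mem _ (Finset.mem_range.2 hj)
    have h1 := (Finset.card_le_card this).trans Finset.card_image_le
    simp at h1; omega
  have hiq : i < q := by
    by_contra hn
    obtain rfl : i = q := le_antisymm h.le_length (not_lt.1 hn)
    classical
    -- a deepest unprocessed node has no unprocessed child
    let R : Finset ℕ := {x ∈ Finset.range N | ¬ ∃ j < i, Q j = x}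
    have hR : R.Nonempty := by
      push Not at hne
      obtain ⟨x, hx, hx'⟩ := hne
      exact ⟨x, by simpa [R] using ⟨hx, hx'⟩⟩
    obtain ⟨x, hx, hmax⟩ := R.exists_max_image depth hR
    simp only [R, Finset.mem_filter, Finset.mem_range] at hx hmax
    refine hx.2 ((h.mem_iff x hx.1.le).2 ?_)
    rw [h.cnt_eq x hx.1.le, Finset.card_eq_zero, Finset.filter_eq_empty_iff]
    rintro y hy ⟨rfl, hyj⟩
    rw [Finset.mem_range] at hy
    have := hmax y ⟨hy, fun ⟨j, hj, he⟩ => hyj j hj he⟩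
    have := hd y hy
    omega
  refine ⟨hiq, lt_of_le_of_ne (h.le i hiq) fun hN => hne ?_⟩
  -- if the additional root is in the queue, then all nodes have been processed
  have key : ∀ d x, depth x = d → x < N → ∃ j < i, Q j = x := by
    intro d
    induction d using Nat.strong_induction_on with
    | h d ih =>
      intro x hxd hx
      refine h.child_processed (hpar x hx) ?_ ⟨hx, rfl⟩
      rcases (hpar x hx).lt_or_eq with h' | h'
      · obtain ⟨j, hj, he⟩ := ih _ (hxd ▸ hd x hx) _ rfl h'
        exact ⟨j, by omega, he⟩
      · exact ⟨i, hiq, by rw [hN, h']⟩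
  exact fun x hx => key _ x rfl hx

theorem succ (h : Peeling N par i q Q cnt) (hpar : ∀ x < N, par x ≤ N)
    (hiq : i < q) (hQi : Q i < N) :
    Peeling N par (i + 1) (if cnt (par (Q i)) - 1 = 0 then q + 1 else q)
      (Function.update Q q (par (Q i)))
      (Function.update cnt (par (Q i)) (cnt (par (Q i)) - 1)) := by
  set p := par (Q i) with hp
  have hpN : p ≤ N := hpar _ hQi
  have hQ' : ∀ j < q, Function.update Q q p j = Q j := fun j hj => by simp [hj.ne]
  have hyi : ∀ j < i, Q j ≠ Q i := fun j hj he => by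
    have := h.inj j (by omega) i hiq he; omega
  have hfil : ∀ x, ({y ∈ Finset.range N | par y = x ∧ ∀ j < i + 1, Function.update Q q p j ≠ y}) =
      ({y ∈ Finset.range N | par y = x ∧ ∀ j < i, Q j ≠ y}).erase (Q i) := by
    intro x
    ext y
    simp only [Finset.mem_filter, Finset.mem_erase, Finset.mem_range]
    constructor
    · rintro ⟨h1, h2, h3⟩
      refine ⟨fun he => h3 i (by omega) (by rw [hQ' i hiq, he]), h1, h2, fun j hj he => ?_⟩
      exact h3 j (by omega) (by rw [hQ' j (by omega), he])
    · rintro ⟨h0, h1, h2, h3⟩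
      refine ⟨h1, h2, fun j hj he => ?_⟩
      rw [hQ' j (by omega)] at he
      rcases Nat.lt_succ_iff_lt_or_eq.1 hj with hj | rfl
      · exact h3 j hj he
      · exact h0 he.symm
  have hmem : Q i ∈ ({y ∈ Finset.range N | par y = p ∧ ∀ j < i, Q j ≠ y} : Finset ℕ) := by
    simpa [hp] using ⟨hQi, hyi⟩
  have hpos : 0 < cnt p := by
    rw [h.cnt_eq p hpN]; exact Finset.card_pos.2 ⟨_, hmem⟩
  have hpQ : ∀ j < q, Q j ≠ p := fun j hj he => by
    have := (h.mem_iff p hpN).1 ⟨j, hj, he⟩; omega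
  refine ⟨fun x hx => ?_, fun x hx => ?_, ?_, ?_, ?_⟩
  · rw [hfil]
    by_cases hxp : x = p
    · subst hxp
      rw [Finset.card_erase_of_mem hmem, Function.update_self, h.cnt_eq _ hpN]
    · rw [Finset.erase_eq_of_notMem, Function.update_of_ne hxp, h.cnt_eq x hx]
      simp only [Finset.mem_filter, not_and]
      intro _ he
      exact absurd he.symm hxp
  · by_cases hxp : x = p
    · subst hxp
      rw [Function.update_self]
      split_ifs with h0
      · exact ⟨fun _ => h0, fun _ => ⟨q, by omega, by simp⟩⟩
      · refine ⟨fun ⟨j, hj, he⟩ => ?_, fun h' => absurd h' h0⟩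
        rw [hQ' j hj] at he
        exact absurd he (hpQ j hj)
    · rw [Function.update_of_ne hxp, ← h.mem_iff x hx]
      constructor
      · rintro ⟨j, hj, he⟩
        by_cases hjq : j = q
        · subst hjq; simp at he; exact absurd he.symm hxp
        · have hj' : j < q := by split_ifs at hj <;> omega
          exact ⟨j, hj', by rw [← he, hQ' j hj']⟩
      · rintro ⟨j, hj, he⟩
        exact ⟨j, by split_ifs <;> omega, by rw [hQ' j hj, he]⟩
  · intro j hj j' hj' he
    by_cases hjq : j = q <;> by_cases hjq' : j' = q
    · omega
    · have : j' < q := by split_ifs at hj' <;> omega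
      subst hjq
      rw [hQ' j' this, Function.update_self] at he
      exact absurd he.symm (hpQ j' this)
    · have : j < q := by split_ifs at hj <;> omega
      subst hjq'
      rw [hQ' j this, Function.update_self] at he
      exact absurd he (hpQ j this)
    · have h1 : j < q := by split_ifs at hj <;> omega
      have h2 : j' < q := by split_ifs at hj' <;> omega
      rw [hQ' j h1, hQ' j' h2] at he
      exact h.inj j h1 j' h2 he
  · intro j hj
    by_cases hjq : j = q
    · subst hjq; simpa using hpN
    · have : j < q := by split_ifs at hj <;> omega
      rw [hQ' j this]; exact h.le j this
  · split_ifs <;> omega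

end Peeling

/-! ### Tables -/

/-- The number `v` is the least `w` with `P w`, except that values above `k` do not matter. -/
def Represents (k v : ℕ) (P : ℕ → Prop) : Prop := ∀ w ≤ k, v ≤ w ↔ P w

/-- The bag state encoded by the binary digits of `c`. Every vertex of the bag list `l` owns `b + 2`
digits: the first ones for equality with the other vertices, the last two for the flags `sat` and
`done`. -/
def codeState {V : Type*} [DecidableEq V] (b : ℕ) (l : List V) (c : ℕ) : BagState V where
  eq u v := bitAt (2 ^ (b * (b + 2))) (b + 2) c (l.idxOf u) (l.idxOf v)
  sat v := bitAt (2 ^ (b * (b + 2))) (b + 2) c (l.idxOf v) b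
  done v := bitAt (2 ^ (b * (b + 2))) (b + 2) c (l.idxOf v) (b + 1)

theorem index_lt {b i j : ℕ} (hi : i < b) (hj : j < b + 2) : i * (b + 2) + j < b * (b + 2) := by
  have : (i + 1) * (b + 2) ≤ b * (b + 2) := Nat.mul_le_mul_right _ hi
  nlinarith

/-- Every state has a code. -/
theorem exists_code {V : Type*} [DecidableEq V] {b : ℕ} {l : List V} (hl : l.length ≤ b)
    (σ : BagState V) : ∃ c < 2 ^ (b * (b + 2)), σ.Agree l.toFinset (codeState b l c) := by
  classical
  let f : Fin (b * (b + 2)) → Bool := fun m =>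
    if h : (m : ℕ) / (b + 2) < l.length then
      if h' : (m : ℕ) % (b + 2) < l.length then
        decide (σ.eq l[(m : ℕ) / (b + 2)] l[(m : ℕ) % (b + 2)])
      else if (m : ℕ) % (b + 2) = b then decide (σ.sat l[(m : ℕ) / (b + 2)])
      else decide (σ.done l[(m : ℕ) / (b + 2)])
    else false
  have hdiv : ∀ i j, j < b + 2 →
      (i * (b + 2) + j) / (b + 2) = i ∧ (i * (b + 2) + j) % (b + 2) = j := by
    intro i j hj
    rw [Nat.add_comm, Nat.add_mul_div_right _ _ (by omega), Nat.div_eq_of_lt hj,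
      Nat.add_mul_mod_self_right, Nat.mod_eq_of_lt hj]
    simp
  have hidx : ∀ v ∈ l.toFinset, l.idxOf v < l.length := fun v hv =>
    List.idxOf_lt_length_iff.2 (List.mem_toFinset.1 hv)
  have hbit : ∀ i j (hi : i < b) (hj : j < b + 2),
      bitAt (2 ^ (b * (b + 2))) (b + 2) (Nat.ofBits f) i j ↔
        f ⟨i * (b + 2) + j, index_lt hi hj⟩ = true := fun i j hi hj => by
    have h1 := index_lt hi hj
    have h2 : b * (b + 2) < 2 ^ (b * (b + 2)) := Nat.lt_two_pow_self
    have h3 : i ≤ i * (b + 2) := Nat.le_mul_of_pos_right _ (by omega)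
    rw [bitAt, Nat.testBit_ofBits_lt f _ h1]
    exact ⟨fun h => h.2.2.2, fun h => ⟨by omega, (Nat.ofBits_lt_two_pow f).le, by omega, h⟩⟩
  refine ⟨Nat.ofBits f, Nat.ofBits_lt_two_pow f, fun u hu v hv => ?_, fun v hv => ?_,
    fun v hv => ?_⟩
  · have h1 := hidx u hu
    have h2 := hidx v hv
    simp only [codeState]
    rw [hbit _ _ (by omega) (by omega)]
    simp only [f, hdiv (l.idxOf u) (l.idxOf v) (by omega), dif_pos h1, dif_pos h2]
    simp
  · have h1 := hidx v hv
    simp only [codeState]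
    rw [hbit _ _ (by omega) (by omega)]
    simp only [f, hdiv (l.idxOf v) b (by omega), dif_pos h1, dif_neg (not_lt.2 hl)]
    simp
  · have h1 := hidx v hv
    simp only [codeState]
    rw [hbit _ _ (by omega) (by omega)]
    simp only [f, hdiv (l.idxOf v) (b + 1) (by omega), dif_pos h1,
      dif_neg (show ¬ b + 1 < l.length by omega)]
    simp

theorem BagState.Agree.closed {V : Type*} {B₁ B₂ : Finset V} {σ τ : BagState V}
    (h : σ.Agree B₂ τ) {z : V} (hz : z ∈ B₂) (hc : τ.Closed B₁ B₂ z) : σ.Closed B₁ B₂ z := by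
  rcases hc with hc | ⟨u, hu, h1, h2, h3⟩
  · exact Or.inl ((h.2.2 z hz).2 hc)
  · exact Or.inr ⟨u, hu, h1, (h.1 u hu z hz).2 h2, fun h4 => h3 ((h.2.1 u hu).1 h4)⟩

theorem Mergeable.congr {V : Type*} {B₁ B₂ : Finset V} {σ₁ σ₂ σ₁' σ₂' τ : BagState V}
    (h : Mergeable B₁ B₂ σ₁ σ₂ τ) (h1 : σ₁.Agree B₁ σ₁') (h2 : σ₂.Agree B₂ σ₂') :
    Mergeable B₁ B₂ σ₁' σ₂' τ where
  compat u hu hu' v hv hv' := by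
    rw [← h1.1 u hu' v hv', ← h2.1 u hu v hv, h.compat u hu hu' v hv hv']
  eq u hu v hv := by rw [h.eq u hu v hv, h1.1 u hu v hv]
  sat v hv hs := (h.sat v hv hs).imp (h1.2.1 v hv).1 fun h => ⟨h.1, (h2.2.1 v h.1).1 h.2⟩
  done v hv hs := h.done v hv ((h1.2.2 v hv).2 hs)
  closed z hz hz' hc := by
    obtain ⟨a, b⟩ := h.closed z hz hz' (h2.closed hz hc)
    exact ⟨fun hd => a ((h1.2.2 z hz').2 hd), fun v hv he => b v hv ((h1.1 z hz' v hv).2 he)⟩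
  gone u hu hu' hs := by
    obtain ⟨a, b⟩ := h.gone u hu hu' fun h' => hs ((h2.2.1 u hu).1 h')
    exact ⟨fun hd => a ((h2.2.2 u hu).2 hd), fun v hv hv' hs' he =>
      b v hv hv' (fun h' => hs' ((h2.2.1 v hv).1 h')) ((h2.1 u hu v hv).2 he)⟩

section Tables

variable {V : Type*} [DecidableEq V] {A : Finset (V × V)} {wt : V × V → ℕ}

theorem mergeCost_congr {B₁ B₂ : Finset V} {σ σ' : BagState V} (h : σ.Agree B₂ σ') :
    mergeCost A wt B₁ B₂ σ = mergeCost A wt B₁ B₂ σ' := by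
  classical
  exact Finset.sum_congr rfl fun u hu => Finset.sum_congr rfl fun v hv => by
    simp only [h.1 u hu v hv]

/-- The recurrence for the tables: the table entry for the code `c'` after merging is the least sum
of two entries with mergeable codes and the merging cost. -/
theorem Separated.represents {U₁ U₂ : Finset V} {b k : ℕ} {l₁ l₂ : List V}
    (hl₁ : l₁.length ≤ b) (hl₂ : l₂.length ≤ b)
    (h : Separated A U₁ l₁.toFinset U₂ l₂.toFinset) {t₁ t₂ : ℕ → ℕ}
    (h1 : ∀ c < 2 ^ (b * (b + 2)),
      Represents k (t₁ c) (Feasible A wt U₁ l₁.toFinset (codeState b l₁ c)))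
    (h2 : ∀ c < 2 ^ (b * (b + 2)),
      Represents k (t₂ c) (Feasible A wt U₂ l₂.toFinset (codeState b l₂ c)))
    (c' : ℕ) {v : ℕ} (hv : ∀ w ≤ k, v ≤ w ↔ ∃ c < 2 ^ (b * (b + 2)), ∃ d < 2 ^ (b * (b + 2)),
      Mergeable l₁.toFinset l₂.toFinset (codeState b l₁ c) (codeState b l₂ d) (codeState b l₁ c') ∧
        t₁ c + t₂ d + mergeCost A wt l₁.toFinset l₂.toFinset (codeState b l₂ d) ≤ w) :
    Represents k v (Feasible A wt (U₁ ∪ U₂) l₁.toFinset (codeState b l₁ c')) := by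
  intro w hw
  rw [hv w hw]
  constructor
  · rintro ⟨c, hc, d, hd, hM, hle⟩
    exact h.feasible_glue (((h1 c hc) _ (by omega)).1 le_rfl) (((h2 d hd) _ (by omega)).1 le_rfl)
      hM hle
  · intro hf
    obtain ⟨σ₁, σ₂, w₁, w₂, f1, f2, hM, hle⟩ := h.feasible_restrict hf
    obtain ⟨c, hc, a1⟩ := exists_code hl₁ σ₁
    obtain ⟨d, hd, a2⟩ := exists_code hl₂ σ₂
    refine ⟨c, hc, d, hd, hM.congr a1 a2, ?_⟩
    rw [← mergeCost_congr a2]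
    have := ((h1 c hc) w₁ (by omega)).2 (f1.congr a1)
    have := ((h2 d hd) w₂ (by omega)).2 (f2.congr a2)
    omega

end Tables

end DAGPart

namespace DAGPart

/-! ### The input as a tree decomposition with parent pointers -/

/-- In a tree, every edge joins a vertex to its parent. -/
theorem adj_parent_cases {X : Type*} {T : SimpleGraph X} (hT : T.IsTree) {root : X}
    {parent : X → X} (hadj : ∀ x, x ≠ root → T.Adj x (parent x))
    (hdist : ∀ x, x ≠ root → T.dist root x = T.dist root (parent x) + 1) {a b : X}
    (hab : T.Adj a b) : a ≠ root ∧ parent a = b ∨ b ≠ root ∧ parent b = a := by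
  by_contra hn
  -- all vertices are still connected to the root by parent edges after deleting the edge
  have hreach : ∀ d x, T.dist root x = d → (T.deleteEdges {s(a, b)}).Reachable x root := by
    intro d
    induction d with
    | zero =>
      intro x hx
      rw [(hT.connected root x).dist_eq_zero_iff.1 hx]
    | succ d ih =>
      intro x hx
      have hxr : x ≠ root := by rintro rfl; simp at hx
      have := hdist x hxr
      refine SimpleGraph.Reachable.trans (SimpleGraph.Adj.reachable ?_) (ih (parent x) (by omega))
      rw [SimpleGraph.deleteEdges_adj]
      refine ⟨hadj x hxr, fun he => hn ?_⟩
      rcases Sym2.eq_iff.1 (Set.mem_singleton_iff.1 he) with ⟨h1, h2⟩ | ⟨h1, h2⟩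
      · subst h1; exact Or.inl ⟨hxr, h2⟩
      · subst h1; exact Or.inr ⟨hxr, h2⟩
  have := SimpleGraph.isAcyclic_iff_forall_adj_isBridge.1 hT.isAcyclic hab
  rw [SimpleGraph.isBridge_iff] at this
  exact this ((hreach _ a rfl).trans (hreach _ b rfl).symm)

namespace Presentation

variable {n N : ℕ} {I : Problem (Fin n)} {D : TreeDecomposition I.arcs (Fin N)}

/-- The parent pointers, where the root points to an additional node `N`. -/
def par (E : Presentation I D) (x : ℕ) : ℕ :=
  if h : x < N then (if x = D.root then N else E.parent ⟨x, h⟩) else 0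

/-- The bag of a node as a list, empty for the additional node `N`. -/
def bagAt (E : Presentation I D) (x : ℕ) : List (Fin n) :=
  if h : x < N then E.bagList ⟨x, h⟩ else []

theorem bagAt_nodup (E : Presentation I D) (x : ℕ) : (E.bagAt x).Nodup := by
  unfold bagAt; split_ifs
  · exact E.bagList_nodup _
  · exact List.nodup_nil

theorem mem_bagAt (E : Presentation I D) (x : Fin N) (v : Fin n) :
    v ∈ E.bagAt x ↔ v ∈ D.bag x := by
  simp [bagAt, E.mem_bagList]

theorem par_val (E : Presentation I D) (x : Fin N) :
    E.par x = if x = D.root then N else (E.parent x : ℕ) := by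
  simp [par, Fin.ext_iff]

theorem child_iff (E : Presentation I D) {x y : Fin N} :
    Child N E.par x y ↔ x ≠ D.root ∧ E.parent x = y := by
  rw [Child, par_val]
  split_ifs with h
  · have := y.2
    simp [h]; omega
  · simp [h, Fin.ext_iff]

theorem pointerDecomposition (E : Presentation I D) :
    Nonempty (PointerDecomposition I.arcs N E.par fun x => (E.bagAt x).toFinset) := by
  refine ⟨⟨fun x => if h : x < N then D.tree.dist D.root ⟨x, h⟩ + 1 else 0, ?_, ?_, ?_, ?_, ?_, ?_⟩⟩
  · intro x hx
    rw [E.par_val ⟨x, hx⟩]; split_ifs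
    · exact le_rfl
    · exact (E.parent _).2.le
  · intro x hx
    rw [dif_pos hx]
    by_cases h : ⟨x, hx⟩ = D.root
    · simp [E.par_val ⟨x, hx⟩, h]
    · simp [E.par_val ⟨x, hx⟩, h, E.dist_parent _ h]
  · simp [bagAt]
  · intro v
    obtain ⟨x, hx⟩ := D.exists_mem_bag v
    exact ⟨x, x.2, by simpa [E.mem_bagAt] using hx⟩
  · intro u w huw
    obtain ⟨x, hx⟩ := D.exists_arc_bag u w huw
    exact ⟨x, x.2, by simpa [E.mem_bagAt] using hx⟩
  · intro v z hz z' hz' y hy hvz hvz' hb hb'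
    simp only [List.mem_toFinset] at *
    lift z to Fin N using hz
    lift z' to Fin N using hz'
    lift y to Fin N using hy
    rw [E.mem_bagAt] at hvz hvz'
    -- a path between the nodes within those containing `v` leaves the subtree of `y` at `y`
    have key : ∀ a a' : {x | v ∈ D.bag x}, (D.tree.induce {x | v ∈ D.bag x}).Walk a a' →
        Below N E.par a.1 y → ¬ Below N E.par a'.1 y → v ∈ E.bagAt y ∧ v ∈ E.bagAt (E.par y) := by
      intro a a' p
      induction p with
      | nil => exact fun h1 h2 => absurd h1 h2
      | @cons a c a' h _ ih =>
        intro h1 h2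
        by_cases hc : Below N E.par c.1 y
        · exact ih hc h2
        · rcases adj_parent_cases D.isTree E.adj_parent E.dist_parent
            (show D.tree.Adj a.1 c.1 from h) with h3 | h3
          · rw [← E.child_iff] at h3
            rcases h1.cases_head with h4 | ⟨c', h4, h5⟩
            · rw [← h4, h3.2, E.mem_bagAt, E.mem_bagAt]
              exact ⟨a.2, c.2⟩
            · rw [← h4.2, h3.2] at h5
              exact absurd h5 hc
          · rw [← E.child_iff] at h3
            exact absurd (h1.head h3) hc
    obtain ⟨p⟩ := (D.connected v).preconnected ⟨z, hvz⟩ ⟨z', hvz'⟩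
    exact key _ _ p hb hb'

/-! ### The initial memory -/

theorem ofList_flatMap {α : Type*} (f : α → List ℕ) (l : List α) (x : ℕ) (hx : x < l.length) (i : ℕ)
    (hi : i < (f l[x]).length) :
    ofList (l.flatMap f) (((l.take x).map fun y => (f y).length).sum + i) = (f l[x])[i] := by
  induction l generalizing x with
  | nil => simp at hx
  | cons a l ih =>
    cases x with
    | zero =>
      simp only [List.getElem_cons_zero] at hi
      simp [ofList, List.getD_eq_getElem?_getD, List.getElem?_append_left, hi]
    | succ x =>
      simp only [List.getElem_cons_succ] at hi
      have := ih x (by simpa using hx) hi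
      simp only [ofList, List.getD_eq_getElem?_getD] at this ⊢
      simp only [List.flatMap_cons, List.take_succ_cons, List.map_cons, List.sum_cons,
        List.getElem_cons_succ]
      rw [List.getElem?_append_right (by omega), ← this]
      congr 2
      omega

/-- The number of bag elements listed before the bag of node `x`. -/
def offset (E : Presentation I D) (x : ℕ) : ℕ := ∑ y ∈ Finset.range x, (E.bagAt y).length

theorem init_size (E : Presentation I D) (x : ℕ) : E.init.mem 4 x = (E.bagAt x).length := by
  simp only [Presentation.init, ofList, List.getD_eq_getElem?_getD, List.getElem?_ofFn, bagAt]
  split_ifs <;> simp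

theorem init_parent (E : Presentation I D) (x : Fin N) : E.init.mem 3 x = E.parent x := by
  simp [Presentation.init, ofList, List.getD_eq_getElem?_getD]

theorem init_elem (E : Presentation I D) {x i : ℕ} (hi : i < (E.bagAt x).length) :
    E.init.mem 5 (E.offset x + i) = (E.bagAt x)[i] := by
  have hx : x < N := by
    by_contra h
    simp [bagAt, h] at hi
  have hb : E.bagAt x = E.bagList ⟨x, hx⟩ := dif_pos hx
  have hoff : E.offset x = (((List.finRange N).take x).map fun y =>
      ((E.bagList y).map fun v : Fin n => (v : ℕ)).length).sum := by
    have : ∀ m ≤ N, E.offset m = (((List.finRange N).take m).map fun y =>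
        ((E.bagList y).map fun v : Fin n => (v : ℕ)).length).sum := by
      intro m
      induction m with
      | zero => simp [offset]
      | succ m ih =>
        intro hm
        rw [offset, Finset.sum_range_succ, ← offset, ih (by omega), List.take_succ_eq_append_getElem
          (by simpa using hm)]
        simp [bagAt, show m < N by omega]
    exact this x hx.le
  rw [hoff]
  have := ofList_flatMap (fun x => (E.bagList x).map fun v : Fin n => (v : ℕ)) (List.finRange N) x
    (by simpa using hx) i (by simpa [hb] using hi)
  have h5 : E.init.mem 5 =
      ofList ((List.finRange N).flatMap fun x => (E.bagList x).map fun v : Fin n => (v : ℕ)) := by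
    simp only [Presentation.init]
    congr 2
    funext x
    simp [← List.map_eq_flatMap]
  rw [h5, this]
  simp [hb]

theorem init_arc (E : Presentation I D) {e : ℕ} (he : e < E.arcList.length) :
    E.init.mem 0 e = E.arcList[e].1 ∧ E.init.mem 1 e = E.arcList[e].2 ∧
      E.init.mem 2 e = I.weight E.arcList[e] := by
  simp [Presentation.init, ofList, List.getD_eq_getElem?_getD, he]

theorem length_bagAt_le (E : Presentation I D) (x : ℕ) :
    (E.bagAt x).length ≤ Finset.univ.sup fun x => (D.bag x).card := by
  unfold bagAt
  split_ifs with h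
  · have : (D.bag ⟨x, h⟩).card = (E.bagList ⟨x, h⟩).length := by
      rw [← List.toFinset_card_of_nodup (E.bagList_nodup _)]
      congr 1
      ext v; simp [E.mem_bagList]
    rw [← this]
    exact Finset.le_sup (f := fun x => (D.bag x).card) (Finset.mem_univ _)
  · simp

/-- Every arc lies in a bag, so that there are at most `b ^ 2` arcs per node. -/
theorem length_arcList_le (E : Presentation I D) :
    E.arcList.length ≤ N * (Finset.univ.sup fun x => (D.bag x).card) ^ 2 := by
  have h1 : E.arcList.length = I.arcs.card := by
    rw [← List.toFinset_card_of_nodup E.arcList_nodup]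
    congr 1
    ext a; simp [E.mem_arcList]
  have h2 : I.arcs ⊆ Finset.univ.biUnion fun x => D.bag x ×ˢ D.bag x := by
    rintro ⟨u, w⟩ h
    obtain ⟨x, hx⟩ := D.exists_arc_bag u w h
    simpa using ⟨x, hx⟩
  rw [h1]
  refine (Finset.card_le_card h2).trans (Finset.card_biUnion_le.trans ?_)
  refine (Finset.sum_le_card_nsmul _ _ ((Finset.univ.sup fun x => (D.bag x).card) ^ 2)
    fun x _ => ?_).trans_eq (by simp)
  rw [Finset.card_product, ← sq]
  exact Nat.pow_le_pow_left (Finset.le_sup (f := fun x => (D.bag x).card) (Finset.mem_univ _)) 2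

end Presentation

end DAGPart

namespace DAGPart

/-! ### The table entries as terms -/

namespace Term

/-- The element at position `i` of the bag of node `x`. -/
def elemT (x i : ℕ) : Term := load 5 (add (load 8 (var x)) (var i))
/-- The number `i` is a position in the bag of node `x`. -/
def inT (x i : ℕ) : Term := ltT (var i) (load 4 (var x))
/-- The weight of the arc between the elements at the positions `i` and `j` of the bag of node `x`,
and zero if there is no such arc. -/
def weightT (x i j : ℕ) : Term := load 7 (add (load 6 (elemT x i)) (elemT x j))
/-- Quantification over the positions in the bag of node `x`. -/
def allInT (x i : ℕ) (t : Term) : Term := allT i (impT (inT x i) t)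
def exInT (x i : ℕ) (t : Term) : Term := notT (allInT x i (notT t))
/-- Summation over the positions in the bag of node `x`. -/
def sumInT (x i : ℕ) (t : Term) : Term := sumT i (ite (inT x i) t (lit 0))
/-- Position `i` of the bag of the child `11` holds the same vertex as position `j` of the bag of
the parent `12`. -/
def sameT (i j : ℕ) : Term := eqT (elemT 11 i) (elemT 12 j)
/-- The vertex at position `i` of the bag of the child is missing in the bag of the parent. -/
def goneT (i : ℕ) : Term := allInT 12 25 (notT (sameT i 25))

/-- The initial table entry of node `16` for the code in register `13`. -/
def initT : Term :=
  ite (andT (allInT 16 20 (bitT 13 20 20))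
    (andT (allInT 16 20 (allInT 16 21 (allInT 16 22
      (impT (bitT 13 20 21) (impT (bitT 13 20 22) (bitT 13 21 22))))))
    (allInT 16 20 (impT (bitT 13 20 7)
      (exInT 16 21 (andT (bitT 13 20 21) (weightT 16 20 21)))))))
  (lit 0) (add (var 2) (lit 1))

/-! The conditions in `Mergeable`, for the codes in register `14` for the parent, in register `15`
for the child, and in register `13` for the result. -/

/-- The codes for the child and for the parent agree on the equalities of common vertices. -/
def compatT : Term :=
  allInT 11 20 (allInT 12 21 (impT (sameT 20 21) (allInT 11 22 (allInT 12 23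
    (impT (sameT 22 23) (iffT (bitT 15 20 22) (bitT 14 21 23)))))))
def eqClauseT : Term := allInT 12 20 (allInT 12 21 (iffT (bitT 13 20 21) (bitT 14 20 21)))
def satClauseT : Term := allInT 12 20 (impT (bitT 13 20 7)
  (orT (bitT 14 20 7) (exInT 11 21 (andT (sameT 21 20) (bitT 15 21 7)))))
def doneClauseT : Term := allInT 12 20 (impT (bitT 14 20 8) (bitT 13 20 8))
/-- The condition `BagState.Closed` for the vertex at position `20` of the bag of the child. -/
def closedT : Term := orT (bitT 15 20 8)
  (exInT 11 24 (andT (goneT 24) (andT (bitT 15 24 20) (notT (bitT 15 24 7)))))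
def closedClauseT : Term := allInT 11 20 (allInT 12 21 (impT (sameT 20 21) (impT closedT
  (andT (notT (bitT 14 21 8)) (allInT 12 22 (impT (bitT 14 21 22) (bitT 13 22 8)))))))
def goneClauseT : Term := allInT 11 20 (impT (goneT 20) (impT (notT (bitT 15 20 7))
  (andT (notT (bitT 15 20 8)) (allInT 11 21 (impT (goneT 21) (impT (notT (bitT 15 21 7))
    (impT (bitT 15 20 21) (eqT (var 20) (var 21)))))))))

/-- The codes in the registers `14` and `15` may be merged into the code in register `13`. -/
def mergeableT : Term := andT compatT (andT eqClauseT (andT satClauseT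
  (andT doneClauseT (andT closedClauseT goneClauseT))))

/-- The merging cost of the child's code in register `15`. -/
def costT : Term := sumInT 11 20 (sumInT 11 21
  (ite (andT (notT (andT (notT (goneT 20)) (notT (goneT 21)))) (notT (bitT 15 20 21)))
    (weightT 11 20 21) (lit 0)))

/-- The table entry for node `x` and code `c`. -/
def entryT (x c : ℕ) : Term := load 12 (add (load 11 (var x)) (var c))

/-- The new table entry of the parent for the code in register `13`. -/
def mergeT : Term := minT 14 (add (var 2) (lit 1)) (minT 15 (add (var 2) (lit 1))
  (ite mergeableT (add (add (entryT 12 14) (entryT 11 15)) costT) (add (var 2) (lit 1))))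

/-- Whether some table entry of the additional root is at most the bound. -/
def answerT : Term := notT (ltT (var 2) (minT 13 (add (var 2) (lit 1)) (entryT 3 13)))

section

variable {x i : ℕ} {t : Term}

@[simp] theorem uses_allInT : (allInT x i t).uses 63 = false := by simp [allInT]
@[simp] theorem uses_exInT : (exInT x i t).uses 63 = false := by simp [exInT]
@[simp] theorem uses_sumInT : (sumInT x i t).uses 63 = false := by simp [sumInT]
@[simp] theorem uses_elemT (hx : x < 60) (hi : i < 60) : (elemT x i).uses 63 = false := by
  simp [elemT]; omega
@[simp] theorem uses_goneT : (goneT i).uses 63 = false := by simp [goneT]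

theorem holds_allInT (hi : i < 60) (hx : x < 60) (hxi : x ≠ i) (ht : t.uses 63 = false)
    (s : State) : (allInT x i t).Holds s ↔
      ∀ j < s.reg 5, j < s.mem 4 (s.reg x) → t.Holds (s.setReg i j) := by
  rw [allInT, holds_allT (by omega) (by simp [ht, inT]; omega)]
  simp [inT, hxi]

theorem holds_exInT (hi : i < 60) (hx : x < 60) (hxi : x ≠ i) (ht : t.uses 63 = false)
    (s : State) : (exInT x i t).Holds s ↔
      ¬ ∀ j < s.reg 5, j < s.mem 4 (s.reg x) → ¬ t.Holds (s.setReg i j) := by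
  rw [exInT, holds_notT, holds_allInT hi hx hxi (by simpa using ht)]
  simp

theorem eval_sumInT (hi : i < 60) (hx : x < 60) (hxi : x ≠ i) (ht : t.uses 63 = false)
    (s : State) : (sumInT x i t).eval s = ∑ j ∈ Finset.range (s.reg 5),
      if j < s.mem 4 (s.reg x) then t.eval (s.setReg i j) else 0 := by
  classical
  rw [sumInT, eval_sumT (by omega) (by simp [ht, inT]; omega)]
  refine Finset.sum_congr rfl fun j _ => ?_
  rw [eval_ite]
  simp [inT, hxi]

end

end Term

theorem forall_lt_length_iff {α : Type*} [DecidableEq α] {l : List α} (hl : l.Nodup) {m : ℕ}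
    (hm : l.length ≤ m) (P : ℕ → Prop) :
    (∀ j < m, j < l.length → P j) ↔ ∀ v ∈ l.toFinset, P (l.idxOf v) := by
  simp only [List.mem_toFinset]
  constructor
  · intro h v hv
    have := List.idxOf_lt_length_iff.2 hv
    exact h _ (by omega) this
  · intro h j _ hj
    have := h l[j] (List.getElem_mem hj)
    rwa [hl.idxOf_getElem] at this

theorem sum_lt_length_eq {α : Type*} [DecidableEq α] {l : List α} (hl : l.Nodup) {m : ℕ}
    (hm : l.length ≤ m) (f : ℕ → ℕ) :
    (∑ j ∈ Finset.range m, if j < l.length then f j else 0) = ∑ v ∈ l.toFinset, f (l.idxOf v) := by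
  rw [← Finset.sum_filter]
  refine (Finset.sum_bij (fun v _ => l.idxOf v) ?_ ?_ ?_ ?_).symm
  · intro v hv
    have := List.idxOf_lt_length_iff.2 (List.mem_toFinset.1 hv)
    simp; omega
  · intro u hu v _ h
    exact (List.idxOf_inj (List.mem_toFinset.1 hu)).1 h
  · intro j hj
    simp only [Finset.mem_filter] at hj
    exact ⟨l[j]'hj.2, by simp, hl.idxOf_getElem j hj.2⟩
  · simp

/-- The data that stay fixed while the tables are filled: the parameters in the registers `2` to
`9`, bag sizes and elements, parents, weights, and the multiplication tables. Here `b` is an upper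
bound on the bag sizes. -/
structure Prepared {n N : ℕ} {I : Problem (Fin n)} {D : TreeDecomposition I.arcs (Fin N)}
    (E : Presentation I D) (b : ℕ) (s : State) : Prop where
  bag_le : ∀ x, (E.bagAt x).length ≤ b
  reg2 : s.reg 2 = I.k
  reg3 : s.reg 3 = N
  reg5 : s.reg 5 = 2 ^ (b * (b + 2))
  reg6 : s.reg 6 = b + 2
  reg7 : s.reg 7 = b
  reg8 : s.reg 8 = b + 1
  reg9 : s.reg 9 = N + 1
  size : ∀ x, s.mem 4 x = (E.bagAt x).length
  elem : ∀ x, ∀ v ∈ E.bagAt x, s.mem 5 (s.mem 8 x + (E.bagAt x).idxOf v) = v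
  parent : ∀ x < N, s.mem 3 x = E.par x
  weight : ∀ u w : Fin n, s.mem 7 (s.mem 6 u + w) = if (u, w) ∈ I.arcs then I.weight (u, w) else 0
  row : ∀ x ≤ N, s.mem 11 x = x * 2 ^ (b * (b + 2))

namespace Prepared

variable {n N : ℕ} {I : Problem (Fin n)} {D : TreeDecomposition I.arcs (Fin N)}
  {E : Presentation I D} {b : ℕ} {s : State}

theorem congr {s' : State} (h : Prepared E b s) (hr : ∀ r, 2 ≤ r → r < 10 → s'.reg r = s.reg r)
    (hm : ∀ a < 12, a ≠ 9 → a ≠ 10 → s'.mem a = s.mem a) : Prepared E b s' where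
  bag_le := h.bag_le
  reg2 := by rw [hr 2 (by omega) (by omega), h.reg2]
  reg3 := by rw [hr 3 (by omega) (by omega), h.reg3]
  reg5 := by rw [hr 5 (by omega) (by omega), h.reg5]
  reg6 := by rw [hr 6 (by omega) (by omega), h.reg6]
  reg7 := by rw [hr 7 (by omega) (by omega), h.reg7]
  reg8 := by rw [hr 8 (by omega) (by omega), h.reg8]
  reg9 := by rw [hr 9 (by omega) (by omega), h.reg9]
  size := by rw [hm 4 (by omega) (by omega) (by omega)]; exact h.size
  elem := by
    rw [hm 5 (by omega) (by omega) (by omega), hm 8 (by omega) (by omega) (by omega)]; exact h.elem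
  parent := by rw [hm 3 (by omega) (by omega) (by omega)]; exact h.parent
  weight := by
    rw [hm 7 (by omega) (by omega) (by omega), hm 6 (by omega) (by omega) (by omega)]
    exact h.weight
  row := by rw [hm 11 (by omega) (by omega) (by omega)]; exact h.row

theorem bag_le_size (h : Prepared E b s) (x : ℕ) : (E.bagAt x).length ≤ 2 ^ (b * (b + 2)) := by
  have h1 := h.bag_le x
  have h2 : b * (b + 2) < 2 ^ (b * (b + 2)) := Nat.lt_two_pow_self
  have h3 : b ≤ b * (b + 2) := Nat.le_mul_of_pos_right _ (by omega)
  omega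

end Prepared

end DAGPart

set_option linter.unusedSimpArgs false
namespace DAGPart

/-! ### The values of the terms for the table entries -/

namespace Term

theorem holds_weightT {x i j : ℕ} (s : State) : (weightT x i j).Holds s ↔
    ¬ s.mem 7 (s.mem 6 (s.mem 5 (s.mem 8 (s.reg x) + s.reg i)) +
      s.mem 5 (s.mem 8 (s.reg x) + s.reg j)) = 0 := Iff.rfl

@[simp] theorem uses_weightT {x i j : ℕ} (hx : x < 60) (hi : i < 60) (hj : j < 60) :
    (weightT x i j).uses 63 = false := by simp [weightT, hx, hi, hj]

theorem holds_sameT {i j : ℕ} (s : State) : (sameT i j).Holds s ↔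
    s.mem 5 (s.mem 8 (s.reg 11) + s.reg i) = s.mem 5 (s.mem 8 (s.reg 12) + s.reg j) := by
  rw [sameT, holds_eqT]; rfl

@[simp] theorem uses_sameT {i j : ℕ} (hi : i < 60) (hj : j < 60) :
    (sameT i j).uses 63 = false := by simp [sameT, hi, hj]

theorem holds_goneT {i : ℕ} (hi : i < 25) (s : State) : (goneT i).Holds s ↔
    ∀ j < s.reg 5, j < s.mem 4 (s.reg 12) → ¬ s.mem 5 (s.mem 8 (s.reg 11) + s.reg i) =
      s.mem 5 (s.mem 8 (s.reg 12) + j) := by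
  have h : i ≠ 25 := by omega
  rw [goneT, holds_allInT (by decide) (by decide) (by decide) (by
    simp [show i < 60 by omega])]
  simp [holds_sameT, h]

end Term

open Term

namespace Prepared

variable {n N : ℕ} {I : Problem (Fin n)} {D : TreeDecomposition I.arcs (Fin N)}
  {E : Presentation I D} {b : ℕ} {s : State}

/-- The initial table entries represent the feasible weights for a single bag. -/
theorem represents_initT (h : Prepared E b s) {x c : ℕ} (hx : s.reg 16 = x) (hc : s.reg 13 = c) :
    Represents I.k (initT.eval s) (Feasible I.arcs I.weight (E.bagAt x).toFinset
      (E.bagAt x).toFinset (codeState b (E.bagAt x) c)) := by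
  classical
  intro w hw
  rw [feasible_self_iff, initT, eval_ite]
  simp +contextual only [holds_andT, holds_allInT, holds_exInT, holds_impT, holds_bitT,
    State.setReg_reg, State.setReg_mem, uses_bitT, uses_impT, uses_allInT, uses_exInT, uses_andT,
    Nat.reduceLT, Bool.or_self, Nat.reduceEqDiff, ne_eq, not_false_eq_true, holds_weightT,
    uses_weightT, decide_false, if_true, if_false, h.size, hx, hc, h.reg5, h.reg6, h.reg7,
    forall_lt_length_iff (E.bagAt_nodup _) (h.bag_le_size _), eval_lit, eval_add, eval_var,
    List.mem_toFinset, h.elem, h.weight, h.reg2, codeState]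
  have harc : ∀ a, ¬ (if a ∈ I.arcs then I.weight a else 0) = 0 ↔ a ∈ I.arcs := by
    intro a
    split_ifs with ha
    · simpa [ha] using (I.weight_pos a ha).ne'
    · simpa using ha
  simp only [harc, not_forall, not_not, exists_prop]
  split_ifs with hP
  · simpa using hP
  · exact ⟨fun h' => by omega, fun h' => absurd h' hP⟩

section Merge

variable {y p c c₁ c₂ : ℕ}

theorem holds_mergeableT (h : Prepared E b s) (hy : s.reg 11 = y) (hp : s.reg 12 = p)
    (hc : s.reg 13 = c) (hc₁ : s.reg 14 = c₁) (hc₂ : s.reg 15 = c₂) :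
    mergeableT.Holds s ↔ Mergeable (E.bagAt p).toFinset (E.bagAt y).toFinset
      (codeState b (E.bagAt p) c₁) (codeState b (E.bagAt y) c₂) (codeState b (E.bagAt p) c) := by
  have h1 : compatT.Holds s ↔ ∀ u ∈ E.bagAt y, u ∈ E.bagAt p → ∀ v ∈ E.bagAt y, v ∈ E.bagAt p →
      ((codeState b (E.bagAt y) c₂).eq u v ↔ (codeState b (E.bagAt p) c₁).eq u v) := by
    simp +contextual only [compatT, holds_andT, holds_allInT, holds_exInT, holds_impT, holds_bitT,
      holds_iffT, uses_iffT, State.setReg_reg, State.setReg_mem, uses_bitT, uses_impT, uses_allInT,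
      Nat.reduceLT, Bool.or_self, Nat.reduceEqDiff, ne_eq, not_false_eq_true, holds_sameT,
      uses_sameT, if_true, if_false, h.size, hy, hp, hc, hc₁, hc₂, h.reg5, h.reg6,
      forall_lt_length_iff (E.bagAt_nodup _) (h.bag_le_size _),
      List.mem_toFinset, h.elem, codeState, Fin.val_inj]
    constructor
    · exact fun H u hu hu' v hv hv' => H u hu u hu' rfl v hv v hv' rfl
    · rintro H u hu _ hu' rfl v hv _ hv' rfl
      exact H u hu hu' v hv hv'
  have h2 : eqClauseT.Holds s ↔ ∀ u ∈ E.bagAt p, ∀ v ∈ E.bagAt p,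
      (codeState b (E.bagAt p) c).eq u v ↔ (codeState b (E.bagAt p) c₁).eq u v := by
    simp +contextual only [eqClauseT, holds_allInT, holds_bitT,
      holds_iffT, uses_iffT, State.setReg_reg, State.setReg_mem, uses_bitT, uses_allInT,
      Nat.reduceLT, Bool.or_self, Nat.reduceEqDiff, ne_eq, not_false_eq_true,
      if_true, if_false, h.size, hy, hp, hc, hc₁, hc₂, h.reg5, h.reg6,
      forall_lt_length_iff (E.bagAt_nodup _) (h.bag_le_size _), List.mem_toFinset, codeState]
  have h3 : satClauseT.Holds s ↔ ∀ v ∈ E.bagAt p, (codeState b (E.bagAt p) c).sat v →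
      (codeState b (E.bagAt p) c₁).sat v ∨ v ∈ E.bagAt y ∧ (codeState b (E.bagAt y) c₂).sat v := by
    simp +contextual only [satClauseT, holds_andT, holds_allInT, holds_exInT, holds_impT,
      holds_bitT, holds_orT, uses_orT, uses_andT, State.setReg_reg, State.setReg_mem, uses_bitT,
      uses_impT, uses_allInT, uses_exInT,
      Nat.reduceLT, Bool.or_self, Nat.reduceEqDiff, ne_eq, not_false_eq_true, holds_sameT,
      uses_sameT, if_true, if_false, h.size, hy, hp, hc, hc₁, hc₂, h.reg5, h.reg6, h.reg7,
      forall_lt_length_iff (E.bagAt_nodup _) (h.bag_le_size _),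
      List.mem_toFinset, h.elem, codeState, Fin.val_inj, not_forall, not_not, exists_prop]
    refine forall₃_congr fun v hv _ => or_congr_right ?_
    constructor
    · rintro ⟨u, hu, rfl, hs⟩; exact ⟨hu, hs⟩
    · rintro ⟨hv, hs⟩; exact ⟨v, hv, rfl, hs⟩
  have h4 : doneClauseT.Holds s ↔ ∀ v ∈ E.bagAt p, (codeState b (E.bagAt p) c₁).done v →
      (codeState b (E.bagAt p) c).done v := by
    simp +contextual only [doneClauseT, holds_allInT, holds_impT,
      holds_bitT, State.setReg_reg, State.setReg_mem, uses_bitT, uses_impT, uses_allInT,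
      Nat.reduceLT, Bool.or_self, Nat.reduceEqDiff, ne_eq, not_false_eq_true,
      if_true, if_false, h.size, hy, hp, hc, hc₁, hc₂, h.reg5, h.reg6, h.reg8,
      forall_lt_length_iff (E.bagAt_nodup _) (h.bag_le_size _), List.mem_toFinset, codeState]
  have hgone : ∀ u : Fin n, (∀ v ∈ E.bagAt p, ¬ u = v) ↔ u ∉ E.bagAt p := fun u =>
    ⟨fun H hu => H u hu rfl, fun H v hv he => H (he ▸ hv)⟩
  have h5 : closedClauseT.Holds s ↔ ∀ z ∈ E.bagAt y, z ∈ E.bagAt p →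
      (codeState b (E.bagAt y) c₂).Closed (E.bagAt p).toFinset (E.bagAt y).toFinset z →
      ¬ (codeState b (E.bagAt p) c₁).done z ∧ ∀ v ∈ E.bagAt p,
        (codeState b (E.bagAt p) c₁).eq z v → (codeState b (E.bagAt p) c).done v := by
    simp +contextual only [closedClauseT, closedT, holds_andT, holds_allInT, holds_exInT,
      holds_impT, holds_notT, uses_notT, holds_goneT, uses_goneT,
      holds_bitT, holds_orT, uses_orT, uses_andT, State.setReg_reg, State.setReg_mem, uses_bitT,
      uses_impT, uses_allInT, uses_exInT,
      Nat.reduceLT, Bool.or_self, Nat.reduceEqDiff, ne_eq, not_false_eq_true, holds_sameT,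
      uses_sameT, if_true, if_false, h.size, hy, hp, hc, hc₁, hc₂, h.reg5, h.reg6, h.reg7, h.reg8,
      forall_lt_length_iff (E.bagAt_nodup _) (h.bag_le_size _),
      List.mem_toFinset, h.elem, codeState, Fin.val_inj, hgone, BagState.Closed]
    simp only [not_forall, not_not, exists_prop]
    constructor
    · exact fun H z hz hz' hc => H z hz z hz' rfl hc
    · rintro H z hz _ hz' rfl hc
      exact H z hz hz' hc
  have h6 : goneClauseT.Holds s ↔ ∀ u ∈ E.bagAt y, u ∉ E.bagAt p →
      ¬ (codeState b (E.bagAt y) c₂).sat u → ¬ (codeState b (E.bagAt y) c₂).done u ∧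
        ∀ v ∈ E.bagAt y, v ∉ E.bagAt p → ¬ (codeState b (E.bagAt y) c₂).sat v →
          (codeState b (E.bagAt y) c₂).eq u v → u = v := by
    have hidx : ∀ u ∈ E.bagAt y, ∀ v, (E.bagAt y).idxOf u = (E.bagAt y).idxOf v ↔ u = v :=
      fun u hu v => List.idxOf_inj hu
    simp +contextual only [goneClauseT, holds_andT, holds_allInT, holds_exInT,
      holds_impT, holds_notT, uses_notT, holds_goneT, uses_goneT, holds_eqT, uses_eqT, eval_var,
      uses_var, decide_false,
      holds_bitT, uses_andT, State.setReg_reg, State.setReg_mem, uses_bitT,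
      uses_impT, uses_allInT, uses_exInT,
      Nat.reduceLT, Bool.or_self, Nat.reduceEqDiff, ne_eq, not_false_eq_true, holds_sameT,
      uses_sameT, if_true, if_false, h.size, hy, hp, hc, hc₁, hc₂, h.reg5, h.reg6, h.reg7, h.reg8,
      forall_lt_length_iff (E.bagAt_nodup _) (h.bag_le_size _),
      List.mem_toFinset, h.elem, codeState, Fin.val_inj, hgone, hidx]
  rw [mergeableT, holds_andT, holds_andT, holds_andT, holds_andT, holds_andT, h1, h2, h3, h4, h5,
    h6]
  constructor
  · rintro ⟨a1, a2, a3, a4, a5, a6⟩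
    constructor <;> simpa only [List.mem_toFinset]
  · rintro ⟨a1, a2, a3, a4, a5, a6⟩
    simp only [List.mem_toFinset] at a1 a2 a3 a4 a5 a6
    exact ⟨a1, a2, a3, a4, a5, a6⟩

theorem eval_costT (h : Prepared E b s) (hy : s.reg 11 = y) (hp : s.reg 12 = p)
    (hc₂ : s.reg 15 = c₂) : costT.eval s = mergeCost I.arcs I.weight (E.bagAt p).toFinset
      (E.bagAt y).toFinset (codeState b (E.bagAt y) c₂) := by
  classical
  have hgone : ∀ u : Fin n, (∀ v ∈ E.bagAt p, ¬ u = v) ↔ u ∉ E.bagAt p := fun u =>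
    ⟨fun H hu => H u hu rfl, fun H v hv he => H (he ▸ hv)⟩
  have hw : ∀ s : State, (weightT 11 20 21).eval s =
      s.mem 7 (s.mem 6 (s.mem 5 (s.mem 8 (s.reg 11) + s.reg 20)) +
      s.mem 5 (s.mem 8 (s.reg 11) + s.reg 21)) := fun _ => rfl
  rw [costT, eval_sumInT (by decide) (by decide) (by decide) (by simp), h.reg5, h.size, hy,
    sum_lt_length_eq (E.bagAt_nodup _) (h.bag_le_size _), mergeCost]
  refine Finset.sum_congr rfl fun u hu => ?_
  rw [List.mem_toFinset] at hu
  rw [eval_sumInT (by decide) (by decide) (by decide) (by simp)]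
  simp only [State.setReg_reg, State.setReg_mem, Nat.reduceEqDiff, if_false, h.reg5, h.size, hy]
  rw [sum_lt_length_eq (E.bagAt_nodup _) (h.bag_le_size _)]
  refine Finset.sum_congr rfl fun v hv => ?_
  rw [List.mem_toFinset] at hv
  rw [eval_ite, hw]
  simp +contextual only [holds_andT, holds_notT, holds_goneT, holds_bitT, State.setReg_reg,
    State.setReg_mem, Nat.reduceLT, Nat.reduceEqDiff, if_true, if_false, h.size, hy, hp, hc₂,
    h.reg5, h.reg6, forall_lt_length_iff (E.bagAt_nodup _) (h.bag_le_size _), List.mem_toFinset,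
    h.elem, hu, hv, codeState, Fin.val_inj, hgone, h.weight, eval_lit, not_not]

/-- The merged table entry is the minimum in the recurrence for the tables, capped at the first
value above the bound. -/
theorem mergeT_le_iff (h : Prepared E b s) (hy : s.reg 11 = y) (hp : s.reg 12 = p)
    (hc : s.reg 13 = c) (hyN : y ≤ N) (hpN : p ≤ N) {w : ℕ} (hw : w ≤ I.k) :
    mergeT.eval s ≤ w ↔ ∃ c₁ < 2 ^ (b * (b + 2)), ∃ c₂ < 2 ^ (b * (b + 2)),
      Mergeable (E.bagAt p).toFinset (E.bagAt y).toFinset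
        (codeState b (E.bagAt p) c₁) (codeState b (E.bagAt y) c₂) (codeState b (E.bagAt p) c) ∧
      s.mem 12 (p * 2 ^ (b * (b + 2)) + c₁) + s.mem 12 (y * 2 ^ (b * (b + 2)) + c₂) +
        mergeCost I.arcs I.weight (E.bagAt p).toFinset (E.bagAt y).toFinset
          (codeState b (E.bagAt y) c₂) ≤ w := by
  classical
  have hk : ¬ I.k + 1 ≤ w := by omega
  have hent : ∀ (x c : ℕ) (s : State), (entryT x c).eval s =
      s.mem 12 (s.mem 11 (s.reg x) + s.reg c) := fun _ _ _ => rfl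
  rw [mergeT, eval_minT_le (by decide) rfl]
  simp only [eval_add, eval_var, eval_lit, h.reg2, h.reg5, hk, false_or]
  refine exists_congr fun c₁ => and_congr_right fun _ => ?_
  rw [eval_minT_le (by decide) rfl]
  simp only [eval_add, eval_var, eval_lit, State.setReg_reg, Nat.reduceEqDiff, if_false,
    h.reg2, h.reg5, hk, false_or]
  refine exists_congr fun c₂ => and_congr_right fun _ => ?_
  have h' : Prepared E b ((s.setReg 14 c₁).setReg 15 c₂) := h.congr
    (fun r h1 h2 => by simp [show r ≠ 15 by omega, show r ≠ 14 by omega]) (fun _ _ _ _ => rfl)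
  rw [eval_ite, h'.holds_mergeableT (y := y) (p := p) (c := c) (c₁ := c₁) (c₂ := c₂)
    (by simp [hy]) (by simp [hp]) (by simp [hc]) (by simp) (by simp)]
  rw [eval_add, eval_add, h'.eval_costT (y := y) (p := p) (c₂ := c₂)
    (by simp [hy]) (by simp [hp]) (by simp), hent, hent]
  simp only [State.setReg_reg, State.setReg_mem, Nat.reduceEqDiff, if_true, if_false, hy, hp,
    h.row _ hyN, h.row _ hpN, eval_add, eval_var, eval_lit, h.reg2]
  split_ifs with hM
  · simp [hM]
  · simp [hM]; omega

end Merge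

end Prepared

end DAGPart

namespace DAGPart

/-! ### The program -/

namespace Prog

theorem run_loop {x r : ℕ} {c : Prog} (P : ℕ → State → Prop) {s : State} (h0 : P 0 s)
    (hstep : ∀ j < s.reg r, ∀ s', P j s' → P (j + 1) (c.run (s'.setReg x j))) :
    P (s.reg r) ((loop x r c).run s) := by
  have : ∀ m ≤ s.reg r, P m (Nat.rec s (fun j s' => c.run (s'.setReg x j)) m) := by
    intro m
    induction m with
    | zero => exact fun _ => h0
    | succ m ih => exact fun hm => hstep m hm _ (ih (by omega))
  exact this _ le_rfl

open Term

/-- Puts the largest bag size `b` into register `7`, and `b + 1`, `b + 2`, and the number of nodes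
including the additional root into the registers `8`, `6`, and `9`. -/
def measure : Prog :=
  seq (loop 16 3 (assign 7 (ite (sub (load 4 (var 16)) (var 7)) (load 4 (var 16)) (var 7))))
    (seq (assign 8 (add (var 7) (lit 1))) (seq (assign 6 (add (var 7) (lit 2)))
      (assign 9 (add (var 3) (lit 1)))))

/-- Puts the number of codes into register `17`. -/
def power : Prog :=
  seq (assign 17 (lit 1)) (loop 16 7 (loop 18 6 (assign 17 (add (var 17) (var 17)))))

/-- Fills array `a` with the multiples of register `v`. -/
def multiples (a r v : ℕ) : Prog :=
  loop 16 r (store a (add (var 16) (lit 1)) (add (load a (var 16)) (var v)))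

/-- Fills array `7` with the matrix of the arc weights. -/
def weights : Prog :=
  loop 16 1 (store 7 (add (load 6 (load 0 (var 16))) (load 1 (var 16))) (load 2 (var 16)))

/-- Fills array `8` with the positions in array `5` where the bags begin. -/
def offsets : Prog :=
  loop 16 3 (store 8 (add (var 16) (lit 1)) (add (load 8 (var 16)) (load 4 (var 16))))

/-- Fills array `9` with the numbers of children. -/
def children : Prog :=
  loop 16 3 (store 9 (load 3 (var 16)) (add (load 9 (load 3 (var 16))) (lit 1)))

/-- Puts the nodes without children into the queue in array `10`, and their number into register
`10`. -/
def enqueue : Prog :=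
  seq (assign 10 (lit 0)) (loop 16 9 (seq (store 10 (var 10) (var 16))
    (assign 10 (ite (load 9 (var 16)) (var 10) (add (var 10) (lit 1))))))

/-- Writes the values of a term, for register `13` running below the number of codes, to the
array `a` from the address `base` on. -/
def tabulate (a : ℕ) (base t : Term) : Prog :=
  loop 13 5 (store a (add base (var 13)) t)

/-- Computes the initial tables. -/
def initTables : Prog := loop 16 9 (tabulate 12 (load 11 (var 16)) initT)

/-- Merges the table of the node at position `16` of the queue into the table of its parent, and
appends the parent to the queue if this was its last child. -/
def mergeStep : Prog :=
  seq (assign 11 (load 10 (var 16))) (seq (assign 12 (load 3 (var 11)))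
    (seq (tabulate 13 (lit 0) mergeT) (seq (tabulate 12 (load 11 (var 12)) (load 13 (var 13)))
      (seq (store 9 (var 12) (sub (load 9 (var 12)) (lit 1)))
        (seq (store 10 (var 10) (var 12))
          (assign 10 (ite (load 9 (var 12)) (var 10) (add (var 10) (lit 1)))))))))

/-- The preparations: multiplication tables, weight matrix, bag positions, and the additional root
as the parent of the root. -/
def prepare : Prog :=
  seq (multiples 6 0 0) (seq weights (seq offsets (seq (store 3 (var 4) (var 3))
    (multiples 11 9 5))))

/-- The computation of all tables. -/
def fill : Prog :=
  seq prepare (seq children (seq enqueue (seq initTables (loop 16 3 mergeStep))))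

theorem multiples_run {a r v : ℕ} (hv : v ≠ 16) {s : State} (h0 : s.mem a 0 = 0) :
    ∀ x ≤ s.reg r, ((multiples a r v).run s).mem a x = x * s.reg v := by
  refine (run_loop (fun j s' => s'.reg v = s.reg v ∧ ∀ x ≤ j, s'.mem a x = x * s.reg v)
    ⟨rfl, fun x hx => ?_⟩ ?_).2
  · obtain rfl : x = 0 := by omega
    simp [h0]
  · rintro j _ s' ⟨h1, h2⟩
    refine ⟨by simp [run, hv, h1], fun x hx => ?_⟩
    simp only [run, State.setMem_mem, eval_add, eval_var, eval_lit, eval_load, State.setReg_reg,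
      State.setReg_mem, if_true, true_and, hv, if_false, h1]
    split_ifs with h
    · rw [h2 j le_rfl, h]; ring
    · exact h2 x (by omega)

theorem tabulate_run {a B : ℕ} {base t : Term} {s : State} (P : ℕ → ℕ → Prop)
    (hbase : ∀ s' : State, (∀ r, r ≠ 13 → s'.reg r = s.reg r) →
      (∀ a', a' ≠ a → s'.mem a' = s.mem a') → base.eval s' = B)
    (hP : ∀ c < s.reg 5, ∀ s' : State, (∀ r, r ≠ 13 → s'.reg r = s.reg r) → s'.reg 13 = c →
      (∀ a', a' ≠ a → s'.mem a' = s.mem a') → P c (t.eval s')) :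
    (∀ r, r ≠ 13 → ((tabulate a base t).run s).reg r = s.reg r) ∧
    (∀ a', a' ≠ a → ((tabulate a base t).run s).mem a' = s.mem a') ∧
    (∀ c < s.reg 5, P c (((tabulate a base t).run s).mem a (B + c))) ∧
    ∀ z, (∀ c < s.reg 5, z ≠ B + c) → ((tabulate a base t).run s).mem a z = s.mem a z := by
  refine run_loop (fun j s' => (∀ r, r ≠ 13 → s'.reg r = s.reg r) ∧
    (∀ a', a' ≠ a → s'.mem a' = s.mem a') ∧ (∀ c < j, P c (s'.mem a (B + c))) ∧
    ∀ z, (∀ c < j, z ≠ B + c) → s'.mem a z = s.mem a z)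
    ⟨fun _ _ => rfl, fun _ _ => rfl, fun c hc => absurd hc (by omega), fun _ _ => rfl⟩ ?_
  rintro j hj s' ⟨h1, h2, h3, h4⟩
  have hb := hbase (s'.setReg 13 j) (fun r hr => by simp [hr, h1 r hr]) (fun a' ha => h2 a' ha)
  have hp := hP j hj (s'.setReg 13 j) (fun r hr => by simp [hr, h1 r hr]) (by simp)
    (fun a' ha => h2 a' ha)
  have hm : ∀ z, ((s'.setReg 13 j).setMem a ((add base (var 13)).eval (s'.setReg 13 j))
      (t.eval (s'.setReg 13 j))).mem a z =
      if z = B + j then t.eval (s'.setReg 13 j) else s'.mem a z := fun z => by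
    simp [State.setMem_mem, hb]
  refine ⟨fun r hr => by simp [run, hr, h1 r hr], fun a' ha => ?_, fun c hc => ?_, fun z hz => ?_⟩
  · funext z; simp [run, State.setMem_mem, ha, h2 a' ha]
  · simp only [run]
    rw [hm]
    split_ifs with he
    · obtain rfl : c = j := by omega
      exact hp
    · exact h3 c (by omega)
  · simp only [run]
    rw [hm, if_neg (hz j (by omega))]
    exact h4 z fun c hc => hz c (by omega)

theorem measure_run (s : State) (B : ℕ) (h7 : s.reg 7 = 0) (hB : ∀ x < s.reg 3, s.mem 4 x ≤ B) :
    (measure.run s).reg 7 ≤ B ∧ (∀ x < s.reg 3, s.mem 4 x ≤ (measure.run s).reg 7) ∧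
    (measure.run s).reg 8 = (measure.run s).reg 7 + 1 ∧
    (measure.run s).reg 6 = (measure.run s).reg 7 + 2 ∧
    (measure.run s).reg 9 = s.reg 3 + 1 := by
  have := run_loop (c := assign 7 (ite (sub (load 4 (var 16)) (var 7)) (load 4 (var 16)) (var 7)))
    (x := 16) (r := 3) (s := s)
    (fun j s' => s'.mem = s.mem ∧ s'.reg 3 = s.reg 3 ∧ s'.reg 7 ≤ B ∧ ∀ x < j, s.mem 4 x ≤ s'.reg 7)
    ⟨rfl, rfl, by omega, fun x hx => absurd hx (by omega)⟩ ?_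
  · obtain ⟨h1, h2, h3, h4⟩ := this
    simp only [measure, run] at h1 h2 h3 h4 ⊢
    simp [h2]
    exact ⟨h3, h4⟩
  · rintro j hj s' ⟨h1, h2, h3, h4⟩
    have hv : ((assign 7 (ite (sub (load 4 (var 16)) (var 7)) (load 4 (var 16)) (var 7))).run
        (s'.setReg 16 j)).reg 7 = max (s'.reg 7) (s.mem 4 j) := by
      simp only [run, State.setReg_reg, Term.eval, h1, State.setReg_mem]
      simp
      split_ifs <;> omega
    refine ⟨by simp [run, h1], by simp [run, h2], ?_, fun x hx => ?_⟩
    · rw [hv]; exact max_le h3 (hB j hj)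
    · rw [hv]
      rcases Nat.lt_succ_iff_lt_or_eq.1 hx with h | rfl
      · exact (h4 x h).trans (le_max_left _ _)
      · exact le_max_right _ _

theorem power_run (s : State) : (power.run s).reg 17 = 2 ^ (s.reg 7 * s.reg 6) := by
  have inner : ∀ s : State, ((loop 18 6 (assign 17 (add (var 17) (var 17)))).run s).reg 17 =
      s.reg 17 * 2 ^ s.reg 6 := fun s =>
    run_loop (fun j s' => s'.reg 17 = s.reg 17 * 2 ^ j) (by simp) fun j _ s' h => by
      simp only [run, State.setReg_reg, if_true, eval_add, eval_var]
      simp [h, pow_succ]; ring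
  have h6 : ∀ s : State, ((loop 18 6 (assign 17 (add (var 17) (var 17)))).run s).reg 6 = s.reg 6 :=
    fun s => run_reg (L := [6]) _ rfl (by simp) s
  have := run_loop (x := 16) (r := 7) (c := loop 18 6 (assign 17 (add (var 17) (var 17))))
    (s := s.setReg 17 1) (fun j s' => s'.reg 6 = s.reg 6 ∧ s'.reg 17 = 2 ^ (j * s.reg 6))
    (by simp) fun j _ s' h => by
      rw [h6, inner]
      simp [h.1, h.2, Nat.succ_mul, pow_add]
  exact this.2

end Prog

open Prog Term

theorem index_inj {n : ℕ} {u w u' w' : Fin n} (h : (u' : ℕ) * n + w' = u * n + w) :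
    (u', w') = (u, w) := by
  have hn : 0 < n := u.pos
  have h1 := congrArg (· / n) h
  have h2 := congrArg (· % n) h
  simp only [Nat.add_comm (_ * n), Nat.add_mul_div_right _ _ hn, Nat.add_mul_mod_self_right,
    Nat.div_eq_of_lt, Nat.mod_eq_of_lt, Fin.is_lt, Nat.zero_add] at h1 h2
  exact Prod.ext (Fin.ext h1) (Fin.ext h2)

section

variable {n N : ℕ} {I : Problem (Fin n)} {D : TreeDecomposition I.arcs (Fin N)}
  (E : Presentation I D) {s : State}

theorem weights_run (h1 : s.reg 1 = E.arcList.length)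
    (hm : ∀ a < 3, s.mem a = E.init.mem a) (h6 : ∀ u ≤ n, s.mem 6 u = u * n)
    (h7 : ∀ z, s.mem 7 z = 0) (u w : Fin n) :
    (weights.run s).mem 7 (u * n + w) = if (u, w) ∈ I.arcs then I.weight (u, w) else 0 := by
  have := run_loop (x := 16) (r := 1) (s := s)
    (c := store 7 (add (load 6 (load 0 (var 16))) (load 1 (var 16))) (load 2 (var 16)))
    (fun j s' => (∀ a, a ≠ 7 → s'.mem a = s.mem a) ∧ ∀ u w : Fin n,
      s'.mem 7 (u * n + w) = if (u, w) ∈ E.arcList.take j then I.weight (u, w) else 0)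
    ⟨fun _ _ => rfl, by simp [h7]⟩ ?_
  · have h := this.2 u w
    rw [h1, List.take_length] at h
    simp only [E.mem_arcList] at h
    exact h
  · rintro j hj s' ⟨h3, h4⟩
    rw [h1] at hj
    obtain ⟨e0, e1, e2⟩ := E.init_arc hj
    refine ⟨fun a ha => ?_, fun u w => ?_⟩
    · funext z; simp [run, State.setMem_mem, ha, h3 a ha]
    · have ea : (add (load 6 (load 0 (var 16))) (load 1 (var 16))).eval (s'.setReg 16 j) =
          E.arcList[j].1 * n + E.arcList[j].2 := by
        simp [h3, hm, e0, e1, h6 _ E.arcList[j].1.2.le]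
      have ev : (load 2 (var 16)).eval (s'.setReg 16 j) = I.weight E.arcList[j] := by
        simp [h3, hm, e2]
      simp only [run, ea, ev, State.setMem_mem, State.setReg_mem, true_and, h4]
      rw [List.take_succ_eq_append_getElem hj]
      simp only [List.mem_append, List.mem_singleton]
      by_cases he : (u, w) = E.arcList[j]
      · simp [← he]
      · rw [if_neg]
        · simp [he]
        · exact fun h => he (index_inj h)

theorem offsets_run (h3 : s.reg 3 = N) (h4 : s.mem 4 = E.init.mem 4) (h8 : s.mem 8 0 = 0) :
    ∀ x ≤ N, (offsets.run s).mem 8 x = E.offset x := by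
  have := run_loop (x := 16) (r := 3) (s := s)
    (c := store 8 (add (var 16) (lit 1)) (add (load 8 (var 16)) (load 4 (var 16))))
    (fun j s' => s'.mem 4 = s.mem 4 ∧ ∀ x ≤ j, s'.mem 8 x = E.offset x)
    ⟨rfl, fun x hx => ?_⟩ ?_
  · rw [h3] at this; exact this.2
  · obtain rfl : x = 0 := by omega
    simp [h8, Presentation.offset]
  · rintro j _ s' ⟨h1, h2⟩
    refine ⟨by funext z; simp [run, State.setMem_mem, h1], fun x hx => ?_⟩
    simp only [run, State.setMem_mem, eval_add, eval_var, eval_lit, eval_load, State.setReg_reg,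
      State.setReg_mem, if_true, true_and, h1, h2 j le_rfl, h4, E.init_size]
    split_ifs with h
    · rw [h, Presentation.offset, Presentation.offset, Finset.sum_range_succ]
    · exact h2 x (by omega)

theorem children_run (h3 : s.reg 3 = N) (hp : ∀ x < N, s.mem 3 x = E.par x)
    (h9 : ∀ x, s.mem 9 x = 0) (x : ℕ) :
    (children.run s).mem 9 x = ({y ∈ Finset.range N | E.par y = x} : Finset ℕ).card := by
  have := run_loop (x := 16) (r := 3) (s := s)
    (c := store 9 (load 3 (var 16)) (add (load 9 (load 3 (var 16))) (lit 1)))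
    (fun j s' => s'.mem 3 = s.mem 3 ∧ ∀ x, s'.mem 9 x =
      ({y ∈ Finset.range j | E.par y = x} : Finset ℕ).card)
    ⟨rfl, by simp [h9]⟩ ?_
  · rw [h3] at this; exact this.2 x
  · rintro j hj s' ⟨h1, h2⟩
    rw [h3] at hj
    refine ⟨by funext z; simp [run, State.setMem_mem, h1], fun x => ?_⟩
    simp only [run, State.setMem_mem, eval_add, eval_var, eval_lit, eval_load, State.setReg_reg,
      State.setReg_mem, if_true, true_and, h1, h2, hp j hj]
    rw [Finset.range_add_one, Finset.filter_insert]
    by_cases h : x = E.par j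
    · rw [if_pos h, if_pos h.symm, Finset.card_insert_of_notMem (by simp), h]
    · rw [if_neg h, if_neg (Ne.symm h)]

theorem enqueue_run (h9 : s.reg 9 = N + 1)
    (hc : ∀ x, s.mem 9 x = ({y ∈ Finset.range N | E.par y = x} : Finset ℕ).card) :
    Peeling N E.par 0 ((enqueue.run s).reg 10) ((enqueue.run s).mem 10)
      ((enqueue.run s).mem 9) := by
  have hm : (enqueue.run s).mem 9 = s.mem 9 := run_mem _ rfl s
  have := run_loop (x := 16) (r := 9) (s := s.setReg 10 0)
    (c := seq (store 10 (var 10) (var 16))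
      (assign 10 (ite (load 9 (var 16)) (var 10) (add (var 10) (lit 1)))))
    (fun j s' => s'.mem 9 = s.mem 9 ∧
      (∀ x < j, (∃ l < s'.reg 10, s'.mem 10 l = x) ↔ s.mem 9 x = 0) ∧
      (∀ l < s'.reg 10, ∀ l' < s'.reg 10, s'.mem 10 l = s'.mem 10 l' → l = l') ∧
      ∀ l < s'.reg 10, s'.mem 10 l < j) ⟨rfl, by simp, by simp, by simp⟩ ?_
  · have h9' : (s.setReg 10 0).reg 9 = N + 1 := by simp [h9]
    rw [h9'] at this
    obtain ⟨-, h2, h3, h4⟩ := this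
    refine ⟨fun x _ => ?_, fun x hx => ?_, h3, fun l hl => Nat.lt_succ_iff.1 (h4 l hl), by omega⟩
    · rw [hm, hc]; congr 1; ext; simp
    · rw [hm]; exact h2 x (by omega)
  · rintro j - s' ⟨h1, h2, h3, h4⟩
    set q := s'.reg 10 with hq
    have er : ((seq (store 10 (var 10) (var 16)) (assign 10 (ite (load 9 (var 16)) (var 10)
        (add (var 10) (lit 1))))).run (s'.setReg 16 j)).reg 10 =
        if s.mem 9 j = 0 then q + 1 else q := by
      simp [run, Term.eval, State.setMem_mem, h1, ← hq]
    have em : ∀ l, ((seq (store 10 (var 10) (var 16)) (assign 10 (ite (load 9 (var 16)) (var 10)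
        (add (var 10) (lit 1))))).run (s'.setReg 16 j)).mem 10 l =
        if l = q then j else s'.mem 10 l := fun l => by
      simp [run, State.setMem_mem, ← hq]
    refine ⟨?_, fun x hx => ?_, ?_, ?_⟩
    · funext z; simp [run, State.setMem_mem, h1]
    · simp only [er, em]
      rcases Nat.lt_succ_iff_lt_or_eq.1 hx with hx' | rfl
      · rw [← h2 x hx']
        constructor
        · rintro ⟨l, hl, he⟩
          by_cases hlq : l = q
          · rw [if_pos hlq] at he; omega
          · rw [if_neg hlq] at he
            exact ⟨l, by split_ifs at hl <;> omega, he⟩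
        · rintro ⟨l, hl, he⟩
          exact ⟨l, by split_ifs <;> omega, by rw [if_neg hl.ne, he]⟩
      · split_ifs with h0
        · exact ⟨fun _ => h0, fun _ => ⟨q, by omega, by simp⟩⟩
        · refine ⟨fun ⟨l, hl, he⟩ => ?_, fun h => absurd h h0⟩
          rw [if_neg hl.ne] at he
          have := h4 l hl
          omega
    · intro l hl l' hl' he
      rw [er] at hl hl'
      rw [em, em] at he
      by_cases hlq : l = q <;> by_cases hlq' : l' = q
      · omega
      · rw [if_pos hlq, if_neg hlq'] at he
        have := h4 l' (by split_ifs at hl' <;> omega)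
        omega
      · rw [if_neg hlq, if_pos hlq'] at he
        have := h4 l (by split_ifs at hl <;> omega)
        omega
      · rw [if_neg hlq, if_neg hlq'] at he
        exact h3 l (by split_ifs at hl <;> omega) l' (by split_ifs at hl' <;> omega) he
    · intro l hl
      rw [er] at hl
      rw [em]
      split_ifs with hlq
      · omega
      · have := h4 l (by split_ifs at hl <;> omega)
        omega

end

end DAGPart

namespace DAGPart

/-! ### The tables during the run of the program -/

open Prog Term PointerDecomposition

variable {n N : ℕ} {I : Problem (Fin n)} {D : TreeDecomposition I.arcs (Fin N)}
  {E : Presentation I D} {b : ℕ} {s : State}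

theorem Presentation.lt_of_mem_bagAt {x : ℕ} {v : Fin n} (h : v ∈ E.bagAt x) : x < N := by
  by_contra hx
  simp [Presentation.bagAt, hx] at h

theorem prepared_prepare (hm : s.mem = E.init.mem) (h0 : s.reg 0 = n)
    (h1 : s.reg 1 = E.arcList.length) (h2 : s.reg 2 = I.k) (h3 : s.reg 3 = N)
    (h4 : s.reg 4 = D.root) (h5 : s.reg 5 = 2 ^ (b * (b + 2))) (h6 : s.reg 6 = b + 2)
    (h7 : s.reg 7 = b) (h8 : s.reg 8 = b + 1) (h9 : s.reg 9 = N + 1)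
    (hb : ∀ x, (E.bagAt x).length ≤ b) : Prepared E b (prepare.run s) := by
  have hreg : ∀ r ∈ [0, 1, 2, 3, 4, 5, 6, 7, 8, 9], (prepare.run s).reg r = s.reg r :=
    fun r hr => run_reg prepare rfl hr s
  have hmem : ∀ a, prepare.stores a = false → (prepare.run s).mem a = E.init.mem a := fun a ha => by
    rw [run_mem prepare ha, hm]
  set s1 := (multiples 6 0 0).run s with hs1
  set s2 := weights.run s1 with hs2
  set s3 := offsets.run s2 with hs3
  set s4 := (store 3 (var 4) (var 3)).run s3 with hs4
  set s5 := (multiples 11 9 5).run s4 with hs5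
  have he : prepare.run s = s5 := rfl
  have r1 : ∀ r ∈ [0, 1, 3, 4, 5, 9], s1.reg r = s.reg r := fun r hr => run_reg _ rfl hr s
  have r2 : ∀ r ∈ [1, 3, 4, 5, 9], s2.reg r = s1.reg r := fun r hr => run_reg _ rfl hr s1
  have r3 : ∀ r ∈ [3, 4, 5, 9], s3.reg r = s2.reg r := fun r hr => run_reg _ rfl hr s2
  have m1 : ∀ a, a ≠ 6 → s1.mem a = E.init.mem a := fun a ha => by
    rw [hs1, run_mem _ (by simp [multiples, stores, ha]), hm]
  have m2 : ∀ a, a ≠ 7 → s2.mem a = s1.mem a := fun a ha => by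
    rw [hs2, run_mem _ (by simp [weights, stores, ha])]
  have m3 : ∀ a, a ≠ 8 → s3.mem a = s2.mem a := fun a ha => by
    rw [hs3, run_mem _ (by simp [offsets, stores, ha])]
  have m4 : ∀ a, a ≠ 3 → s4.mem a = s3.mem a := fun a ha => by
    rw [hs4, run_mem _ (by simp [stores, ha])]
  have m5 : ∀ a, a ≠ 11 → s5.mem a = s4.mem a := fun a ha => by
    rw [hs5, run_mem _ (by simp [multiples, stores, ha])]
  have e6 : ∀ u ≤ n, s1.mem 6 u = u * n := by
    have := multiples_run (a := 6) (r := 0) (v := 0) (by decide) (s := s) (by rw [hm]; rfl)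
    rwa [h0] at this
  have e7 := weights_run E (s := s1) (by rw [r1 1 (by simp), h1])
    (fun a ha => m1 a (by omega)) e6 (fun z => by rw [m1 7 (by decide)]; rfl)
  have e8 := offsets_run E (s := s2) (by rw [r2 3 (by simp), r1 3 (by simp), h3])
    (by rw [m2 4 (by decide), m1 4 (by decide)])
    (by rw [m2 8 (by decide), m1 8 (by decide)]; rfl)
  refine ⟨hb, ?_, ?_, ?_, ?_, ?_, ?_, ?_, fun x => ?_, fun x v hv => ?_, fun x hx => ?_,
    fun u w => ?_, fun x hx => ?_⟩
  · rw [hreg 2 (by simp), h2]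
  · rw [hreg 3 (by simp), h3]
  · rw [hreg 5 (by simp), h5]
  · rw [hreg 6 (by simp), h6]
  · rw [hreg 7 (by simp), h7]
  · rw [hreg 8 (by simp), h8]
  · rw [hreg 9 (by simp), h9]
  · rw [hmem 4 rfl, E.init_size]
  · have hl := List.idxOf_lt_length_iff.2 hv
    rw [hmem 5 rfl, he, m5 8 (by decide), m4 8 (by decide), e8 x (E.lt_of_mem_bagAt hv).le,
      E.init_elem hl]
    simp
  · rw [he, m5 3 (by decide)]
    have : s4.mem 3 x = if x = D.root then N else E.init.mem 3 x := by
      simp [hs4, run, State.setMem_mem, r3, r2, r1, h3, h4, m3, m2, m1]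
    rw [this, E.par_val ⟨x, hx⟩, ← E.init_parent ⟨x, hx⟩]
    simp [Fin.ext_iff]
  · rw [he, m5 7 (by decide), m4 7 (by decide), m3 7 (by decide), m5 6 (by decide),
      m4 6 (by decide), m3 6 (by decide), m2 6 (by decide), e6 u u.2.le, e7]
  · have := multiples_run (a := 11) (r := 9) (v := 5) (by decide) (s := s4)
      (by rw [m4 11 (by decide), m3 11 (by decide), m2 11 (by decide), m1 11 (by decide)]; rfl)
    have q5 : s4.reg 5 = 2 ^ (b * (b + 2)) := by
      rw [hs4]; simp [run, r3, r2, r1, h5]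
    have q9 : s4.reg 9 = N + 1 := by
      rw [hs4]; simp [run, r3, r2, r1, h9]
    rw [q5, q9] at this
    exact this x (by omega)

theorem row_add_ne {M x p c d : ℕ} (hx : x ≠ p) (hc : c < M) (hd : d < M) :
    x * M + c ≠ p * M + d := by
  intro h
  have h1 := congrArg (· / M) h
  have hM : 0 < M := by omega
  simp only [Nat.add_comm (_ * M), Nat.add_mul_div_right _ _ hM, Nat.div_eq_of_lt hc,
    Nat.div_eq_of_lt hd, Nat.zero_add] at h1
  exact hx h1

theorem initTables_run (h : Prepared E b s) :
    ∀ x ≤ N, ∀ c < 2 ^ (b * (b + 2)),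
      Represents I.k ((initTables.run s).mem 12 (x * 2 ^ (b * (b + 2)) + c))
        (Feasible I.arcs I.weight (E.bagAt x).toFinset (E.bagAt x).toFinset
          (codeState b (E.bagAt x) c)) := by
  have := run_loop (x := 16) (r := 9) (s := s) (c := tabulate 12 (load 11 (var 16)) initT)
    (fun j s' => Prepared E b s' ∧ ∀ x < j, ∀ c < 2 ^ (b * (b + 2)),
      Represents I.k (s'.mem 12 (x * 2 ^ (b * (b + 2)) + c))
        (Feasible I.arcs I.weight (E.bagAt x).toFinset (E.bagAt x).toFinset
          (codeState b (E.bagAt x) c))) ⟨h, fun x hx => absurd hx (by omega)⟩ ?_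
  · rw [h.reg9] at this
    exact fun x hx => this.2 x (by omega)
  · rintro j hj s' ⟨hp, ht⟩
    rw [h.reg9] at hj
    have hp' : Prepared E b (s'.setReg 16 j) := hp.congr
      (fun r h1 h2 => by simp [show r ≠ 16 by omega]) (fun _ _ _ _ => rfl)
    obtain ⟨t1, t2, t3, t4⟩ := tabulate_run (a := 12) (B := j * 2 ^ (b * (b + 2)))
      (base := load 11 (var 16)) (t := initT) (s := s'.setReg 16 j)
      (fun c v => Represents I.k v (Feasible I.arcs I.weight (E.bagAt j).toFinset
        (E.bagAt j).toFinset (codeState b (E.bagAt j) c)))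
      (fun s'' e1 e2 => by
        rw [eval_load, e2 11 (by decide), eval_var, e1 16 (by decide)]
        simpa using hp.row j (by omega))
      (fun c hc s'' e1 e2 e3 => (hp'.congr (fun r _ _ => e1 r (by omega))
        fun a ha _ _ => e3 a (by omega)).represents_initT (by simp [e1]) e2)
    rw [hp'.reg5] at t3 t4
    refine ⟨hp'.congr (fun r _ _ => t1 r (by omega)) fun a ha _ _ => t2 a (by omega),
      fun x hx c hc => ?_⟩
    rcases Nat.lt_succ_iff_lt_or_eq.1 hx with hx' | rfl
    · rw [t4 _ fun d hd => row_add_ne hx'.ne hc hd]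
      exact ht x hx' c hc
    · exact t3 c hc

/-- The tables after `i` nodes have been merged into their parents: for every other node, the table
describes the piece that has been merged into it. -/
structure Progress (E : Presentation I D) (b i : ℕ) (s : State) : Prop where
  prepared : Prepared E b s
  peeling : Peeling N E.par i (s.reg 10) (s.mem 10) (s.mem 9)
  lt : ∀ j < i, s.mem 10 j < N
  table : ∀ x ≤ N, (∀ j < i, s.mem 10 j ≠ x) → ∀ c < 2 ^ (b * (b + 2)),
    Represents I.k (s.mem 12 (x * 2 ^ (b * (b + 2)) + c))
      (Feasible I.arcs I.weight
        (seen N E.par (fun x => (E.bagAt x).toFinset) {y | ∃ j < i, s.mem 10 j = y} x)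
        (E.bagAt x).toFinset (codeState b (E.bagAt x) c))

theorem Progress.succ {i : ℕ} (h : Progress E b i s) (hi : i < N) :
    Progress E b (i + 1) (mergeStep.run (s.setReg 16 i)) := by
  obtain ⟨T⟩ := E.pointerDecomposition
  obtain ⟨hiq, hyN⟩ := h.peeling.next T.par_le T.depth_par hi
  set q := s.reg 10 with hq
  set Q := s.mem 10 with hQ
  set y := Q i with hy
  set p := E.par y with hp
  have hpN : p ≤ N := T.par_le y hyN
  set M := 2 ^ (b * (b + 2)) with hM
  have hy' : ∀ j < i, Q j ≠ y := fun j hj he => by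
    have := h.peeling.inj j (by omega) i hiq he; omega
  -- the states after the single steps
  set s1 := ((s.setReg 16 i).setReg 11 y).setReg 12 p with hs1
  have P1 : Prepared E b s1 := h.prepared.congr (fun r _ _ => by
    simp [hs1, show r ≠ 16 by omega, show r ≠ 12 by omega, show r ≠ 11 by omega])
    fun _ _ _ _ => rfl
  set s2 := (tabulate 13 (lit 0) mergeT).run s1 with hs2
  set s3 := (tabulate 12 (load 11 (var 12)) (load 13 (var 13))).run s2 with hs3
  set s4 := s3.setMem 9 p (s3.mem 9 p - 1) with hs4
  set s5 := s4.setMem 10 q p with hs5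
  set s6 := s5.setReg 10 (if s5.mem 9 p = 0 then q + 1 else q) with hs6
  obtain ⟨t1, t2, t3, -⟩ := tabulate_run (a := 13) (B := 0) (base := lit 0) (t := mergeT) (s := s1)
    (fun c v => ∀ w ≤ I.k, v ≤ w ↔ ∃ c₁ < M, ∃ c₂ < M,
      Mergeable (E.bagAt p).toFinset (E.bagAt y).toFinset
        (codeState b (E.bagAt p) c₁) (codeState b (E.bagAt y) c₂) (codeState b (E.bagAt p) c) ∧
      s.mem 12 (p * M + c₁) + s.mem 12 (y * M + c₂) +
        mergeCost I.arcs I.weight (E.bagAt p).toFinset (E.bagAt y).toFinset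
          (codeState b (E.bagAt y) c₂) ≤ w)
    (fun _ _ _ => rfl) (fun c hc s' e1 e2 e3 w hw => by
      have := (P1.congr (s' := s') (fun r _ _ => e1 r (by omega))
        fun a ha _ _ => e3 a (by omega)).mergeT_le_iff (y := y) (p := p) (c := c)
        (by simp [e1, hs1]) (by simp [e1, hs1]) e2 hyN.le hpN hw
      rw [e3 12 (by decide)] at this
      exact this)
  obtain ⟨u1, u2, u3, u4⟩ := tabulate_run (a := 12) (B := p * M) (base := load 11 (var 12))
    (t := load 13 (var 13)) (s := s2) (fun c v => v = s2.mem 13 (0 + c))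
    (fun s' e1 e2 => by
      rw [eval_load, e2 11 (by decide), eval_var, e1 12 (by decide), t1 12 (by decide),
        t2 11 (by decide)]
      simpa [hs1] using h.prepared.row p hpN)
    (fun c hc s' e1 e2 e3 => by simp [e2, e3])
  have r5 : s2.reg 5 = M := by rw [t1 5 (by decide), P1.reg5]
  rw [P1.reg5] at t3
  rw [r5] at u3 u4
  have g12 : s3.reg 12 = p := by rw [u1 12 (by decide), t1 12 (by decide)]; simp [hs1]
  have g10 : s3.reg 10 = q := by rw [u1 10 (by decide), t1 10 (by decide)]; simp [hs1, hq]
  have hm3 : ∀ a, a ≠ 12 → a ≠ 13 → s3.mem a = s.mem a := fun a h1 h2 => by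
    rw [u2 a h1, t2 a h2]; simp [hs1]
  have hrun : mergeStep.run (s.setReg 16 i) = s6 := by
    have e1 : (assign 12 (load 3 (var 11))).run ((assign 11 (load 10 (var 16))).run
        (s.setReg 16 i)) = s1 := by
      have : s.mem 3 y = p := h.prepared.parent y hyN
      simp [run, ← hQ, ← hy, this, hs1]
    have e2 : mergeStep.run (s.setReg 16 i) = (seq
        (store 9 (var 12) (sub (load 9 (var 12)) (lit 1))) (seq (store 10 (var 10) (var 12))
          (assign 10 (ite (load 9 (var 12)) (var 10) (add (var 10) (lit 1)))))).run s3 := by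
      rw [hs3, hs2, ← e1]; rfl
    rw [e2]
    simp only [run, eval_sub, eval_load, eval_var, eval_lit, g12, State.setMem_reg, g10]
    rw [← hs4, ← hs5, hs6]
    congr 1
    have h5 : s5.reg 12 = p ∧ s5.reg 10 = q := ⟨g12, g10⟩
    simp [Term.eval, h5]
  have m9 : s6.mem 9 = Function.update (s.mem 9) p (s.mem 9 p - 1) := by
    funext z
    simp [hs6, hs5, hs4, State.setMem_mem, hm3, Function.update_apply]
  have m10 : s6.mem 10 = Function.update Q q p := by
    funext z
    simp [hs6, hs5, hs4, State.setMem_mem, hm3, Function.update_apply, hQ]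
  have m12 : s6.mem 12 = s3.mem 12 := by
    funext z; simp [hs6, hs5, hs4, State.setMem_mem]
  have g6 : s6.reg 10 = if s.mem 9 p - 1 = 0 then q + 1 else q := by
    simp [hs6, hs5, hs4, State.setMem_mem, hm3]
  have hPr : {x | ∃ j < i + 1, s6.mem 10 j = x} = insert y {x | ∃ j < i, Q j = x} := by
    ext x
    have hQ' : ∀ j < q, Function.update Q q p j = Q j := fun j hj => by simp [hj.ne]
    simp only [Set.mem_ofPred_eq, Set.mem_insert_iff, m10]
    constructor
    · rintro ⟨j, hj, he⟩
      rw [hQ' j (by omega)] at he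
      rcases Nat.lt_succ_iff_lt_or_eq.1 hj with hj' | rfl
      · exact Or.inr ⟨j, hj', he⟩
      · exact Or.inl he.symm
    · rintro (rfl | ⟨j, hj, he⟩)
      · exact ⟨i, by omega, hQ' i hiq⟩
      · exact ⟨j, by omega, by rw [hQ' j (by omega), he]⟩
  have hchild : ∀ z, Child N E.par z y → z ∈ {x | ∃ j < i, Q j = x} := fun z hz =>
    h.peeling.child_processed hyN.le ⟨i, hiq, rfl⟩ hz
  have hyP : y ∉ {x | ∃ j < i, Q j = x} := fun hx => by
    obtain ⟨j, hj, he⟩ := hx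
    exact hy' j hj he
  rw [hrun]
  refine ⟨P1.congr (fun r h1 h2 => ?_) fun a h1 h2 h3 => ?_, ?_, fun j hj => ?_,
    fun x hx hxj c hc => ?_⟩
  · have : s6.reg r = s3.reg r := by simp [hs6, hs5, hs4, show r ≠ 10 by omega]
    rw [this, u1 r (by omega), t1 r (by omega)]
  · funext z
    have : s6.mem a z = s3.mem a z := by simp [hs6, hs5, hs4, State.setMem_mem, h2, h3]
    rw [this, hm3 a (by omega) (by omega)]
    simp [hs1]
  · rw [g6, m9, m10]
    exact h.peeling.succ T.par_le hiq hyN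
  · have hmem : s6.mem 10 j ∈ insert y {x | ∃ j < i, Q j = x} := hPr ▸ ⟨j, hj, rfl⟩
    rcases hmem with he | ⟨l, hl, he⟩
    · rw [he]; exact hyN
    · rw [← he]; exact h.lt l hl
  · have hx' : ∀ z ∈ insert y {x | ∃ j < i, Q j = x}, z ≠ x := by
      rw [← hPr]
      rintro z ⟨j, hj, rfl⟩
      exact hxj j hj
    have hxQ : ∀ j < i, Q j ≠ x := fun j hj => hx' _ (Or.inr ⟨j, hj, rfl⟩)
    rw [hPr, m12]
    by_cases hxp : x = p
    · rw [hxp] at hxQ ⊢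
      rw [u3 c hc, hp, seen_insert_par hyN hchild]
      exact (T.separated hyN hyP hchild).represents
        (h.prepared.bag_le _) (h.prepared.bag_le _) (h.table p hpN hxQ) (h.table y hyN.le hy') c
        (t3 c hc)
    · rw [u4 _ fun d hd => row_add_ne hxp hc hd, t2 12 (by decide), seen_insert_of_ne hxp]
      simpa [hs1] using h.table x hx hxQ c hc

theorem progress_fill (h : Prepared E b (prepare.run s)) (h9 : ∀ x, (prepare.run s).mem 9 x = 0) :
    Progress E b N (fill.run s) := by
  set s1 := prepare.run s with hs1
  set s2 := children.run s1 with hs2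
  set s3 := enqueue.run s2 with hs3
  set s4 := initTables.run s3 with hs4
  have m2 : ∀ a, a ≠ 9 → s2.mem a = s1.mem a := fun a ha => by
    rw [hs2, run_mem _ (by simp [children, stores, ha])]
  have m3 : ∀ a, a ≠ 10 → s3.mem a = s2.mem a := fun a ha => by
    rw [hs3, run_mem _ (by simp [enqueue, stores, ha])]
  have m4 : ∀ a, a ≠ 12 → s4.mem a = s3.mem a := fun a ha => by
    rw [hs4, run_mem _ (by simp [initTables, tabulate, stores, ha])]
  have L : ∀ r, 2 ≤ r → r < 10 → r ∈ [2, 3, 4, 5, 6, 7, 8, 9] := fun r h1 h2 => by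
    simp; omega
  have p2 : Prepared E b s2 := h.congr (fun r h1 h2 => run_reg _ rfl (L r h1 h2) _)
    fun a _ h1 _ => m2 a h1
  have p3 : Prepared E b s3 := p2.congr (fun r h1 h2 => run_reg _ rfl (L r h1 h2) _)
    fun a _ _ h1 => m3 a h1
  have p4 : Prepared E b s4 := p3.congr (fun r h1 h2 => run_reg _ rfl (L r h1 h2) _)
    fun a h1 _ _ => m4 a (by omega)
  have hpeel := enqueue_run E p2.reg9 (children_run E h.reg3 h.parent h9)
  have g4 : s4.reg 10 = s3.reg 10 :=
    run_reg (L := [5, 9, 10]) initTables rfl (by simp) s3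
  have := run_loop (x := 16) (r := 3) (s := s4) (c := mergeStep) (fun j s' => Progress E b j s')
    ⟨p4, by rw [g4, m4 10 (by decide), m4 9 (by decide)]; exact hpeel,
      fun _ hj => absurd hj (by omega), fun x hx _ c hc => by
      have := initTables_run p3 x hx c hc
      simpa [seen_empty] using this⟩
    (fun j hj s' h' => h'.succ (by rw [p4.reg3] at hj; exact hj))
  rw [p4.reg3] at this
  exact this

/-- When all nodes have been merged, the table of the additional root answers the question. -/
theorem Progress.eval_answerT (h : Progress E b N s) [Decidable I.IsYes] :
    answerT.eval s = if I.IsYes then 1 else 0 := by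
  classical
  obtain ⟨T⟩ := E.pointerDecomposition
  set Pr := {y | ∃ j < N, s.mem 10 j = y} with hPr
  -- every node other than the additional root has been processed
  have hall : ∀ y < N, y ∈ Pr := by
    have himg : (Finset.range N).image (s.mem 10) = Finset.range N := by
      refine Finset.eq_of_subset_of_card_le (fun y hy => ?_) ?_
      · obtain ⟨j, hj, rfl⟩ := Finset.mem_image.1 hy
        exact Finset.mem_range.2 (h.lt j (Finset.mem_range.1 hj))
      · rw [Finset.card_image_of_injOn]
        intro j hj j' hj' he
        have := h.peeling.le_length
        simp only [Finset.coe_range, Set.mem_Iio] at hj hj'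
        exact h.peeling.inj j (by omega) j' (by omega) he
    intro y hy
    obtain ⟨j, hj, he⟩ := Finset.mem_image.1 (himg.symm ▸ Finset.mem_range.2 hy :
      y ∈ (Finset.range N).image (s.mem 10))
    exact ⟨j, Finset.mem_range.1 hj, he⟩
  have key : ∀ c < 2 ^ (b * (b + 2)),
      s.mem 12 (N * 2 ^ (b * (b + 2)) + c) ≤ I.k ↔ I.IsYes := fun c hc => by
    have h1 := h.table N le_rfl (fun j hj => (h.lt j hj).ne) c hc I.k le_rfl
    rw [T.seen_root hall] at h1
    rw [h1, ← I.feasible_univ_iff (codeState b (E.bagAt N) c)]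
    have : (E.bagAt N).toFinset = ∅ := T.bag_root
    rw [this]
  have hmin : (minT 13 (add (var 2) (lit 1)) (entryT 3 13)).eval s ≤ I.k ↔ I.IsYes := by
    have hk : ¬ I.k + 1 ≤ I.k := by omega
    rw [eval_minT_le (by decide) rfl]
    simp only [entryT, eval_add, eval_var, eval_lit, eval_load, State.setReg_reg,
      State.setReg_mem, Nat.reduceEqDiff, if_false, if_true, h.prepared.reg2, h.prepared.reg3,
      h.prepared.reg5, h.prepared.row N le_rfl, hk, false_or]
    exact ⟨fun ⟨c, hc, h'⟩ => (key c hc).1 h', fun h' =>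
      ⟨0, by positivity, (key 0 (by positivity)).2 h'⟩⟩
  rw [answerT, eval_notT]
  simp only [holds_ltT, eval_var, h.prepared.reg2, ← not_le, hmin]
  split_ifs <;> rfl

end DAGPart

namespace DAGPart

/-! ### Correctness and running time -/

open Prog Term

/-- The program. -/
def solve : Cmd :=
  .seq (measure.compile 64) (.seq (power.compile 64) (.seq (.assign 5 (.reg 17))
    (.seq (fill.compile 64) ((assign 0 answerT).compile 64))))

/-- The state after the number `b` and the number of codes have been computed. -/
def measured (s : State) : State :=
  (power.run (measure.run s)).setReg 5 ((power.run (measure.run s)).reg 17)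

theorem exec_solve (s : State) : ∃ T σ, Exec solve s T σ ∧
    T ≤ measure.bound s.reg + (power.bound (measure.run s).reg + (2 + (fill.bound (measured s).reg +
      (assign 0 answerT).bound (fill.run (measured s)).reg))) ∧
    σ.reg 0 = answerT.eval (fill.run (measured s)) := by
  obtain ⟨T₁, σ₁, x₁, t₁, m₁, r₁, -⟩ := measure.exec_compile (L := [3, 5]) (by simp) rfl s.reg 64
    le_rfl s s rfl (fun _ _ => rfl) (fun _ _ => rfl)
  obtain ⟨T₂, σ₂, x₂, t₂, m₂, r₂, -⟩ := power.exec_compile (L := [5, 6, 7]) (by simp) rfl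
    (measure.run s).reg 64 le_rfl (measure.run s) σ₁ m₁ r₁ (fun _ _ => rfl)
  obtain ⟨T₃, σ₃, x₃, t₃, m₃, r₃, -⟩ := fill.exec_compile (L := [0, 1, 3, 5, 6, 7, 9]) (by simp)
    rfl (measured s).reg 64 le_rfl (measured s) (σ₂.setReg 5 (σ₂.reg 17)) m₂
    (fun r hr => by by_cases h : r = 5 <;> simp [measured, h, r₂ r hr, r₂ 17 (by decide)])
    (fun _ _ => rfl)
  obtain ⟨T₄, σ₄, x₄, t₄, -, r₄, -⟩ := (assign 0 answerT).exec_compile (L := [5]) (by simp) rfl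
    (fill.run (measured s)).reg 64 le_rfl (fill.run (measured s)) σ₃ m₃ r₃ (fun _ _ => rfl)
  refine ⟨_, σ₄, .seq x₁ (.seq x₂ (.seq (.assign _ _ _) (.seq x₃ x₄))), ?_, ?_⟩
  · simp only [Expr.cost]; omega
  · rw [r₄ 0 (by decide)]
    simp only [run, State.setReg_reg, if_true]

theorem two_pow_add_two_le {b B : ℕ} (h : b ≤ B) : 2 ^ (b * (b + 2)) + 2 ≤ 2 ^ (B + 2) ^ 2 := by
  have h1 : b * (b + 2) + 2 ≤ (B + 2) ^ 2 :=
    (by nlinarith : b * (b + 2) + 2 ≤ (b + 2) ^ 2).trans (Nat.pow_le_pow_left (by omega) 2)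
  have h2 := Nat.pow_le_pow_right (n := 2) (by decide) h1
  have h3 := Nat.one_le_two_pow (n := b * (b + 2))
  rw [pow_add] at h2
  omega

/-- The program is correct, and its running time is linear in the size of the tree decomposition
with a factor that is polynomial in the number of codes. -/
theorem solve_decides : ∃ K e : ℕ, ∀ {n N : ℕ} {I : Problem (Fin n)}
    {D : TreeDecomposition I.arcs (Fin N)} (E : Presentation I D) (B : ℕ),
    (Finset.univ.sup fun x => (D.bag x).card) ≤ B →
      DecidesWithin solve E (K * (2 ^ (B + 2) ^ 2) ^ e * (n + N)) := by
  classical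
  obtain ⟨K₁, e₁, c₁⟩ := measure.bound_le_of_linear [3, 5] [] rfl rfl
  obtain ⟨K₂, e₂, c₂⟩ := power.bound_le_of_linear [5, 6, 7] [5, 6, 7] rfl rfl
  obtain ⟨K₃, e₃, c₃⟩ := fill.bound_le_of_linear [0, 1, 3, 5, 6, 7, 9] [5, 6, 7] rfl rfl
  obtain ⟨K₄, e₄, c₄⟩ := (assign 0 answerT).bound_le_of_linear [5] [5] rfl rfl
  refine ⟨K₁ + K₂ + 2 + K₃ + K₄, e₁ + e₂ + e₃ + e₄, fun {n N I D} E B hB => ?_⟩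
  have hN : 1 ≤ N := by have := D.root.2; omega
  -- the abstract run
  set s0 := E.init with hs0
  have i0 : s0.reg 0 = n := rfl
  have i1 : s0.reg 1 = E.arcList.length := rfl
  have i2 : s0.reg 2 = I.k := rfl
  have i3 : s0.reg 3 = N := rfl
  have i4 : s0.reg 4 = D.root := rfl
  have i5 : s0.reg 5 = 0 := rfl
  have i7 : s0.reg 7 = 0 := rfl
  set s1 := measure.run s0 with hs1
  have q1 : ∀ r ∈ [0, 1, 2, 3, 4, 5], s1.reg r = s0.reg r := fun r hr => run_reg _ rfl hr s0
  obtain ⟨hbB, hbag, g8, g6, g9⟩ := measure_run s0 B i7 fun x _ => by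
    rw [hs0, E.init_size]; exact (E.length_bagAt_le x).trans hB
  rw [← hs1] at hbB hbag g8 g6 g9
  set b := s1.reg 7 with hb
  set s2 := power.run s1 with hs2
  have q2 : ∀ r ∈ [0, 1, 2, 3, 4, 5, 6, 7, 8, 9], s2.reg r = s1.reg r :=
    fun r hr => run_reg _ rfl hr s1
  have g17 : s2.reg 17 = 2 ^ (b * (b + 2)) := by rw [hs2, power_run, ← hb, g6]
  set s3 := s2.setReg 5 (s2.reg 17) with hs3
  have q3 : ∀ r, r ≠ 5 → s3.reg r = s2.reg r := fun r hr => by simp [hs3, hr]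
  have q5 : s3.reg 5 = 2 ^ (b * (b + 2)) := by simp [hs3, g17]
  have m3 : s3.mem = s0.mem := by
    funext a
    rw [hs3, State.setReg_mem, hs2, run_mem _ rfl, hs1, run_mem _ rfl]
  have v0 : s3.reg 0 = n := by rw [q3 0 (by decide), q2 0 (by simp), q1 0 (by simp), i0]
  have v1 : s3.reg 1 = E.arcList.length := by
    rw [q3 1 (by decide), q2 1 (by simp), q1 1 (by simp), i1]
  have v2 : s3.reg 2 = I.k := by rw [q3 2 (by decide), q2 2 (by simp), q1 2 (by simp), i2]
  have v3 : s3.reg 3 = N := by rw [q3 3 (by decide), q2 3 (by simp), q1 3 (by simp), i3]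
  have v4 : s3.reg 4 = D.root := by rw [q3 4 (by decide), q2 4 (by simp), q1 4 (by simp), i4]
  have v6 : s3.reg 6 = b + 2 := by rw [q3 6 (by decide), q2 6 (by simp), g6]
  have v7 : s3.reg 7 = b := by rw [q3 7 (by decide), q2 7 (by simp)]
  have v8 : s3.reg 8 = b + 1 := by rw [q3 8 (by decide), q2 8 (by simp), g8]
  have v9 : s3.reg 9 = N + 1 := by rw [q3 9 (by decide), q2 9 (by simp), g9, i3]
  have hlen : ∀ x, (E.bagAt x).length ≤ b := fun x => by
    by_cases hx : x < N
    · rw [← E.init_size]; exact hbag x (by rw [i3]; exact hx)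
    · simp [Presentation.bagAt, hx]
  have hprep := prepared_prepare (E := E) m3 v0 v1 v2 v3 v4 q5 v6 v7 v8 v9 hlen
  have hprog := progress_fill hprep fun x => by
    rw [run_mem prepare rfl, m3]; rfl
  set s4 := fill.run s3 with hs4
  have hans := hprog.eval_answerT
  obtain ⟨T, σ, hx, hT, hout⟩ := exec_solve s0
  replace hout : σ.reg 0 = if I.IsYes then 1 else 0 := hout.trans hans
  replace hT : T ≤ measure.bound s0.reg + (power.bound s1.reg + (2 + (fill.bound s3.reg +
    (assign 0 answerT).bound s4.reg))) := hT
  refine ⟨T, σ, hx, hT.trans ?_, fun h => by rw [hout, if_pos h], fun h => by rw [hout, if_neg h]⟩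
  clear hT hout hx hans hprog hprep
  -- the running time
  set Z := 2 ^ (B + 2) ^ 2 with hZ
  set W := n + N with hW
  have hW1 : 1 ≤ W := by omega
  have hBZ : (B + 2) ^ 2 < Z := Nat.lt_two_pow_self
  have hMZ : 2 ^ (b * (b + 2)) + 2 ≤ Z := two_pow_add_two_le hbB
  have hbZ : b + 2 ≤ Z := by
    have := Nat.le_self_pow (n := 2) (by decide) (B + 2)
    omega
  have hWZ : ∀ {x}, x ≤ W → x ≤ W * Z := fun h => h.trans (Nat.le_mul_of_pos_right _ (by omega))
  have hZW : ∀ {x}, x ≤ Z → x ≤ W * Z := fun h => h.trans (Nat.le_mul_of_pos_left _ hW1)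
  have b₁ := c₁ s0.reg Z W (by rw [i5]; omega) (by simp) hW1
    (by simp only [List.forall_mem_cons, i3, i5]; exact ⟨hWZ (by omega), by simp⟩)
  have b₂ := c₂ s1.reg Z W (by rw [q1 5 (by simp), i5]; omega)
    (by simp only [List.forall_mem_cons, q1 5 (by simp), i5, g6, ← hb]; simp; omega) hW1
    (by
      simp only [List.forall_mem_cons, q1 5 (by simp), i5, g6, ← hb]
      exact ⟨by simp, hZW hbZ, hZW (by omega), by simp⟩)
  have hm : E.arcList.length ≤ W * Z := E.length_arcList_le.trans (Nat.mul_le_mul (by omega)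
    ((Nat.pow_le_pow_left (hB.trans (by omega)) 2).trans hBZ.le))
  have b₃ := c₃ s3.reg Z W (by rw [q5]; exact hMZ)
    (by simp only [List.forall_mem_cons, q5, v6, v7]; simp; omega) hW1
    (by
      simp only [List.forall_mem_cons, v0, v1, v3, q5, v6, v7, v9]
      refine ⟨hWZ (by omega), hm, hWZ (by omega), hZW (by omega), hZW hbZ, hZW (by omega), ?_,
        by simp⟩
      calc N + 1 ≤ W * 2 := by omega
        _ ≤ W * Z := Nat.mul_le_mul_left _ (by omega))
  have v5 : s4.reg 5 = 2 ^ (b * (b + 2)) := by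
    rw [hs4, run_reg (L := [0, 1, 3, 5, 6, 7, 9]) fill rfl (by simp), q5]
  have b₄ := c₄ s4.reg Z W (by rw [v5]; exact hMZ) (by simp [v5]; omega) hW1
    (by simp only [List.forall_mem_cons, v5]; exact ⟨hZW (by omega), by simp⟩)
  have hpow : ∀ K e, e ≤ e₁ + e₂ + e₃ + e₄ → K * Z ^ e * W ≤ K * (Z ^ (e₁ + e₂ + e₃ + e₄) * W) :=
    fun K e he => by
      rw [mul_assoc]
      exact Nat.mul_le_mul_left _ (Nat.mul_le_mul_right _ (Nat.pow_le_pow_right (by omega) he))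
  have p₁ := hpow K₁ e₁ (by omega)
  have p₂ := hpow K₂ e₂ (by omega)
  have p₃ := hpow K₃ e₃ (by omega)
  have p₄ := hpow K₄ e₄ (by omega)
  have hone : 1 * 1 ≤ Z ^ (e₁ + e₂ + e₃ + e₄) * W :=
    Nat.mul_le_mul (Nat.one_le_pow _ _ (by omega)) hW1
  rw [mul_assoc]
  simp only [Nat.add_mul]
  omega

/-- The running time bound `2 ^ (O(t ^ 2)) * (n + N)`. -/
theorem solve_decidesWithin : ∃ C : ℕ, ∀ (n N t : ℕ) (I : Problem (Fin n))
    (D : TreeDecomposition I.arcs (Fin N)) (E : Presentation I D),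
    D.width = t → DecidesWithin solve E (2 ^ (C * (t ^ 2 + 1)) * (n + N)) := by
  obtain ⟨K, e, h⟩ := solve_decides
  refine ⟨K + 12 * e, fun n N t I D E ht => ?_⟩
  obtain ⟨T, s, hx, hT, hs⟩ := h E (t + 1) (by unfold TreeDecomposition.width at ht; omega)
  refine ⟨T, s, hx, hT.trans (Nat.mul_le_mul_right _ ?_), hs⟩
  have h1 : K ≤ 2 ^ (K * (t ^ 2 + 1)) := Nat.lt_two_pow_self.le.trans
    (Nat.pow_le_pow_right (by decide) (Nat.le_mul_of_pos_right _ (by omega)))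
  have h2 : (t + 1 + 2) ^ 2 ≤ 12 * (t ^ 2 + 1) := by
    rcases Nat.eq_zero_or_pos t with rfl | h
    · norm_num
    · nlinarith
  have h3 : (2 ^ (t + 1 + 2) ^ 2) ^ e ≤ 2 ^ (12 * e * (t ^ 2 + 1)) := by
    rw [← pow_mul]
    refine Nat.pow_le_pow_right (by decide) ((Nat.mul_le_mul_right e h2).trans_eq (by ring))
  rw [Nat.add_mul, pow_add]
  exact Nat.mul_le_mul h1 h3

end DAGPart

theorem mainTheorem3 :
    ∃ P : DAGPart.Cmd,
      (∃ C : ℕ, ∀ (n N t : ℕ) (I : DAGPart.Problem (Fin n))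
        (D : DAGPart.TreeDecomposition I.arcs (Fin N)) (E : DAGPart.Presentation I D),
        D.width = t → DAGPart.DecidesWithin P E (2 ^ (C * (t ^ 2 + 1)) * (n + N))) ∧
      (∀ a : ℕ, ∃ C : ℕ, ∀ (n N t : ℕ) (I : DAGPart.Problem (Fin n))
        (D : DAGPart.TreeDecomposition I.arcs (Fin N)) (E : DAGPart.Presentation I D),
        D.width = t → N ≤ a * (t + 1) * n →
          DAGPart.DecidesWithin P E (2 ^ (C * (t ^ 2 + 1)) * n)) := by
  obtain ⟨C, h⟩ := DAGPart.solve_decidesWithin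
  refine ⟨DAGPart.solve, ⟨C, h⟩, fun a => ⟨C + (1 + 2 * a), fun n N t I D E ht hN => ?_⟩⟩
  obtain ⟨T, s, hx, hT, hs⟩ := h n N t I D E ht
  refine ⟨T, s, hx, hT.trans ?_, hs⟩
  -- the factor `1 + a * (t + 1)` is absorbed into the exponential
  have h1 : t + 1 ≤ 2 * (t ^ 2 + 1) := by nlinarith
  have h2 : 1 + a * (t + 1) ≤ 2 ^ ((1 + 2 * a) * (t ^ 2 + 1)) := by
    refine le_trans ?_ Nat.lt_two_pow_self.le
    have := Nat.mul_le_mul_left a h1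
    nlinarith
  rw [Nat.add_mul, pow_add, mul_assoc]
  refine Nat.mul_le_mul_left _ ?_
  calc n + N ≤ (1 + a * (t + 1)) * n := by rw [Nat.add_mul]; omega
    _ ≤ 2 ^ ((1 + 2 * a) * (t ^ 2 + 1)) * n := Nat.mul_le_mul_right _ h2
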